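/- **Setting.** Let $n\ge 1$ and let $(M,\langle\cdot,\cdot\rangle,\varphi,\zeta)$ be an almost contact metric manifold of dimension $2n+1$: $M$ is a smooth Riemannian manifold, $\varphi$ a smooth field of endomorphisms, $\zeta$ a smooth unit vector field, and with $\eta=\zeta^\flat$ one has $\varphi^2=-\mathrm{Id}+\eta\otimes\zeta$ and $\langle\varphi X,\varphi Y\rangle=\langle X,Y\rangle-\eta(X)\eta(Y)$. Put $F(X,Y)=\langle X,\varphi Y\rangle$ and $X_{\zeta^\perp}=X-\eta(X)\zeta$; $\nabla$ is the Levi-Civita connection, $\{e_i\}$ a local orthonormal frame of $TM$, and repeated indices are summed. *Conventions.* $(\alpha\wedge\beta)(X,Y)=\alpha(X)\beta(Y)-\beta(X)\alpha(Y)$; $d\alpha(X,Y)=X\alpha(Y)-Y\alpha(X)-\alpha([X,Y])$ for one-forms; $(\varphi\alpha)(X)=-\alpha(\varphi X)$; $\beta_{[[\lambda^{2,0}]]}(X,Y)=\frac12\big(\beta(\varphi^2X,\varphi^2Y)-\beta(\varphi X,\varphi Y)\big)$ for two-forms; $R_{X,Y}=\nabla_{[X,Y]}-[\nabla_X,\nabla_Y]$;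 $\mathrm{Ric}^*(X,Y)=\langle R_{e_i,X}\varphi e_i,\varphi Y\rangle$; $\mathrm{Ric}^*_{\rm alt}(X,Y)=\frac12(\mathrm{Ric}^*(X,Y)-\mathrm{Ric}^*(Y,X))$; $\langle\mathrm{Ric}^*(\zeta),X\rangle=\mathrm{Ric}^*(\zeta,X)$; $d^*\eta=-(\nabla_{e_i}\eta)(e_i)$; $d^*F(Y)=-(\nabla_{e_i}F)(e_i,Y)$. *Intrinsic torsion.* $\xi_XY=-\frac12\varphi((\nabla_X\varphi)Y)+(\nabla_X\eta)(Y)\zeta-\frac12\eta(Y)\nabla_X\zeta$, $\nabla^{U(n)}=\nabla+\xi$, and $d^*\xi=-(\nabla_{e_i}\xi)_{e_i}$. The structure is *harmonic* if $d^*\xi=0$. Put $(\xi_X\eta)(Y)=-\eta(\xi_XY)$, and likewise for the components of $\xi$ below. The Lee form $\theta$ is defined by $(n-1)\theta^\sharp=-\varphi(d^*F)^\sharp+\nabla_\zeta\zeta$ for $n>1$ and $\theta=0$ for $n=1$. *Components.* $\xi=\sum_{i=1}^{12}\xi_{(i)}$ is the decomposition into the twelve Chinea–González-Dávila modules $\mathcal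 C_1,\dots,\mathcal C_{12}$ (orthogonal and $U(n)$-invariant), as follows. - $\xi_{(1)}+\dots+\xi_{(4)}$ is $(X,Y)\mapsto(\xi_{X_{\zeta^\perp}}Y_{\zeta^\perp})_{\zeta^\perp}$. Its part with $T_{\varphi X}\varphi Y=-T_XY$ for $X,Y\perp\zeta$ is $\xi_{(1)}+\xi_{(2)}$, where $\xi_{(1)}$ is the totally skew-symmetric part. Its part with $T_{\varphi X}\varphi Y=T_XY$ for $X,Y\perp\zeta$ is $\xi_{(3)}+\xi_{(4)}$, where $\xi_{(4)X}Y=\frac14\big(\langle X,Y\rangle\theta^\sharp-\theta(Y)X-\langle\varphi X,Y\rangle\varphi\theta^\sharp+\langle\varphi\theta^\sharp,Y\rangle\varphi X\big)$ for $X,Y\perp\zeta$. - For $i=5,\dots,10$, $\xi_{(i)X}Y=\eta(Y)L_iX-\langle L_iX,Y\rangle\zeta$, where $L_5+\dots+L_{10}=L$, $LX=(\xi_{X_{\zeta^\perp}}\zeta)_{\zeta^\perp}$. On $\zeta^\perp$, $L_5$ is the multiple-of-identity part, $L_6$ the multiple-of-$\varphi$ part, $L_7$ the part that is skew-symmetric,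 commutes with $\varphi$ and is orthogonal to $\varphi$, $L_8$ the part that is symmetric, trace-free and commutes with $\varphi$, and $L_9$ and $L_{10}$ the symmetric and skew-symmetric parts that anticommute with $\varphi$. - $\xi_{(11)X}Y=\eta(X)(\xi_\zeta Y_{\zeta^\perp})_{\zeta^\perp}$ and $\xi_{(12)X}Y=\eta(X)\big(\eta(Y)\xi_\zeta\zeta-\langle\xi_\zeta\zeta,Y\rangle\zeta\big)$. $M$ is of type $\bigoplus_{i\in I}\mathcal C_i$ if $\xi=\sum_{i\in I}\xi_{(i)}$. Put $\mathcal A=\mathcal C_1\oplus\mathcal C_2$, $\mathcal B=\mathcal C_3\oplus\mathcal C_4$, $\mathcal C=\mathcal C_5\oplus\dots\oplus\mathcal C_8$, $\mathcal D=\mathcal C_9\oplus\mathcal C_{10}$, $\mathcal E=\mathcal C_{11}\oplus\mathcal C_{12}$, and $W=\frac14\big(\xi_\zeta\eta\wedge\theta-\varphi\,\xi_\zeta\eta\wedge\varphi\theta\big)$. **Theorem.** **(i)** If $M$ is of type $\mathcal A\oplus\mathcal C_4\oplus\mathcal C\oplus\mathcal E$, then the structure is harmonic if and only if, for all vector fields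 $X,Y$, $$\begin{aligned}\mathrm{Ric}^*_{\rm alt}(X_{\zeta^\perp},Y_{\zeta^\perp})={}&d\theta_{[[\lambda^{2,0}]]}(X,Y)+(n-3)\langle\xi_{(1)\theta^\sharp}X,Y\rangle+n\langle\xi_{(2)\theta^\sharp}X,Y\rangle-d^*\eta\,\langle\xi_{(11)\zeta}X,Y\rangle\\&-d^*F(\zeta)\langle\xi_{(11)\zeta}\varphi X,Y\rangle+\langle(\nabla^{U(n)}_\zeta\xi_{(11)})_\zeta X,Y\rangle\\&+\langle\xi_{(1)\xi_{(12)\zeta}\zeta}X,Y\rangle+\langle\xi_{(2)\xi_{(12)\zeta}\zeta}X,Y\rangle+W(X,Y)\end{aligned}$$ and $$\begin{aligned}\mathrm{Ric}^*(\zeta)={}&-(\zeta\lrcorner d\xi_\zeta\eta)^\sharp-\tfrac{n-1}{4n}d^*\eta\,\theta^\sharp-\tfrac{2n-1}2\xi_{(8)\theta^\sharp}\zeta-\tfrac{3(n-1)}{4n}d^*F(\zeta)\varphi\theta^\sharp-\tfrac{2n-3}2\xi_{(7)\theta^\sharp}\zeta\\&+\tfrac{n-1}n d^*\eta\,\xi_\zeta\zeta-2\xi_{(8)\xi_\zeta\zeta}\zeta+d^*F(\zeta)\varphi\xi_\zeta\zeta-\xi_{(11)\zeta}\xi_{(12)\zeta}\zeta.\end{aligned}$$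 **(ii)** If $M$ is of type $\mathcal A\oplus\mathcal C_4\oplus\mathcal D\oplus\mathcal E$, then the structure is harmonic if and only if, for all vector fields $X,Y$, $$\begin{aligned}\mathrm{Ric}^*_{\rm alt}(X_{\zeta^\perp},Y_{\zeta^\perp})={}&d\theta_{[[\lambda^{2,0}]]}(X,Y)+(n-3)\langle\xi_{(1)\theta^\sharp}X,Y\rangle+n\langle\xi_{(2)\theta^\sharp}X,Y\rangle+\langle(\nabla^{U(n)}_\zeta\xi_{(11)})_\zeta X,Y\rangle\\&+\langle\xi_{(1)\xi_{(12)\zeta}\zeta}X,Y\rangle+\langle\xi_{(2)\xi_{(12)\zeta}\zeta}X,Y\rangle+W(X,Y)\end{aligned}$$ and $$\begin{aligned}\mathrm{Ric}^*(\zeta)={}&(\zeta\lrcorner d\xi_\zeta\eta)^\sharp-\xi_{(1)e_i}\xi_{(10)e_i}\zeta-\xi_{(2)e_i}(\xi_{(9)e_i}\zeta+\xi_{(10)e_i}\zeta)+(n-1)\xi_{(9)\theta^\sharp}\zeta\\&+(n-1)\xi_{(10)\theta^\sharp}\zeta+2\xi_{(9)\xi_\zeta\zeta}\zeta+\xi_{(11)\zeta}\xi_{(12)\zeta}\zeta.\end{aligned}$$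 **(iii)** If $M$ is of type $\mathcal B\oplus\mathcal C\oplus\mathcal E$, then the structure is harmonic if and only if, for all vector fields $X,Y$, $$\begin{aligned}\mathrm{Ric}^*_{\rm alt}(X_{\zeta^\perp},Y_{\zeta^\perp})={}&-(n-1)\langle\xi_{(3)\theta^\sharp}X,Y\rangle-\langle(\nabla^{U(n)}_\zeta\xi_{(11)})_\zeta X,Y\rangle-\langle\xi_{(3)\xi_\zeta\zeta}X,Y\rangle-W(X,Y)\\&+d^*\eta\,\langle\xi_{(11)\zeta}X,Y\rangle-d^*F(\zeta)\langle\xi_{(11)\zeta}\varphi X,Y\rangle\end{aligned}$$ and $$\begin{aligned}\mathrm{Ric}^*(\zeta)={}&-(\zeta\lrcorner d\xi_\zeta\eta)^\sharp-P_8-P_7-\tfrac{n-1}{4n}d^*\eta\,\theta^\sharp-\tfrac{2n-1}2\xi_{(8)\theta^\sharp}\zeta-\tfrac{3(n-1)}{4n}d^*F(\zeta)\varphi\theta^\sharp-\tfrac{2n-3}2\xi_{(7)\theta^\sharp}\zeta\\&+\tfrac{n-1}n d^*\eta\,\xi_\zeta\zeta-2\xi_{(8)\xi_\zeta\zeta}\zeta+d^*F(\zeta)\varphi\xi_\zeta\zeta-\xi_{(11)\zeta}\xi_{(12)\zeta}\zeta,\end{aligned}$$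 where $P_a=\langle\xi_{(a)e_i}\zeta,e_k\rangle\,\langle\xi_{(3)e_i}e_j,e_k\rangle\,e_j$. If in this case the structure is harmonic, then for all vector fields $X,Y$ $$\begin{aligned}\langle(\nabla^{U(n)}_\zeta\xi_{(11)})_\zeta X,Y\rangle={}&-\tfrac{n-1}2d\theta_{[[\lambda^{2,0}]]}(X,Y)-(n-1)\langle\xi_{(3)\theta^\sharp}X,Y\rangle-\langle\xi_{(3)\xi_\zeta\zeta}X,Y\rangle-W(X,Y)\\&+d^*\eta\,\langle\xi_{(11)\zeta}X,Y\rangle-\tfrac{n-2}n d^*F(\zeta)\langle\xi_{(11)\zeta}\varphi X,Y\rangle\\&-2(\xi_{(7)X}\eta)(\xi_{(11)\zeta}Y)+2(\xi_{(7)Y}\eta)(\xi_{(11)\zeta}X).\end{aligned}$$ **(iv)** If $M$ is of type $\mathcal B\oplus\mathcal D\oplus\mathcal E$, then the structure is harmonic if and only if, for all vector fields $X,Y$, $$\mathrm{Ric}^*_{\rm alt}(X_{\zeta^\perp},Y_{\zeta^\perp})=-(n-1)\langle\xi_{(3)\theta^\sharp}X,Y\rangle-\langle(\nabla^{U(n)}_\zeta\xi_{(11)})_\zeta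 X,Y\rangle-\langle\xi_{(3)\xi_\zeta\zeta}X,Y\rangle-W(X,Y)$$ and $$\mathrm{Ric}^*(\zeta)=(\zeta\lrcorner d\xi_\zeta\eta)^\sharp+(n-1)\xi_{(9)\theta^\sharp}\zeta+(n-1)\xi_{(10)\theta^\sharp}\zeta+2\xi_{(9)\xi_\zeta\zeta}\zeta+\xi_{(11)\zeta}\xi_\zeta\zeta.$$ If in this case the structure is harmonic, then for all vector fields $X,Y$ $$\langle(\nabla^{U(n)}_\zeta\xi_{(11)})_\zeta X,Y\rangle=-\tfrac{n-1}2d\theta_{[[\lambda^{2,0}]]}(X,Y)-(n-1)\langle\xi_{(3)\theta^\sharp}X,Y\rangle-\langle\xi_{(3)\xi_\zeta\zeta}X,Y\rangle-W(X,Y).$$ -/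

import Mathlib

open Bundle Manifold VectorField
open scoped ContDiff Topology

namespace ACM
noncomputable section

/-! ## The Levi-Civita connection of a Riemannian manifold -/

section LeviCivita

variable {E : Type*} [NormedAddCommGroup E] [NormedSpace ℝ E] [FiniteDimensional ℝ E]
  {H : Type*} [TopologicalSpace H] (I : ModelWithCorners ℝ E H)
  {M : Type*} [TopologicalSpace M] [ChartedSpace H M] [IsManifold I ∞ M]
  [RiemannianBundle (fun x : M ↦ TangentSpace I x)]
  [IsContMDiffRiemannianBundle I ∞ E (fun x : M ↦ TangentSpace I x)]

instance finDimTangent (x : M) : FiniteDimensional ℝ (TangentSpace I x) :=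
  inferInstanceAs (FiniteDimensional ℝ E)

/-- The right-hand side of the Koszul formula, `⟨∇_X Y, Z⟩`. -/
def koszul (X Y Z : Π x : M, TangentSpace I x) (x : M) : ℝ :=
  (1 / 2 : ℝ) *
    (mvfderiv I (fun y ↦ inner ℝ (Y y) (Z y)) x (X x)
      + mvfderiv I (fun y ↦ inner ℝ (X y) (Z y)) x (Y x)
      - mvfderiv I (fun y ↦ inner ℝ (X y) (Y y)) x (Z x)
      + inner ℝ (mlieBracket I X Y x) (Z x)
      - inner ℝ (mlieBracket I X Z x) (Y x)
      - inner ℝ (mlieBracket I Y Z x) (X x))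

variable {I}

theorem mdiffAt_inner {X Y : Π x : M, TangentSpace I x} {x : M}
    (hX : MDiffAt (T% X) x) (hY : MDiffAt (T% Y) x) :
    MDiffAt (fun y ↦ inner ℝ (X y) (Y y)) x := by
  have : IsContMDiffRiemannianBundle I 1 E (fun x : M ↦ TangentSpace I x) :=
    IsContMDiffRiemannianBundle.of_le (n := ∞) (by simp)
  exact MDifferentiableAt.inner_bundle (E := fun x : M ↦ TangentSpace I x) (F := E) (b := id) hX hY

theorem koszul_tensorial_left {Y Z : Π x : M, TangentSpace I x} {x : M}
    (hY : MDiffAt (T% Y) x) (hZ : MDiffAt (T% Z) x) :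
    TensorialAt I E (fun X : Π x : M, TangentSpace I x ↦ koszul I X Y Z x) x where
  smul {f X} hf hX := by
    have h1 := mvfderiv_fun_mul hf (mdiffAt_inner hX hZ)
    have h2 := mvfderiv_fun_mul hf (mdiffAt_inner hX hY)
    simp only [koszul, Pi.smul_apply', real_inner_smul_left, real_inner_smul_right,
      mlieBracket_smul_left hf hX, h1, h2, map_smul, inner_add_left]
    simp [real_inner_comm]
    ring
  add {X X'} hX hX' := by
    have h1 := mvfderiv_fun_add (mdiffAt_inner hX hZ) (mdiffAt_inner hX' hZ)
    have h2 := mvfderiv_fun_add (mdiffAt_inner hX hY) (mdiffAt_inner hX' hY)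
    simp only [koszul, Pi.add_apply, inner_add_left, inner_add_right,
      mlieBracket_add_left hX hX', h1, h2, map_add]
    simp
    ring

theorem koszul_tensorial_right {X Y : Π x : M, TangentSpace I x} {x : M}
    (hX : MDiffAt (T% X) x) (hY : MDiffAt (T% Y) x) :
    TensorialAt I E (fun Z : Π x : M, TangentSpace I x ↦ koszul I X Y Z x) x where
  smul {f Z} hf hZ := by
    have h1 := mvfderiv_fun_mul hf (mdiffAt_inner hX hZ)
    have h2 := mvfderiv_fun_mul hf (mdiffAt_inner hY hZ)
    simp only [koszul, Pi.smul_apply', real_inner_smul_left, real_inner_smul_right,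
      mlieBracket_smul_right hf hZ, h1, h2, map_smul, inner_add_left]
    simp [real_inner_comm]
    ring
  add {Z Z'} hZ hZ' := by
    have h1 := mvfderiv_fun_add (mdiffAt_inner hX hZ) (mdiffAt_inner hX hZ')
    have h2 := mvfderiv_fun_add (mdiffAt_inner hY hZ) (mdiffAt_inner hY hZ')
    simp only [koszul, Pi.add_apply, inner_add_left, inner_add_right,
      mlieBracket_add_right hZ hZ', h1, h2, map_add]
    simp
    ring


variable (I) in
open Classical in
/-- `leviCivitaFun I Y x u` is the vector `∇_u Y` at `x` determined by the Koszul formula. -/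
def leviCivitaFun (Y : Π x : M, TangentSpace I x) (x : M) :
    TangentSpace I x →L[ℝ] TangentSpace I x :=
  if hY : MDiffAt (T% Y) x then
    ∑ i, ContinuousLinearMap.smulRight
      ((TensorialAt.mkHom₂ (F := E) (F' := E) (fun X Z ↦ koszul I X Y Z x) x
        (fun _ hZ ↦ koszul_tensorial_left hY hZ)
        (fun _ hX ↦ koszul_tensorial_right hX hY)).flip
          (stdOrthonormalBasis ℝ (TangentSpace I x) i))
      (stdOrthonormalBasis ℝ (TangentSpace I x) i)
  else 0

theorem inner_leviCivitaFun {X Y Z : Π x : M, TangentSpace I x} {x : M}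
    (hX : MDiffAt (T% X) x) (hY : MDiffAt (T% Y) x) (hZ : MDiffAt (T% Z) x) :
    inner ℝ (leviCivitaFun I Y x (X x)) (Z x) = koszul I X Y Z x := by
  rw [leviCivitaFun, dif_pos hY]
  set K := TensorialAt.mkHom₂ (F := E) (F' := E) (fun X Z ↦ koszul I X Y Z x) x
        (fun _ hZ ↦ koszul_tensorial_left hY hZ)
        (fun _ hX ↦ koszul_tensorial_right hX hY) with hK
  have h1 : K (X x) (Z x) = koszul I X Y Z x := by
    rw [hK]
    exact TensorialAt.mkHom₂_apply _ _ hX hZ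
  rw [← h1]
  conv_rhs => rw [← (stdOrthonormalBasis ℝ (TangentSpace I x)).sum_repr' (Z x)]
  simp only [sum_apply, ContinuousLinearMap.smulRight_apply,
    ContinuousLinearMap.flip_apply, sum_inner, real_inner_smul_left, map_sum, map_smul, smul_eq_mul]
  exact Finset.sum_congr rfl fun i _ ↦ mul_comm _ _

theorem leviCivitaFun_ext {x : M} {A B : TangentSpace I x →L[ℝ] TangentSpace I x}
    (h : ∀ X Z : Π x : M, TangentSpace I x, MDiffAt (T% X) x → MDiffAt (T% Z) x →
      inner ℝ (A (X x)) (Z x) = inner ℝ (B (X x)) (Z x)) : A = B := by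
  ext u
  refine ext_inner_right ℝ fun z ↦ ?_
  have := h (FiberBundle.extend E u) (FiberBundle.extend E z)
    (FiberBundle.mdifferentiableAt_extend ..) (FiberBundle.mdifferentiableAt_extend ..)
  simpa using this

theorem isCovariantDerivativeOn_leviCivitaFun :
    IsCovariantDerivativeOn E (leviCivitaFun I (M := M)) Set.univ where
  add {Y Y' x} hY hY' _ := by
    refine leviCivitaFun_ext fun X Z hX hZ ↦ ?_
    have h1 := mvfderiv_fun_add (mdiffAt_inner hY hZ) (mdiffAt_inner hY' hZ)
    have h2 := mvfderiv_fun_add (mdiffAt_inner hX hY) (mdiffAt_inner hX hY')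
    rw [inner_leviCivitaFun hX (mdifferentiableAt_add_section hY hY') hZ,
      add_apply, inner_add_left, inner_leviCivitaFun hX hY hZ,
      inner_leviCivitaFun hX hY' hZ]
    simp only [koszul, Pi.add_apply, inner_add_left, inner_add_right,
      mlieBracket_add_left hY hY', mlieBracket_add_right hY hY', h1, h2, map_add]
    simp
    ring
  leibniz {Y f x} hY hf _ := by
    refine leviCivitaFun_ext fun X Z hX hZ ↦ ?_
    have h1 := mvfderiv_fun_mul hf (mdiffAt_inner hY hZ)
    have h2 := mvfderiv_fun_mul hf (mdiffAt_inner hX hY)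
    rw [inner_leviCivitaFun hX (hf.smul_section hY) hZ]
    simp only [add_apply, inner_add_left, smul_apply,
      real_inner_smul_left, ContinuousLinearMap.smulRight_apply, inner_leviCivitaFun hX hY hZ]
    simp only [koszul, Pi.smul_apply', real_inner_smul_left, real_inner_smul_right,
      mlieBracket_smul_left hf hY, mlieBracket_smul_right hf hY, h1, h2, map_smul, inner_add_left]
    simp [real_inner_comm]
    ring

variable (I M) in
/-- The Levi-Civita connection: `leviCivita I M Y x u` is `∇_u Y` at `x`. It is the covariant
derivative that is torsion-free and metric, as the two facts below record. -/
def leviCivita : CovariantDerivative I E (TangentSpace I : M → Type _) :=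
  ⟨leviCivitaFun I, isCovariantDerivativeOn_leviCivitaFun⟩

theorem leviCivita_torsion : (leviCivita I M).torsion = 0 := by
  rw [CovariantDerivative.torsion_eq_zero_iff]
  intro X Y x hX hY
  refine ext_inner_right ℝ fun z ↦ ?_
  have hZ : MDiffAt (T% (FiberBundle.extend E z : Π y : M, TangentSpace I y)) x :=
    FiberBundle.mdifferentiableAt_extend ..
  have h1 := inner_leviCivitaFun hX hY hZ
  have h2 := inner_leviCivitaFun hY hX hZ
  simp only [FiberBundle.extend_apply_self] at h1 h2
  have hs := mlieBracket_swap_apply (I := I) (V := Y) (W := X) (x := x)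
  change inner ℝ (leviCivitaFun I Y x (X x) - leviCivitaFun I X x (Y x)) z = _
  rw [inner_sub_left, h1, h2]
  simp only [koszul, hs, inner_neg_left, FiberBundle.extend_apply_self, real_inner_comm]
  ring

theorem leviCivita_metric {X Y Z : Π x : M, TangentSpace I x} {x : M}
    (hX : MDiffAt (T% X) x) (hY : MDiffAt (T% Y) x) (hZ : MDiffAt (T% Z) x) :
    mvfderiv I (fun y ↦ inner ℝ (Y y) (Z y)) x (X x) =
      inner ℝ (leviCivita I M Y x (X x)) (Z x) + inner ℝ (Y x) (leviCivita I M Z x (X x)) := by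
  have h1 := inner_leviCivitaFun hX hY hZ
  have h2 := inner_leviCivitaFun hX hZ hY
  have hs := mlieBracket_swap_apply (I := I) (V := Z) (W := Y) (x := x)
  change _ = inner ℝ (leviCivitaFun I Y x (X x)) (Z x) + inner ℝ (Y x) (leviCivitaFun I Z x (X x))
  rw [real_inner_comm _ (Y x), h1, h2]
  have hsym : (fun y ↦ inner ℝ (Z y) (Y y)) = (fun y ↦ inner ℝ (Y y) (Z y)) := by
    funext y; exact real_inner_comm _ _
  simp only [koszul, hs, inner_neg_left, hsym]
  ring

end LeviCivita

/-! ## Algebra at a point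

`V` is a Euclidean space of dimension `2n + 1` with an almost contact metric structure `(φ, ζ)`, and
`T : V → V → V`, `(u, v) ↦ T_u v`, is a tensor such that every `T_u` is skew-symmetric and
orthogonal to the Lie algebra of `U(n) × 1`. The space of these tensors is the orthogonal sum of the
twelve `U(n)`-modules `C_1, …, C_12` of Chinea and González-Dávila; the projections to the
summands are written out explicitly. All sums run over an orthonormal basis of `V`. -/

section Algebra

variable {V : Type*} [NormedAddCommGroup V] [InnerProductSpace ℝ V] [FiniteDimensional ℝ V]

/-- The sum of `f e` over an orthonormal basis of `V`. -/
def basisSum {W : Type*} [AddCommMonoid W] (f : V → W) : W :=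
  ∑ i, f (stdOrthonormalBasis ℝ V i)

/-- The vector `α^♯` dual to the linear form `α`. -/
def sharp (α : V → ℝ) : V := basisSum fun e ↦ α e • e

/-- The projection `v_{ζ^⊥}` of `v` to the orthogonal complement of the unit vector `ζ`. -/
def hor (ζ v : V) : V := v - inner ℝ ζ v • ζ

/-- The part of `T` with all three arguments in `ζ^⊥`; it lies in `C_1 ⊕ C_2 ⊕ C_3 ⊕ C_4`. -/
def horPart (ζ : V) (T : V → V → V) (u v : V) : V := hor ζ (T (hor ζ u) (hor ζ v))

/-- The part of `horPart` with `T_{φ u} (φ v) = - T_u v`; it lies in `C_1 ⊕ C_2`. -/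
def antiPart (φ : V →L[ℝ] V) (ζ : V) (T : V → V → V) (u v : V) : V :=
  (1 / 2 : ℝ) • (horPart ζ T u v - horPart ζ T (φ u) (φ v))

/-- The part of `horPart` with `T_{φ u} (φ v) = T_u v`; it lies in `C_3 ⊕ C_4`. -/
def commPart (φ : V →L[ℝ] V) (ζ : V) (T : V → V → V) (u v : V) : V :=
  (1 / 2 : ℝ) • (horPart ζ T u v + horPart ζ T (φ u) (φ v))

/-- The component in `C_1`: the totally skew-symmetric part of `antiPart`. -/
def comp1 (φ : V →L[ℝ] V) (ζ : V) (T : V → V → V) (u v : V) : V :=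
  (1 / 3 : ℝ) • (antiPart φ ζ T u v - antiPart φ ζ T v u
    + sharp fun w ↦ inner ℝ (antiPart φ ζ T w u) v)

/-- The component in `C_2`. -/
def comp2 (φ : V →L[ℝ] V) (ζ : V) (T : V → V → V) (u v : V) : V :=
  antiPart φ ζ T u v - comp1 φ ζ T u v

/-- The vector `2 / (n - 1) * ∑ T_e e` with the sum over a basis of `ζ^⊥`, projected to `ζ^⊥`. -/
def traceVec (n : ℕ) (ζ : V) (T : V → V → V) : V :=
  (2 / ((n : ℝ) - 1)) • basisSum fun e ↦ horPart ζ T e e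

/-- The component in `C_4`, which is determined by `traceVec`. -/
def comp4 (n : ℕ) (φ : V →L[ℝ] V) (ζ : V) (T : V → V → V) (u v : V) : V :=
  let θ := traceVec n ζ T
  (1 / 4 : ℝ) • (inner ℝ (hor ζ u) v • θ - inner ℝ θ v • hor ζ u
    - inner ℝ (φ u) v • φ θ + inner ℝ (φ θ) v • φ u)

/-- The component in `C_3`. -/
def comp3 (n : ℕ) (φ : V →L[ℝ] V) (ζ : V) (T : V → V → V) (u v : V) : V :=
  commPart φ ζ T u v - comp4 n φ ζ T u v

/-- The endomorphism `u ↦ T_u ζ` of `ζ^⊥`, which determines the part in `C_5 ⊕ ⋯ ⊕ C_10`. -/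
def reebMap (ζ : V) (T : V → V → V) (u : V) : V := hor ζ (T (hor ζ u) ζ)

/-- The tensor `T` with `T_u ζ = L u` and `T_u v = - ⟨L u, v⟩ ζ` for `v` orthogonal to `ζ`. -/
def lift (ζ : V) (L : V → V) (u v : V) : V := inner ℝ ζ v • L u - inner ℝ (L u) v • ζ

/-- The transpose of an endomorphism. -/
def transp (L : V → V) (u : V) : V := sharp fun w ↦ inner ℝ (L w) u

/-- The part of `reebMap` commuting with `φ`. -/
def reebComm (φ : V →L[ℝ] V) (ζ : V) (T : V → V → V) (u : V) : V :=
  (1 / 2 : ℝ) • (reebMap ζ T u - φ (reebMap ζ T (φ u)))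

/-- The part of `reebMap` anticommuting with `φ`. -/
def reebAnti (φ : V →L[ℝ] V) (ζ : V) (T : V → V → V) (u : V) : V :=
  (1 / 2 : ℝ) • (reebMap ζ T u + φ (reebMap ζ T (φ u)))

/-- `C_5`: multiples of the identity. -/
def reeb5 (n : ℕ) (ζ : V) (T : V → V → V) (u : V) : V :=
  (basisSum (fun e ↦ inner ℝ (reebMap ζ T e) e) / (2 * n)) • hor ζ u

/-- `C_6`: multiples of `φ`. -/
def reeb6 (n : ℕ) (φ : V →L[ℝ] V) (ζ : V) (T : V → V → V) (u : V) : V :=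
  (basisSum (fun e ↦ inner ℝ (reebMap ζ T e) (φ e)) / (2 * n)) • φ u

/-- `C_7`: skew-symmetric, commuting with `φ`, orthogonal to `φ`. -/
def reeb7 (n : ℕ) (φ : V →L[ℝ] V) (ζ : V) (T : V → V → V) (u : V) : V :=
  (1 / 2 : ℝ) • (reebComm φ ζ T u - transp (reebComm φ ζ T) u) - reeb6 n φ ζ T u

/-- `C_8`: symmetric, commuting with `φ`, trace-free. -/
def reeb8 (n : ℕ) (φ : V →L[ℝ] V) (ζ : V) (T : V → V → V) (u : V) : V :=
  (1 / 2 : ℝ) • (reebComm φ ζ T u + transp (reebComm φ ζ T) u) - reeb5 n ζ T u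

/-- `C_9`: symmetric, anticommuting with `φ`. -/
def reeb9 (φ : V →L[ℝ] V) (ζ : V) (T : V → V → V) (u : V) : V :=
  (1 / 2 : ℝ) • (reebAnti φ ζ T u + transp (reebAnti φ ζ T) u)

/-- `C_10`: skew-symmetric, anticommuting with `φ`. -/
def reeb10 (φ : V →L[ℝ] V) (ζ : V) (T : V → V → V) (u : V) : V :=
  (1 / 2 : ℝ) • (reebAnti φ ζ T u - transp (reebAnti φ ζ T) u)

/-- The component in `C_11`: first argument along `ζ`, the others in `ζ^⊥`. -/
def comp11 (ζ : V) (T : V → V → V) (u v : V) : V :=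
  inner ℝ ζ u • hor ζ (T ζ (hor ζ v))

/-- The component in `C_12`, determined by `T_ζ ζ`. -/
def comp12 (ζ : V) (T : V → V → V) (u v : V) : V :=
  inner ℝ ζ u • lift ζ (fun _ ↦ hor ζ (T ζ ζ)) u v

/-- The component of `T` in `C_i`, for `1 ≤ i ≤ 12`. -/
def component (n : ℕ) (φ : V →L[ℝ] V) (ζ : V) (T : V → V → V) : ℕ → V → V → V
  | 1 => comp1 φ ζ T
  | 2 => comp2 φ ζ T
  | 3 => comp3 n φ ζ T
  | 4 => comp4 n φ ζ T
  | 5 => lift ζ (reeb5 n ζ T)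
  | 6 => lift ζ (reeb6 n φ ζ T)
  | 7 => lift ζ (reeb7 n φ ζ T)
  | 8 => lift ζ (reeb8 n φ ζ T)
  | 9 => lift ζ (reeb9 φ ζ T)
  | 10 => lift ζ (reeb10 φ ζ T)
  | 11 => comp11 ζ T
  | 12 => comp12 ζ T
  | _ => 0

/-- `(α ∧ β)(u, v) = α(u) β(v) - β(u) α(v)`. -/
def wedge (α β : V → ℝ) (u v : V) : ℝ := α u * β v - β u * α v

/-- The inner product `∑ A(e_i, e_k) B(e_i, e_k)` of two bilinear forms. -/
def formInner (A B : V → V → ℝ) : ℝ :=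
  basisSum fun e ↦ basisSum fun f ↦ A e f * B e f

/-- The component `½ (β(φ² u, φ² v) - β(φ u, φ v))` of a two-form `β` in `[[λ^{2,0}]]`: the
part on `ζ^⊥` with `β(φ u, φ v) = - β(u, v)`. -/
def lambda20 (φ : V →L[ℝ] V) (β : V → V → ℝ) (u v : V) : ℝ :=
  (1 / 2 : ℝ) * (β (φ (φ u)) (φ (φ v)) - β (φ u) (φ v))

end Algebra

/-! ## Covariant derivatives, curvature and exterior derivative -/

section Calculus

variable {E : Type*} [NormedAddCommGroup E] [NormedSpace ℝ E] [FiniteDimensional ℝ E]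
  {H : Type*} [TopologicalSpace H] (I : ModelWithCorners ℝ E H)
  {M : Type*} [TopologicalSpace M] [ChartedSpace H M] [IsManifold I ∞ M]

/-- An extension of the tangent vector `v` to a vector field that is smooth near its base point.
The tensorial expressions below do not depend on the choice of the extension. -/
def ext {x : M} (v : TangentSpace I x) : Π y : M, TangentSpace I y :=
  FiberBundle.extend E v

/-- The covariant derivative `(D_u A)_v w` of a tensor field `A`, `(v, w) ↦ A_v w`, for the
connection `D`, where `D σ x u` stands for `D_u σ` at `x`. -/
def covTensor (D : (Π y : M, TangentSpace I y) → Π y : M, TangentSpace I y → TangentSpace I y)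
    (A : Π x : M, TangentSpace I x → TangentSpace I x → TangentSpace I x)
    (x : M) (u v w : TangentSpace I x) : TangentSpace I x :=
  D (fun y ↦ A y (ext I v y) (ext I w y)) x u
    - A x (D (ext I v) x u) w - A x v (D (ext I w) x u)

/-- The exterior derivative `dα(U, V) = U(α(V)) - V(α(U)) - α([U, V])` of a one-form. -/
def extDeriv1 (α : Π x : M, TangentSpace I x → ℝ) (x : M) (u v : TangentSpace I x) : ℝ :=
  mvfderiv I (fun y ↦ α y (ext I v y)) x u - mvfderiv I (fun y ↦ α y (ext I u y)) x v
    - α x (mlieBracket I (ext I u) (ext I v) x)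

variable [RiemannianBundle (fun x : M ↦ TangentSpace I x)]
  [IsContMDiffRiemannianBundle I ∞ E (fun x : M ↦ TangentSpace I x)]

/-- The curvature with the sign convention `R_{U,V} = ∇_{[U,V]} - [∇_U, ∇_V]`. -/
def curvature (x : M) (u v w : TangentSpace I x) : TangentSpace I x :=
  leviCivita I M (ext I w) x (mlieBracket I (ext I u) (ext I v) x)
    - leviCivita I M (fun y ↦ leviCivita I M (ext I w) y (ext I v y)) x u
    + leviCivita I M (fun y ↦ leviCivita I M (ext I w) y (ext I u y)) x v

end Calculus

/-! ## Almost contact metric structures -/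

section Structures

variable {E : Type*} [NormedAddCommGroup E] [NormedSpace ℝ E] [FiniteDimensional ℝ E]
  {H : Type*} [TopologicalSpace H] (I : ModelWithCorners ℝ E H)
  (M : Type*) [TopologicalSpace M] [ChartedSpace H M] [IsManifold I ∞ M]
  [RiemannianBundle (fun x : M ↦ TangentSpace I x)]

/-- An almost contact metric structure `(φ, ζ)` on a Riemannian manifold: a smooth field of
endomorphisms and a smooth unit vector field, with `φ² = - Id + η ⊗ ζ` and
`⟨φ u, φ v⟩ = ⟨u, v⟩ - η(u) η(v)`, where `η = ⟨ζ, ·⟩`. -/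
structure AlmostContactMetric where
  /-- the endomorphism field -/
  φ : Π x : M, TangentSpace I x →L[ℝ] TangentSpace I x
  /-- the Reeb vector field -/
  ζ : Π x : M, TangentSpace I x
  smooth_φ : ContMDiff I (I.prod 𝓘(ℝ, E →L[ℝ] E)) ∞
    (fun x ↦ TotalSpace.mk' (E →L[ℝ] E)
      (E := fun x : M ↦ TangentSpace I x →L[ℝ] TangentSpace I x) x (φ x))
  smooth_ζ : ContMDiff I (I.prod 𝓘(ℝ, E)) ∞
    (fun x ↦ TotalSpace.mk' E (E := fun x : M ↦ TangentSpace I x) x (ζ x))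
  inner_ζ : ∀ x, inner ℝ (ζ x) (ζ x) = 1
  φ_φ : ∀ x (u : TangentSpace I x), φ x (φ x u) = - u + inner ℝ (ζ x) u • ζ x
  inner_φ : ∀ x (u v : TangentSpace I x),
    inner ℝ (φ x u) (φ x v) = inner ℝ u v - inner ℝ (ζ x) u * inner ℝ (ζ x) v

end Structures

namespace AlmostContactMetric

variable {E : Type*} [NormedAddCommGroup E] [NormedSpace ℝ E] [FiniteDimensional ℝ E]
  {H : Type*} [TopologicalSpace H] {I : ModelWithCorners ℝ E H}
  {M : Type*} [TopologicalSpace M] [ChartedSpace H M] [IsManifold I ∞ M]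
  [RiemannianBundle (fun x : M ↦ TangentSpace I x)]
  (S : AlmostContactMetric I M)

/-- The one-form `η = ζ^♭`. -/
def η (x : M) (v : TangentSpace I x) : ℝ := inner ℝ (S.ζ x) v

/-- The fundamental two-form `F(u, v) = ⟨u, φ v⟩`. -/
def fund (x : M) (u v : TangentSpace I x) : ℝ := inner ℝ u (S.φ x v)

variable [IsContMDiffRiemannianBundle I ∞ E (fun x : M ↦ TangentSpace I x)]

/-- `(∇_u φ) v`. -/
def nablaφ (x : M) (u v : TangentSpace I x) : TangentSpace I x :=
  leviCivita I M (fun y ↦ S.φ y (ext I v y)) x u - S.φ x (leviCivita I M (ext I v) x u)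

/-- `(∇_u η)(v)`. -/
def nablaη (x : M) (u v : TangentSpace I x) : ℝ :=
  mvfderiv I (fun y ↦ S.η y (ext I v y)) x u - S.η x (leviCivita I M (ext I v) x u)

/-- `(∇_u F)(v, w)`. -/
def nablaF (x : M) (u v w : TangentSpace I x) : ℝ :=
  mvfderiv I (fun y ↦ S.fund y (ext I v y) (ext I w y)) x u
    - S.fund x (leviCivita I M (ext I v) x u) w - S.fund x v (leviCivita I M (ext I w) x u)

/-- The intrinsic torsion `ξ_u v = -½ φ((∇_u φ) v) + (∇_u η)(v) ζ - ½ η(v) ∇_u ζ` of the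
`U(n) × 1`-structure. -/
def ξ (x : M) (u v : TangentSpace I x) : TangentSpace I x :=
  -(1 / 2 : ℝ) • S.φ x (S.nablaφ x u v) + S.nablaη x u v • S.ζ x
    - ((1 / 2 : ℝ) * S.η x v) • leviCivita I M S.ζ x u

/-- The minimal connection `∇^{U(n)} = ∇ + ξ`. -/
def minConn (σ : Π y : M, TangentSpace I y) (x : M) (u : TangentSpace I x) : TangentSpace I x :=
  leviCivita I M σ x u + S.ξ x u (σ x)

/-- `(d^*ξ)_v w`, with `d^*ξ = - ∑ (∇_{e_i} ξ)_{e_i}`. -/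
def codiffξ (x : M) (v : TangentSpace I x) : TangentSpace I x :=
  - basisSum fun e ↦ covTensor I (fun σ y w ↦ leviCivita I M σ y w) S.ξ x e e v

/-- The structure is harmonic if `d^*ξ = 0`. -/
def IsHarmonic : Prop := ∀ (x : M) (v : TangentSpace I x), S.codiffξ x v = 0

/-- `Ric^*(u, v) = ∑ ⟨R_{e_i, u} (φ e_i), φ v⟩`. -/
def ricStar (x : M) (u v : TangentSpace I x) : ℝ :=
  basisSum fun e : TangentSpace I x ↦
    inner ℝ (curvature I x e u (S.φ x e)) (S.φ x v)

/-- The skew-symmetric part of `Ric^*`. -/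
def ricStarAlt (x : M) (u v : TangentSpace I x) : ℝ :=
  (1 / 2 : ℝ) * (S.ricStar x u v - S.ricStar x v u)

/-- The vector `Ric^*(ζ)`, given by `⟨Ric^*(ζ), v⟩ = Ric^*(ζ, v)`. -/
def ricStarζ (x : M) : TangentSpace I x := sharp (S.ricStar x (S.ζ x))

/-- `d^*η`. -/
def codiffη (x : M) : ℝ := - basisSum fun e : TangentSpace I x ↦ S.nablaη x e e

/-- The one-form `d^*F`. -/
def codiffF (x : M) (v : TangentSpace I x) : ℝ := - basisSum fun e ↦ S.nablaF x e e v

/-- The Lee vector field `θ^♯`, given by `(n - 1) θ^♯ = - φ (d^*F)^♯ + ∇_ζ ζ`. For `n = 1` it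
is zero. -/
def lee (n : ℕ) (x : M) : TangentSpace I x :=
  (1 / ((n : ℝ) - 1)) • (- S.φ x (sharp (S.codiffF x)) + leviCivita I M S.ζ x (S.ζ x))

/-- The Lee form `θ`. -/
def θ (n : ℕ) (x : M) (v : TangentSpace I x) : ℝ := inner ℝ (S.lee n x) v

/-- The component `ξ_(i)` of the intrinsic torsion in `C_i`. -/
def ξc (n i : ℕ) (x : M) : TangentSpace I x → TangentSpace I x → TangentSpace I x :=
  component n (S.φ x) (S.ζ x) (S.ξ x) i

/-- The structure is of type `⨁_{i ∈ s} C_i`: `ξ` is the sum of its components in these `C_i`. -/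
def IsOfType (n : ℕ) (s : Finset ℕ) : Prop :=
  ∀ (x : M) (u v : TangentSpace I x), S.ξ x u v = ∑ i ∈ s, S.ξc n i x u v

/-- The vector field `ξ_ζ ζ`. -/
def ξζζ (x : M) : TangentSpace I x := S.ξ x (S.ζ x) (S.ζ x)

/-- The one-form `ξ_ζ η`, that is, `(ξ_ζ η)(v) = - η(ξ_ζ v)`. -/
def ξζη (x : M) (v : TangentSpace I x) : ℝ := - S.η x (S.ξ x (S.ζ x) v)

/-- `(ξ_(i)u η)(v) = - η(ξ_(i)u v)`. -/
def ξcη (n i : ℕ) (x : M) (u v : TangentSpace I x) : ℝ := - S.η x (S.ξc n i x u v)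

/-- `(φ α)(v) = - α(φ v)` for a one-form `α`. -/
def actφ (α : Π x : M, TangentSpace I x → ℝ) (x : M) (v : TangentSpace I x) : ℝ :=
  - α x (S.φ x v)

/-- The vector field `(ζ ⌟ d(ξ_ζ η))^♯`. -/
def dξζη (x : M) : TangentSpace I x := sharp (extDeriv1 I S.ξζη x (S.ζ x))

/-- `(∇^{U(n)}_ζ ξ_(11))_ζ u`. -/
def nablaξ11 (n : ℕ) (x : M) (u : TangentSpace I x) : TangentSpace I x :=
  covTensor I S.minConn (S.ξc n 11) x (S.ζ x) (S.ζ x) u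

/-- `¼ (ξ_ζ η ∧ θ - φ ξ_ζ η ∧ φ θ)(u, v)`. -/
def wedgeTerm (n : ℕ) (x : M) (u v : TangentSpace I x) : ℝ :=
  (1 / 4 : ℝ) * wedge (S.ξζη x) (S.θ n x) u v
    - (1 / 4 : ℝ) * wedge (S.actφ S.ξζη x) (S.actφ (S.θ n) x) u v

/-- The vector `∑_j ⟨⟨ξ_(i)· ζ, ·⟩, ⟨ξ_(3)· e_j, ·⟩⟩ e_j` (inner products of bilinear forms). -/
def pairξ3 (n i : ℕ) (x : M) : TangentSpace I x :=
  sharp fun w : TangentSpace I x ↦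
    formInner (fun u v ↦ inner ℝ (S.ξc n i x u (S.ζ x)) v) (fun u v ↦ inner ℝ (S.ξc n 3 x u w) v)

end AlmostContactMetric

end

end ACM

set_option linter.unusedSectionVars false
set_option linter.unusedSimpArgs false

namespace ACM
noncomputable section
open scoped RealInnerProductSpace

section Smoothness

variable {E : Type*} [NormedAddCommGroup E] [NormedSpace ℝ E]
  {H : Type*} [TopologicalSpace H] {I : ModelWithCorners ℝ E H}
  {M : Type*} [TopologicalSpace M] [ChartedSpace H M]

variable (I) in
/-- The function `f` is smooth on a neighbourhood of `x`. -/
def SmoothFun (f : M → ℝ) (x : M) : Prop :=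
  ∀ᶠ y in 𝓝 x, ContMDiffAt I 𝓘(ℝ, ℝ) ∞ f y

theorem SmoothFun.eventually {f : M → ℝ} {x : M} (h : SmoothFun I f x) :
    ∀ᶠ y in 𝓝 x, SmoothFun I f y :=
  eventually_eventually_nhds.2 h

theorem SmoothFun.mdiffAt {f : M → ℝ} {x : M} (h : SmoothFun I f x) : MDiffAt f x :=
  h.self_of_nhds.mdifferentiableAt (by simp)

variable [IsManifold I ∞ M]

variable (I) in
/-- The vector field `σ` is smooth on a neighbourhood of `x`. -/
def SmoothVec (σ : Π y : M, TangentSpace I y) (x : M) : Prop :=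
  ∀ᶠ y in 𝓝 x, ContMDiffAt I (I.prod 𝓘(ℝ, E)) ∞ (T% σ) y

variable {σ τ : Π y : M, TangentSpace I y} {f g : M → ℝ} {x : M}

theorem SmoothVec.eventually (h : SmoothVec I σ x) : ∀ᶠ y in 𝓝 x, SmoothVec I σ y :=
  eventually_eventually_nhds.2 h

theorem SmoothVec.mdiffAt (h : SmoothVec I σ x) : MDiffAt (T% σ) x :=
  h.self_of_nhds.mdifferentiableAt (by simp)

theorem SmoothVec.congr (h : SmoothVec I σ x) (he : ∀ᶠ y in 𝓝 x, τ y = σ y) :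
    SmoothVec I τ x := by
  filter_upwards [h, eventually_eventually_nhds.2 he] with y hy hey
  exact hy.congr_of_eventuallyEq (hey.mono fun z hz ↦ by simp [hz])

theorem SmoothFun.congr (h : SmoothFun I f x) (he : ∀ᶠ y in 𝓝 x, g y = f y) :
    SmoothFun I g x := by
  filter_upwards [h, eventually_eventually_nhds.2 he] with y hy hey
  exact hy.congr_of_eventuallyEq hey

theorem SmoothVec.add (hσ : SmoothVec I σ x) (hτ : SmoothVec I τ x) :
    SmoothVec I (fun y ↦ σ y + τ y) x := by
  filter_upwards [hσ, hτ] with y h1 h2 using h1.add_section h2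

theorem SmoothVec.sub (hσ : SmoothVec I σ x) (hτ : SmoothVec I τ x) :
    SmoothVec I (fun y ↦ σ y - τ y) x := by
  filter_upwards [hσ, hτ] with y h1 h2 using h1.sub_section h2

theorem SmoothVec.smul (hf : SmoothFun I f x) (hσ : SmoothVec I σ x) :
    SmoothVec I (fun y ↦ f y • σ y) x := by
  filter_upwards [hf, hσ] with y h1 h2 using h1.smul_section h2

theorem SmoothVec.const_smul (c : ℝ) (hσ : SmoothVec I σ x) :
    SmoothVec I (fun y ↦ c • σ y) x := by
  filter_upwards [hσ] with y h2 using h2.const_smul_section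

theorem SmoothVec.sum {ι : Type*} {s : Finset ι} {t : ι → Π y : M, TangentSpace I y}
    (h : ∀ i ∈ s, SmoothVec I (t i) x) : SmoothVec I (fun y ↦ ∑ i ∈ s, t i y) x := by
  have := (Filter.eventually_all_finset s).2 h
  filter_upwards [this] with y hy using ContMDiffAt.sum_section hy

theorem SmoothFun.const (c : ℝ) : SmoothFun I (fun _ : M ↦ c) x :=
  Filter.Eventually.of_forall fun _ ↦ contMDiffAt_const

theorem SmoothFun.add (hf : SmoothFun I f x) (hg : SmoothFun I g x) :
    SmoothFun I (fun y ↦ f y + g y) x := by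
  filter_upwards [hf, hg] with y h1 h2 using h1.add h2

theorem SmoothFun.sub (hf : SmoothFun I f x) (hg : SmoothFun I g x) :
    SmoothFun I (fun y ↦ f y - g y) x := by
  filter_upwards [hf, hg] with y h1 h2 using h1.sub h2

theorem SmoothFun.mul (hf : SmoothFun I f x) (hg : SmoothFun I g x) :
    SmoothFun I (fun y ↦ f y * g y) x := by
  filter_upwards [hf, hg] with y h1 h2 using h1.mul h2

variable (I) in
theorem smoothVec_ext (v : TangentSpace I x) : SmoothVec I (ext I v) x := by
  obtain ⟨s, hs, h⟩ := FiberBundle.exists_contMDiffOn_extend (k := ∞) I E v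
  obtain ⟨t, hts, ht, hxt⟩ := mem_nhds_iff.1 hs
  filter_upwards [ht.mem_nhds hxt] with y hy
  exact h.contMDiffAt (Filter.mem_of_superset (ht.mem_nhds hy) hts)

@[simp] theorem ext_self (v : TangentSpace I x) : ext I v x = v :=
  FiberBundle.extend_apply_self ..

variable (I) in
theorem mdiffAt_ext (v : TangentSpace I x) : MDiffAt (T% (ext I v)) x := (smoothVec_ext I v).mdiffAt

variable (I M) in
theorem isManifold_minSmoothness (k : ℕ) : IsManifold I (minSmoothness ℝ k) M := by
  rw [minSmoothness_of_isRCLikeNormedField]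
  exact IsManifold.of_le (n := ∞) (by exact_mod_cast le_top)

theorem SmoothVec.mlieBracket [FiniteDimensional ℝ E] (hσ : SmoothVec I σ x) (hτ : SmoothVec I τ x) :
    SmoothVec I (mlieBracket I σ τ) x := by
  have : CompleteSpace E := FiniteDimensional.complete ℝ E
  have := isManifold_minSmoothness I M 2
  have : IsManifold I (((⊤ : ℕ∞) : ℕ∞ω) + 1) M := inferInstanceAs (IsManifold I ∞ M)
  filter_upwards [hσ, hτ] with y h1 h2
  exact ContMDiffAt.mlieBracket_vectorField (m := ⊤) (n := ⊤) h1 h2 (by simp)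

variable [RiemannianBundle (fun x : M ↦ TangentSpace I x)]
  [IsContMDiffRiemannianBundle I ∞ E (fun x : M ↦ TangentSpace I x)]

theorem SmoothVec.inner (hσ : SmoothVec I σ x) (hτ : SmoothVec I τ x) :
    SmoothFun I (fun y ↦ inner ℝ (σ y) (τ y)) x := by
  filter_upwards [hσ, hτ] with y h1 h2
  exact ContMDiffAt.inner_bundle (E := fun x : M ↦ TangentSpace I x) (F := E) (b := id) h1 h2

end Smoothness

section Frame

variable {E : Type*} [NormedAddCommGroup E] [NormedSpace ℝ E] [FiniteDimensional ℝ E]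
  {H : Type*} [TopologicalSpace H] {I : ModelWithCorners ℝ E H}
  {M : Type*} [TopologicalSpace M] [ChartedSpace H M] [IsManifold I ∞ M]
  [RiemannianBundle (fun x : M ↦ TangentSpace I x)]
  [IsContMDiffRiemannianBundle I ∞ E (fun x : M ↦ TangentSpace I x)]
  {x : M}

theorem SmoothFun.div {f g : M → ℝ} (hf : SmoothFun I f x) (hg : SmoothFun I g x)
    (h0 : g x ≠ 0) : SmoothFun I (fun y ↦ f y / g y) x := by
  have hc : ∀ᶠ y in 𝓝 x, g y ≠ 0 := hg.mdiffAt.continuousAt.eventually_ne h0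
  filter_upwards [hf, hg, hc] with y h1 h2 h3
  have : ContMDiffAt I 𝓘(ℝ, ℝ) ∞ (fun z ↦ f z * (g z)⁻¹) y :=
    h1.mul ((contDiffAt_inv ℝ h3).contMDiffAt.comp y h2)
  simpa only [div_eq_mul_inv] using this

theorem SmoothFun.sqrt {f : M → ℝ} (hf : SmoothFun I f x) (h0 : f x ≠ 0) :
    SmoothFun I (fun y ↦ √(f y)) x := by
  have hc : ∀ᶠ y in 𝓝 x, f y ≠ 0 := hf.mdiffAt.continuousAt.eventually_ne h0
  filter_upwards [hf, hc] with y h1 h3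
  exact (Real.contDiffAt_sqrt h3).contMDiffAt.comp y h1

variable (I) in
theorem finrank_tangentSpace (y : M) :
    Module.finrank ℝ (TangentSpace I y) = Module.finrank ℝ E := rfl

theorem smoothVec_gramSchmidt {m : ℕ} {s : Fin m → Π y : M, TangentSpace I y}
    (hs : ∀ i, SmoothVec I (s i) x) (hli : LinearIndependent ℝ fun i ↦ s i x) (i : Fin m) :
    SmoothVec I (fun y ↦ InnerProductSpace.gramSchmidt ℝ (fun j ↦ s j y) i) x := by
  induction i using WellFoundedLT.induction with
  | ind i ih =>
  simp only [InnerProductSpace.gramSchmidt_def ℝ _ i, Submodule.starProjection_singleton]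
  refine (hs i).sub (SmoothVec.sum fun j hj ↦ ?_)
  have hj' := ih j (Finset.mem_Iio.1 hj)
  have h0 : InnerProductSpace.gramSchmidt ℝ (fun k ↦ s k x) j ≠ 0 :=
    InnerProductSpace.gramSchmidt_ne_zero j hli
  refine SmoothVec.smul ?_ hj'
  have h1 := hj'.inner (hs i)
  have h2 := hj'.inner hj'
  refine (h1.div h2 (by simpa using h0)).congr (Filter.Eventually.of_forall fun y ↦ ?_)
  simp

variable (I) in
/-- Near every point there is a smooth orthonormal frame. -/
theorem exists_orthonormalFrame (x : M) :
    ∃ e : Fin (Module.finrank ℝ E) → Π y : M, TangentSpace I y, (∀ i, SmoothVec I (e i) x) ∧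
      ∀ᶠ y in 𝓝 x, ∃ b : OrthonormalBasis (Fin (Module.finrank ℝ E)) ℝ (TangentSpace I y),
        ∀ i, b i = e i y := by
  set b := stdOrthonormalBasis ℝ (TangentSpace I x) with hb
  let s : Fin (Module.finrank ℝ E) → Π y : M, TangentSpace I y := fun i ↦ ext I (b i)
  have hs : ∀ i, SmoothVec I (s i) x := fun i ↦ smoothVec_ext I _
  have hli : LinearIndependent ℝ fun i ↦ s i x := by
    simp only [s, ext_self]
    exact b.orthonormal.linearIndependent
  set g : Fin (Module.finrank ℝ E) → Π y : M, TangentSpace I y :=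
    fun i y ↦ InnerProductSpace.gramSchmidt ℝ (fun j ↦ s j y) i with hg
  have hgs : ∀ i, SmoothVec I (g i) x := smoothVec_gramSchmidt hs hli
  have h0 : ∀ i, inner ℝ (g i x) (g i x) ≠ 0 := fun i ↦ by
    simpa using InnerProductSpace.gramSchmidt_ne_zero i hli
  refine ⟨fun i y ↦ (1 / √(inner ℝ (g i y) (g i y))) • g i y, fun i ↦ ?_, ?_⟩
  · exact SmoothVec.smul ((SmoothFun.const 1).div (((hgs i).inner (hgs i)).sqrt (h0 i))
      (Real.sqrt_ne_zero'.2 (real_inner_self_nonneg.lt_of_ne' (h0 i)))) (hgs i)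
  · have hne : ∀ᶠ y in 𝓝 x, ∀ i, inner ℝ (g i y) (g i y) ≠ 0 := by
      rw [Filter.eventually_all]
      exact fun i ↦ ((hgs i).inner (hgs i)).mdiffAt.continuousAt.eventually_ne (h0 i)
    filter_upwards [hne] with y hy
    have hon : Orthonormal ℝ fun i ↦ (1 / √(inner ℝ (g i y) (g i y))) • g i y := by
      refine ⟨fun i ↦ ?_, fun i j hij ↦ ?_⟩
      · have : ‖g i y‖ ≠ 0 := by
          have := hy i
          rw [real_inner_self_eq_norm_sq] at this
          exact fun h ↦ this (by simp [h])
        rw [norm_smul, real_inner_self_eq_norm_sq, Real.sqrt_sq (norm_nonneg _)]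
        simp [this]
      · simp only [real_inner_smul_left, real_inner_smul_right, hg,
          InnerProductSpace.gramSchmidt_orthogonal ℝ (fun j ↦ s j y) hij, mul_zero]
    have hsp := hon.linearIndependent.span_eq_top_of_card_eq_finrank' (by simp [finrank_tangentSpace])
    exact ⟨OrthonormalBasis.mk hon hsp.ge, fun i ↦ by simp⟩

theorem smoothVec_of_inner {τ : Π y : M, TangentSpace I y}
    (h : ∀ Z : Π y : M, TangentSpace I y, SmoothVec I Z x →
      SmoothFun I (fun y ↦ inner ℝ (τ y) (Z y)) x) : SmoothVec I τ x := by
  obtain ⟨e, he, hb⟩ := exists_orthonormalFrame I x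
  refine (SmoothVec.sum (s := Finset.univ) fun i _ ↦ SmoothVec.smul (h (e i) (he i)) (he i)).congr ?_
  filter_upwards [hb] with y ⟨b, hby⟩
  simp only [← hby]
  conv_lhs => rw [← b.sum_repr' (τ y)]
  simp [real_inner_comm]

end Frame

section Derivative

variable {E : Type*} [NormedAddCommGroup E] [NormedSpace ℝ E] [FiniteDimensional ℝ E]
  {H : Type*} [TopologicalSpace H] {I : ModelWithCorners ℝ E H}
  {M : Type*} [TopologicalSpace M] [ChartedSpace H M] [IsManifold I ∞ M]
  [RiemannianBundle (fun x : M ↦ TangentSpace I x)]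
  [IsContMDiffRiemannianBundle I ∞ E (fun x : M ↦ TangentSpace I x)]
  {x : M} (S : AlmostContactMetric I M)
  {f g : M → ℝ} {U V W X Y Z : Π y : M, TangentSpace I y}

include S

namespace AlmostContactMetric

theorem smoothVec_ζ (x : M) : SmoothVec I S.ζ x :=
  Filter.Eventually.of_forall fun y ↦ S.smooth_ζ y

theorem smoothVec_φ (hX : SmoothVec I X x) : SmoothVec I (fun y ↦ S.φ y (X y)) x := by
  filter_upwards [hX] with y hy
  exact ContMDiffAt.clm_bundle_apply (b := id) (S.smooth_φ y) hy

theorem mdiffAt_φ (hX : MDiffAt (T% X) x) : MDiffAt (T% (fun y ↦ S.φ y (X y))) x :=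
  MDifferentiableAt.clm_bundle_apply (b := id) ((S.smooth_φ x).mdifferentiableAt (by simp)) hX

theorem smoothFun_deriv (hf : SmoothFun I f x) (hV : SmoothVec I V x) :
    SmoothFun I (fun y ↦ mvfderiv I f y (V y)) x := by
  have h1 : SmoothVec I (mlieBracket I V (fun y ↦ f y • S.ζ y)) x :=
    hV.mlieBracket (SmoothVec.smul hf (S.smoothVec_ζ x))
  have h2 := SmoothVec.smul hf (hV.mlieBracket (S.smoothVec_ζ x))
  refine ((h1.sub h2).inner (S.smoothVec_ζ x)).congr ?_
  filter_upwards [hf.eventually] with y hy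
  have := mlieBracket_smul_right (I := I) (V := V) hy.mdiffAt (S.smoothVec_ζ y).mdiffAt
  change mlieBracket I V (fun y ↦ f y • S.ζ y) y = _ at this
  rw [this, add_sub_cancel_right, real_inner_smul_left, S.inner_ζ, mul_one]

/-- The Lie bracket acts on functions as the commutator of derivations. -/
theorem mvfderiv_mlieBracket (hf : SmoothFun I f x) (hU : SmoothVec I U x)
    (hV : SmoothVec I V x) :
    mvfderiv I f x (mlieBracket I U V x) =
      mvfderiv I (fun y ↦ mvfderiv I f y (V y)) x (U x)
        - mvfderiv I (fun y ↦ mvfderiv I f y (U y)) x (V x) := by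
  have : CompleteSpace E := FiniteDimensional.complete ℝ E
  have := isManifold_minSmoothness I M 3
  have := isManifold_minSmoothness I M 2
  have hζ := S.smoothVec_ζ x
  have key : ∀ {V : Π y : M, TangentSpace I y}, SmoothVec I V x → ∀ᶠ y in 𝓝 x,
      mlieBracket I V (f • S.ζ) y =
        ((fun y ↦ mvfderiv I f y (V y)) • S.ζ + f • mlieBracket I V S.ζ) y := by
    intro V hV
    filter_upwards [hf.eventually] with y hy
    exact mlieBracket_smul_right hy.mdiffAt (S.smoothVec_ζ y).mdiffAt
  have two : ∀ {V : Π y : M, TangentSpace I y}, SmoothVec I V x →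
      ContMDiffAt I (I.prod 𝓘(ℝ, E)) (minSmoothness ℝ 2) (T% V) x := by
    intro V hV
    rw [minSmoothness_of_isRCLikeNormedField]
    exact hV.self_of_nhds.of_le ENat.LEInfty.out
  have exp : ∀ {U V : Π y : M, TangentSpace I y}, SmoothVec I U x → SmoothVec I V x →
      mlieBracket I U (mlieBracket I V (f • S.ζ)) x =
        mvfderiv I (fun y ↦ mvfderiv I f y (V y)) x (U x) • S.ζ x
          + mvfderiv I f x (V x) • mlieBracket I U S.ζ x
          + (mvfderiv I f x (U x) • mlieBracket I V S.ζ x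
          + f x • mlieBracket I U (mlieBracket I V S.ζ) x) := by
    intro U V hU hV
    have hb := hV.mlieBracket hζ
    have hd := S.smoothFun_deriv hf hV
    rw [Filter.EventuallyEq.mlieBracket_vectorField_eq (Filter.EventuallyEq.refl _ U) (key hV),
      mlieBracket_add_right (hd.mdiffAt.smul_section hζ.mdiffAt)
        (hf.mdiffAt.smul_section hb.mdiffAt),
      mlieBracket_smul_right hd.mdiffAt hζ.mdiffAt, mlieBracket_smul_right hf.mdiffAt hb.mdiffAt]
  have hfζ : SmoothVec I (f • S.ζ) x := SmoothVec.smul hf hζ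
  have J1 := leibniz_identity_mlieBracket_apply (two hU) (two hV) (two hfζ)
  have J2 := leibniz_identity_mlieBracket_apply (two hU) (two hV) (two hζ)
  rw [exp hU hV, exp hV hU, J2, (key (hU.mlieBracket hV)).self_of_nhds] at J1
  simp only [Pi.add_apply, Pi.smul_apply'] at J1
  have J3 : mvfderiv I f x (mlieBracket I U V x) • S.ζ x =
      (mvfderiv I (fun y ↦ mvfderiv I f y (V y)) x (U x)
        - mvfderiv I (fun y ↦ mvfderiv I f y (U y)) x (V x)) • S.ζ x := by
    linear_combination (norm := module) -J1
  have := congrArg (fun w ↦ inner ℝ w (S.ζ x)) J3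
  simpa only [real_inner_smul_left, S.inner_ζ, mul_one] using this

/-- The covariant derivative of a smooth vector field along a smooth vector field is smooth. -/
theorem smoothVec_leviCivita (hX : SmoothVec I X x) (hY : SmoothVec I Y x) :
    SmoothVec I (fun y ↦ leviCivita I M Y y (X y)) x := by
  refine smoothVec_of_inner fun Z hZ ↦ ?_
  have h : SmoothFun I (koszul I X Y Z) x := by
    unfold koszul
    refine (SmoothFun.const (1 / 2)).mul ?_
    exact ((((S.smoothFun_deriv (hY.inner hZ) hX).add
      (S.smoothFun_deriv (hX.inner hZ) hY)).sub
      (S.smoothFun_deriv (hX.inner hY) hZ)).add ((hX.mlieBracket hY).inner hZ)).sub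
      ((hX.mlieBracket hZ).inner hY) |>.sub ((hY.mlieBracket hZ).inner hX)
  refine h.congr ?_
  filter_upwards [hX.eventually, hY.eventually, hZ.eventually] with y h1 h2 h3
  exact inner_leviCivitaFun h1.mdiffAt h2.mdiffAt h3.mdiffAt

end AlmostContactMetric

end Derivative

section PointwiseAlgebra

variable {V : Type*} [NormedAddCommGroup V] [InnerProductSpace ℝ V] [FiniteDimensional ℝ V]
  {W : Type*} [AddCommGroup W] [Module ℝ W]

/-! ### Sums over an orthonormal basis -/

theorem basisSum_add (f g : V → W) : basisSum (fun e ↦ f e + g e) = basisSum f + basisSum g :=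
  Finset.sum_add_distrib

theorem basisSum_sub (f g : V → W) : basisSum (fun e ↦ f e - g e) = basisSum f - basisSum g :=
  Finset.sum_sub_distrib ..

theorem basisSum_neg (f : V → W) : basisSum (fun e ↦ - f e) = - basisSum f :=
  Finset.sum_neg_distrib ..

theorem basisSum_smul (c : ℝ) (f : V → W) : basisSum (fun e ↦ c • f e) = c • basisSum f :=
  Finset.smul_sum.symm

theorem basisSum_mul (c : ℝ) (f : V → ℝ) : basisSum (fun e ↦ c * f e) = c * basisSum f :=
  (Finset.mul_sum ..).symm

theorem map_basisSum {W' : Type*} [AddCommGroup W'] [Module ℝ W'] (g : W →ₗ[ℝ] W') (f : V → W) :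
    g (basisSum f) = basisSum fun e ↦ g (f e) :=
  map_sum ..

theorem inner_basisSum (f : V → V) (w : V) :
    inner ℝ (basisSum f) w = basisSum fun e ↦ inner ℝ (f e) w :=
  sum_inner ..

theorem basisSum_congr {f g : V → W} (h : ∀ e, f e = g e) : basisSum f = basisSum g :=
  Finset.sum_congr rfl fun _ _ ↦ h _

theorem basisSum_const_zero : basisSum (fun _ : V ↦ (0 : W)) = 0 :=
  Finset.sum_const_zero

theorem basisSum_inner_smul (a : V) (g : V →ₗ[ℝ] W) :
    basisSum (fun e ↦ inner ℝ a e • g e) = g a := by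
  conv_rhs => rw [← (stdOrthonormalBasis ℝ V).sum_repr' a]
  simp [basisSum, real_inner_comm]

theorem basisSum_inner_mul (a b : V) :
    basisSum (fun e ↦ inner ℝ a e * inner ℝ b e) = inner ℝ a b := by
  have := basisSum_inner_smul a (innerₗ V b)
  simpa [real_inner_comm a b] using this

/-- The trace of a bilinear map does not depend on the orthonormal basis. -/
theorem basisSum_eq_sum {ι : Type*} [Fintype ι] (b : OrthonormalBasis ι ℝ V) {B : V → V → W}
    (hB : IsBilinearMap ℝ B) : basisSum (fun e ↦ B e e) = ∑ i, B (b i) (b i) := by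
  have h1 : ∀ i, B (b i) (b i) = basisSum fun e ↦ inner ℝ (b i) e • B e (b i) := fun i ↦
    (basisSum_inner_smul (b i) (hB.toLinearMap.flip (b i))).symm
  simp only [h1, basisSum]
  rw [Finset.sum_comm]
  refine Finset.sum_congr rfl fun j _ ↦ ?_
  conv_lhs => rw [← b.sum_repr' (stdOrthonormalBasis ℝ V j)]
  have := map_sum (hB.toLinearMap (∑ i, inner ℝ (b i) (stdOrthonormalBasis ℝ V j) • b i))
    (fun i ↦ inner ℝ (b i) (stdOrthonormalBasis ℝ V j) • b i) Finset.univ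
  refine this.trans (Finset.sum_congr rfl fun i _ ↦ ?_)
  rw [map_smul, b.sum_repr']
  rfl

/-- Under the trace, an endomorphism moves to the other argument as its adjoint. -/
theorem basisSum_adjoint {B : V → V → W} (hB : IsBilinearMap ℝ B) {f g : V → V}
    (hfg : ∀ u v, inner ℝ (f u) v = inner ℝ u (g v)) :
    basisSum (fun e ↦ B (f e) e) = basisSum (fun e ↦ B e (g e)) := by
  have h1 : ∀ e, B (f e) e = basisSum fun c ↦ inner ℝ (f e) c • B c e := fun e ↦
    (basisSum_inner_smul (f e) (hB.toLinearMap.flip e)).symm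
  have h2 : ∀ e, B e (g e) = basisSum fun c ↦ inner ℝ (g e) c • B e c := fun e ↦
    (basisSum_inner_smul (g e) (hB.toLinearMap e)).symm
  simp only [h1, h2, basisSum]
  rw [Finset.sum_comm]
  simp only [hfg, real_inner_comm]

theorem inner_sharp {α : V → ℝ} (hα : IsLinearMap ℝ α) (v : V) :
    inner ℝ (sharp α) v = α v := by
  have h := basisSum_inner_smul v hα.mk'
  rw [sharp, inner_basisSum, ← hα.mk'_apply, ← h]
  exact basisSum_congr fun e ↦ by
    rw [real_inner_smul_left, real_inner_comm, smul_eq_mul, mul_comm, hα.mk'_apply]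

/-! ### The orthogonal complement of `ζ` -/

variable {φ : V →L[ℝ] V} {ζ : V}

theorem hor_add (u v : V) : hor ζ (u + v) = hor ζ u + hor ζ v := by
  simp only [hor, inner_add_right]; module

theorem hor_smul (c : ℝ) (u : V) : hor ζ (c • u) = c • hor ζ u := by
  simp only [hor, real_inner_smul_right]; module

variable (ζ) in
/-- The projection to `ζ^⊥` as a linear map. -/
def horL : V →ₗ[ℝ] V where
  toFun := hor ζ
  map_add' := hor_add
  map_smul' := hor_smul

theorem horL_apply (u : V) : horL ζ u = hor ζ u := rfl

@[simp] theorem hor_neg (u : V) : hor ζ (-u) = - hor ζ u := (horL ζ).map_neg u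
theorem hor_sub (u v : V) : hor ζ (u - v) = hor ζ u - hor ζ v := (horL ζ).map_sub u v
@[simp] theorem hor_zero : hor ζ (0 : V) = 0 := (horL ζ).map_zero

theorem inner_hor_left (u v : V) : inner ℝ (hor ζ u) v = inner ℝ u (hor ζ v) := by
  simp only [hor, inner_sub_left, inner_sub_right, real_inner_smul_left, real_inner_smul_right,
    real_inner_comm ζ]
  ring

variable (φ ζ) in
/-- An almost contact metric structure on a Euclidean space. -/
structure IsACM : Prop where
  inner_ζ : inner ℝ ζ ζ = 1
  φ_φ : ∀ u, φ (φ u) = - u + inner ℝ ζ u • ζ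
  inner_φ : ∀ u v, inner ℝ (φ u) (φ v) = inner ℝ u v - inner ℝ ζ u * inner ℝ ζ v

namespace IsACM

variable (h : IsACM φ ζ)
include h

theorem φ_ζ : φ ζ = 0 := by
  have := h.inner_φ ζ ζ
  rw [h.inner_ζ, mul_one, sub_self] at this
  exact inner_self_eq_zero.1 this

theorem inner_ζ_φ (u : V) : inner ℝ ζ (φ u) = 0 := by
  have h1 := h.φ_φ (φ u)
  rw [h.φ_φ u, map_add, map_neg, map_smul, h.φ_ζ, smul_zero, add_zero, left_eq_add] at h1
  have := congrArg (inner ℝ ζ) h1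
  simpa only [real_inner_smul_right, h.inner_ζ, mul_one, inner_zero_right] using this

theorem inner_φ_left (u v : V) : inner ℝ (φ u) v = - inner ℝ u (φ v) := by
  have h1 := h.inner_φ (φ u) v
  rw [h.φ_φ, h.inner_ζ_φ, inner_add_left, inner_neg_left, real_inner_smul_left, h.inner_ζ_φ] at h1
  linarith

theorem hor_ζ : hor ζ ζ = 0 := by rw [hor, h.inner_ζ, one_smul, sub_self]

theorem inner_ζ_hor (u : V) : inner ℝ ζ (hor ζ u) = 0 := by
  rw [hor, inner_sub_right, real_inner_smul_right, h.inner_ζ, mul_one, sub_self]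

theorem hor_φ (u : V) : hor ζ (φ u) = φ u := by simp [hor, h.inner_ζ_φ]

theorem φ_hor (u : V) : φ (hor ζ u) = φ u := by simp [hor, h.φ_ζ]

theorem hor_hor (u : V) : hor ζ (hor ζ u) = hor ζ u := by
  conv_lhs => rw [hor, h.inner_ζ_hor, zero_smul, sub_zero]

theorem φ_φ_eq (u : V) : φ (φ u) = - hor ζ u := by rw [h.φ_φ, hor]; abel

theorem hor_of {u : V} (hu : inner ℝ ζ u = 0) : hor ζ u = u := by simp [hor, hu]

theorem hor_add_smul (u : V) : hor ζ u + inner ℝ ζ u • ζ = u := by simp [hor]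

/-- Replacing `e` by `φ e` in the first slot of a trace. -/
theorem basisSum_φ {B : V → V → W} (hB : IsBilinearMap ℝ B) :
    basisSum (fun e ↦ B (φ e) e) = - basisSum (fun e ↦ B e (φ e)) := by
  rw [basisSum_adjoint hB (g := fun v ↦ - φ v) fun u v ↦ by rw [h.inner_φ_left, inner_neg_right],
    ← basisSum_neg]
  exact basisSum_congr fun e ↦ (hB.toLinearMap e).map_neg (φ e)

theorem basisSum_hor {B : V → V → W} (hB : IsBilinearMap ℝ B) :
    basisSum (fun e ↦ B (hor ζ e) e) = basisSum (fun e ↦ B e (hor ζ e)) :=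
  basisSum_adjoint hB inner_hor_left

end IsACM

end PointwiseAlgebra

section Torsion

variable {V : Type*} [NormedAddCommGroup V] [InnerProductSpace ℝ V] [FiniteDimensional ℝ V]

/-! ### Tensors of the type of the intrinsic torsion -/

/-- `T_u` is skew-symmetric and orthogonal to the Lie algebra of `U(n) × 1`. -/
structure IsTorsion (φ : V →L[ℝ] V) (ζ : V) (T : V →ₗ[ℝ] V →ₗ[ℝ] V) : Prop where
  skew : ∀ u v w, ⟪T u v, w⟫ = - ⟪v, T u w⟫
  anti : ∀ u v, hor ζ (T u (φ v)) = - φ (T u (hor ζ v))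

/-- `horPart` as a bilinear map. -/
def horTensor (ζ : V) (T : V →ₗ[ℝ] V →ₗ[ℝ] V) : V →ₗ[ℝ] V →ₗ[ℝ] V :=
  (T.compl₁₂ (horL ζ) (horL ζ)).compr₂ (horL ζ)

/-- `reebMap` as a linear map. -/
def reebL (ζ : V) (T : V →ₗ[ℝ] V →ₗ[ℝ] V) : V →ₗ[ℝ] V :=
  horL ζ ∘ₗ T.flip ζ ∘ₗ horL ζ

/-- The endomorphism `v ↦ T_ζ v` of `ζ^⊥`. -/
def alongL (ζ : V) (T : V →ₗ[ℝ] V →ₗ[ℝ] V) : V →ₗ[ℝ] V :=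
  horL ζ ∘ₗ T ζ ∘ₗ horL ζ

theorem horTensor_apply (ζ : V) (T : V →ₗ[ℝ] V →ₗ[ℝ] V) (u v : V) :
    horTensor ζ T u v = hor ζ (T (hor ζ u) (hor ζ v)) := rfl

theorem reebL_apply (ζ : V) (T : V →ₗ[ℝ] V →ₗ[ℝ] V) (u : V) :
    reebL ζ T u = hor ζ (T (hor ζ u) ζ) := rfl

theorem alongL_apply (ζ : V) (T : V →ₗ[ℝ] V →ₗ[ℝ] V) (u : V) :
    alongL ζ T u = hor ζ (T ζ (hor ζ u)) := rfl

variable {φ : V →L[ℝ] V} {ζ : V} {T : V →ₗ[ℝ] V →ₗ[ℝ] V}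

namespace IsTorsion

variable (h : IsACM φ ζ) (hT : IsTorsion φ ζ T)
include h

theorem inner_ζ_horTensor (T : V →ₗ[ℝ] V →ₗ[ℝ] V) (u v : V) : ⟪ζ, horTensor ζ T u v⟫ = 0 :=
  h.inner_ζ_hor _

theorem inner_ζ_reebL (T : V →ₗ[ℝ] V →ₗ[ℝ] V) (u : V) : ⟪ζ, reebL ζ T u⟫ = 0 := h.inner_ζ_hor _

theorem inner_ζ_alongL (T : V →ₗ[ℝ] V →ₗ[ℝ] V) (u : V) : ⟪ζ, alongL ζ T u⟫ = 0 :=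
  h.inner_ζ_hor _

theorem horTensor_ζ_left (T : V →ₗ[ℝ] V →ₗ[ℝ] V) (v : V) : horTensor ζ T ζ v = 0 := by
  simp [horTensor_apply, h.hor_ζ]

theorem horTensor_ζ_right (T : V →ₗ[ℝ] V →ₗ[ℝ] V) (v : V) : horTensor ζ T v ζ = 0 := by
  simp [horTensor_apply, h.hor_ζ]

theorem horTensor_hor_left (T : V →ₗ[ℝ] V →ₗ[ℝ] V) (u v : V) :
    horTensor ζ T (hor ζ u) v = horTensor ζ T u v := by
  simp [horTensor_apply, h.hor_hor]

theorem horTensor_hor_right (T : V →ₗ[ℝ] V →ₗ[ℝ] V) (u v : V) :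
    horTensor ζ T u (hor ζ v) = horTensor ζ T u v := by
  simp [horTensor_apply, h.hor_hor]

theorem hor_horTensor (T : V →ₗ[ℝ] V →ₗ[ℝ] V) (u v : V) :
    hor ζ (horTensor ζ T u v) = horTensor ζ T u v := h.hor_hor _

theorem reebL_ζ (T : V →ₗ[ℝ] V →ₗ[ℝ] V) : reebL ζ T ζ = 0 := by simp [reebL_apply, h.hor_ζ]

theorem reebL_hor (T : V →ₗ[ℝ] V →ₗ[ℝ] V) (u : V) : reebL ζ T (hor ζ u) = reebL ζ T u := by
  simp [reebL_apply, h.hor_hor]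

theorem hor_reebL (T : V →ₗ[ℝ] V →ₗ[ℝ] V) (u : V) : hor ζ (reebL ζ T u) = reebL ζ T u :=
  h.hor_hor _

theorem alongL_ζ (T : V →ₗ[ℝ] V →ₗ[ℝ] V) : alongL ζ T ζ = 0 := by simp [alongL_apply, h.hor_ζ]

theorem alongL_hor (T : V →ₗ[ℝ] V →ₗ[ℝ] V) (u : V) : alongL ζ T (hor ζ u) = alongL ζ T u := by
  simp [alongL_apply, h.hor_hor]

theorem hor_alongL (T : V →ₗ[ℝ] V →ₗ[ℝ] V) (u : V) : hor ζ (alongL ζ T u) = alongL ζ T u :=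
  h.hor_hor _

include hT

omit h in
theorem inner_self_zero (u v : V) : ⟪v, T u v⟫ = 0 := by
  have h1 := hT.skew u v v
  rw [real_inner_comm] at h1
  linarith

theorem horTensor_skew (u v w : V) :
    ⟪horTensor ζ T u v, w⟫ = - ⟪v, horTensor ζ T u w⟫ := by
  rw [horTensor_apply, horTensor_apply, inner_hor_left, hT.skew, ← inner_hor_left]

theorem alongL_skew (v w : V) : ⟪alongL ζ T v, w⟫ = - ⟪v, alongL ζ T w⟫ := by
  rw [alongL_apply, alongL_apply, inner_hor_left, hT.skew, ← inner_hor_left]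

theorem horTensor_φ (u v : V) : horTensor ζ T u (φ v) = - φ (horTensor ζ T u v) := by
  rw [horTensor_apply, horTensor_apply, h.hor_φ, hT.anti, h.φ_hor]

theorem alongL_φ (v : V) : alongL ζ T (φ v) = - φ (alongL ζ T v) := by
  rw [alongL_apply, alongL_apply, h.hor_φ, hT.anti, h.φ_hor]

omit h in
theorem hor_T_ζ (u : V) : hor ζ (T u ζ) = T u ζ := by
  rw [hor, hT.inner_self_zero, zero_smul, sub_zero]

/-- Decomposition of a tensor of torsion type. -/
theorem apply_eq (u v : V) :
    T u v = horTensor ζ T u v + ⟪ζ, v⟫ • reebL ζ T u - ⟪reebL ζ T u, v⟫ • ζ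
      + ⟪ζ, u⟫ • (alongL ζ T v + ⟪ζ, v⟫ • T ζ ζ - ⟪T ζ ζ, v⟫ • ζ) := by
  have key : ∀ a b, T a (hor ζ b) = hor ζ (T a (hor ζ b)) - ⟪hor ζ (T a ζ), b⟫ • ζ := fun a b ↦ by
    conv_lhs => rw [← h.hor_add_smul (T a (hor ζ b))]
    rw [← neg_eq_iff_eq_neg.2 (hT.skew a ζ (hor ζ b)), ← inner_hor_left, neg_smul, sub_eq_add_neg]
  conv_lhs => rw [← h.hor_add_smul u, ← h.hor_add_smul v]
  simp only [map_add, map_smul, LinearMap.add_apply, LinearMap.smul_apply]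
  rw [key (hor ζ u) v, key ζ v, horTensor_apply, reebL_apply, alongL_apply, hT.hor_T_ζ, hT.hor_T_ζ]
  module

end IsTorsion

end Torsion

section PointwiseCurvature

variable {V : Type*} [NormedAddCommGroup V] [InnerProductSpace ℝ V] [FiniteDimensional ℝ V]
  {W : Type*} [AddCommGroup W] [Module ℝ W]

theorem basisSum_inner_smul_of {f : V → W} (hf : IsLinearMap ℝ f) (a : V) :
    basisSum (fun e ↦ ⟪a, e⟫ • f e) = f a :=
  basisSum_inner_smul a hf.mk'

/-- The pair symmetry of a function with the symmetries of a curvature tensor. -/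
theorem pair_symm_of_bianchi {V : Type*} {K : V → V → V → V → ℝ}
    (h1 : ∀ a b c d, K a b c d = - K b a c d) (h2 : ∀ a b c d, K a b c d = - K a b d c)
    (hb : ∀ a b c d, K a b c d + K b c a d + K c a b d = 0) (a b c d : V) :
    K a b c d = K c d a b := by
  linarith [hb a b c d, hb b c d a, hb c d a b, hb d a b c, h1 b c a d, h2 b c a d, h1 c a b d,
    h2 c a b d, h1 a c b d, h1 c d b a, h2 c d b a, h1 d b c a, h2 d b c a, h2 b d c a, h2 b c d a,
    h1 d a c b, h2 d a c b, h2 a d c b, h1 a c d b, h2 a c d b, h2 c d a b, h1 b d a c, h2 a b d c,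
    h2 d a b c, h2 b d a c, h1 d a b c, h2 a d b c, h1 a d b c]

/-! ### Curvature of a connection with intrinsic torsion -/

/-- The difference `R_{u,v} - R^U_{u,v}` of the curvatures of `∇` and of `D = ∇ + T`, where `A` is
the covariant derivative `D T`. -/
def torsionCurv (T : V →ₗ[ℝ] V →ₗ[ℝ] V) (A : V →ₗ[ℝ] V →ₗ[ℝ] V →ₗ[ℝ] V) (u v w : V) : V :=
  A u v w - A v u w + T (T u v - T v u) w - T u (T v w) + T v (T u w)

/-- The algebraic data given at a point by the structure, its intrinsic torsion `T`, the covariant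
derivative `A = D T`, and the Riemann curvature tensor `R`. -/
structure IsPointData (φ : V →L[ℝ] V) (ζ : V) (T : V →ₗ[ℝ] V →ₗ[ℝ] V)
    (A R : V →ₗ[ℝ] V →ₗ[ℝ] V →ₗ[ℝ] V) : Prop where
  acm : IsACM φ ζ
  tor : IsTorsion φ ζ T
  torA : ∀ u, IsTorsion φ ζ (A u)
  curv_swap : ∀ u v w, R u v w = - R v u w
  curv_skew : ∀ u v w z, ⟪R u v w, z⟫ = - ⟪w, R u v z⟫
  bianchi : ∀ u v w, R u v w + R v w u + R w u v = 0
  curv_ζ : ∀ u v, R u v ζ = torsionCurv T A u v ζ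
  curv_φ : ∀ u v w, R u v (φ w) - torsionCurv T A u v (φ w) =
    φ (R u v w - torsionCurv T A u v w)

/-- The operator `½ ∑ (R - R^U)_{e, φ e}`. -/
def traceCurv (φ : V →L[ℝ] V) (T : V →ₗ[ℝ] V →ₗ[ℝ] V) (A : V →ₗ[ℝ] V →ₗ[ℝ] V →ₗ[ℝ] V) (w : V) : V :=
  basisSum (fun e ↦ A e (φ e) w) + T (basisSum fun e ↦ T e (φ e)) w
    - basisSum (fun e ↦ T e (T (φ e) w))

/-- `Ric^*` for a curvature tensor. -/
def starRicci (φ : V →L[ℝ] V) (R : V →ₗ[ℝ] V →ₗ[ℝ] V →ₗ[ℝ] V) (u v : V) : ℝ :=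
  basisSum fun e ↦ ⟪R e u (φ e), φ v⟫

/-- `d^*T`. -/
def codiff (T : V →ₗ[ℝ] V →ₗ[ℝ] V) (A : V →ₗ[ℝ] V →ₗ[ℝ] V →ₗ[ℝ] V) (w : V) : V :=
  - basisSum (fun e ↦ A e e w) - T (basisSum fun e ↦ T e e) w

variable {φ : V →L[ℝ] V} {ζ : V} {T : V →ₗ[ℝ] V →ₗ[ℝ] V} {A R : V →ₗ[ℝ] V →ₗ[ℝ] V →ₗ[ℝ] V}

theorem half_basisSum_torsionCurv (h : IsACM φ ζ) (w : V) :
    (1 / 2 : ℝ) • basisSum (fun e ↦ torsionCurv T A e (φ e) w) = traceCurv φ T A w := by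
  have h1 := h.basisSum_φ (B := fun u v ↦ A u v w) (by constructor <;> intros <;> simp)
  have h2 := h.basisSum_φ (B := fun u v ↦ T u v) (by constructor <;> intros <;> simp)
  have h3 := h.basisSum_φ (B := fun u v ↦ T u (T v w)) (by constructor <;> intros <;> simp)
  have h4 : basisSum (fun e ↦ T (T e (φ e) - T (φ e) e) w)
      = T (basisSum (fun e ↦ T e (φ e) - T (φ e) e)) w := (map_basisSum (T.flip w) _).symm
  simp only [torsionCurv, traceCurv, basisSum_add, basisSum_sub, h1, h3, h4, h2]
  simp only [map_sub, map_neg, LinearMap.sub_apply, LinearMap.neg_apply]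
  module

namespace IsPointData

variable (D : IsPointData φ ζ T A R)
include D

theorem starRicci_eq (u v : V) :
    starRicci φ R u v = ⟪(1 / 2 : ℝ) • basisSum (fun e ↦ R e (φ e) u), φ v⟫ := by
  have h1 : ∀ e, R e u (φ e) = R (φ e) u e + R e (φ e) u := fun e ↦ by
    have h2 := D.bianchi e u (φ e)
    rw [D.curv_swap u (φ e) e, D.curv_swap (φ e) e u] at h2
    linear_combination (norm := module) h2
  have h3 := D.acm.basisSum_φ (B := fun a b ↦ R a u b) (by constructor <;> intros <;> simp)
  have h4 := basisSum_congr h1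
  rw [basisSum_add, h3] at h4
  rw [starRicci, ← inner_basisSum]
  congr 1
  linear_combination (norm := module) (1 / 2 : ℝ) • h4

theorem starRicci_alt (X Y : V) :
    (1 / 2 : ℝ) * (starRicci φ R (hor ζ X) (hor ζ Y) - starRicci φ R (hor ζ Y) (hor ζ X))
      = (1 / 2 : ℝ) * ⟪traceCurv φ T A (φ X) - φ (traceCurv φ T A (hor ζ X)), hor ζ Y⟫ := by
  have h1 : basisSum (fun e ↦ R e (φ e) (φ X)) - basisSum (fun e ↦ torsionCurv T A e (φ e) (φ X))
      = φ (basisSum (fun e ↦ R e (φ e) (hor ζ X))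
        - basisSum (fun e ↦ torsionCurv T A e (φ e) (hor ζ X))) := by
    rw [← basisSum_sub, ← basisSum_sub]
    refine Eq.trans ?_ (map_basisSum φ.toLinearMap _).symm
    refine basisSum_congr fun e ↦ ?_
    rw [← D.acm.φ_hor X]
    exact D.curv_φ ..
  have h2 : ⟪basisSum (fun e ↦ R e (φ e) (hor ζ Y)), φ X⟫
      = - ⟪basisSum (fun e ↦ R e (φ e) (φ X)), hor ζ Y⟫ := by
    rw [inner_basisSum, inner_basisSum, ← basisSum_neg]
    exact basisSum_congr fun e ↦ by rw [D.curv_skew, real_inner_comm]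
  have h3 := congrArg (⟪·, hor ζ Y⟫) h1
  simp only [map_sub, inner_sub_left, D.acm.inner_φ_left] at h3
  rw [D.starRicci_eq, D.starRicci_eq, ← half_basisSum_torsionCurv D.acm,
    ← half_basisSum_torsionCurv D.acm]
  simp only [D.acm.φ_hor, real_inner_smul_left, map_smul, inner_sub_left, h2,
    D.acm.inner_φ_left] at h3 ⊢
  linear_combination (1 / 4 : ℝ) * h3

theorem starRicci_ζ (v : V) : starRicci φ R ζ v = ⟪- φ (traceCurv φ T A ζ), v⟫ := by
  rw [D.starRicci_eq, ← half_basisSum_torsionCurv D.acm, inner_neg_left, D.acm.inner_φ_left,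
    neg_neg, basisSum_congr fun e ↦ D.curv_ζ e (φ e)]

end IsPointData

end PointwiseCurvature

section PointwiseTraces

variable {V : Type*} [NormedAddCommGroup V] [InnerProductSpace ℝ V] [FiniteDimensional ℝ V]

/-- The trace of `horTensor`. -/
def horTrace (ζ : V) (T : V →ₗ[ℝ] V →ₗ[ℝ] V) : V := basisSum fun e ↦ horTensor ζ T e e

/-- The trace of `reebL`. -/
def reebTrace (ζ : V) (T : V →ₗ[ℝ] V →ₗ[ℝ] V) : ℝ := basisSum fun e ↦ ⟪reebL ζ T e, e⟫

/-- The pairing of `reebL` with `φ`. -/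
def reebTraceφ (φ : V →L[ℝ] V) (ζ : V) (T : V →ₗ[ℝ] V →ₗ[ℝ] V) : ℝ :=
  basisSum fun e ↦ ⟪reebL ζ T e, φ e⟫

variable {φ : V →L[ℝ] V} {ζ : V} {T : V →ₗ[ℝ] V →ₗ[ℝ] V} {A R : V →ₗ[ℝ] V →ₗ[ℝ] V →ₗ[ℝ] V}

namespace IsTorsion

variable (h : IsACM φ ζ) (hT : IsTorsion φ ζ T)
include h

theorem inner_ζ_horTrace (T : V →ₗ[ℝ] V →ₗ[ℝ] V) : ⟪ζ, horTrace ζ T⟫ = 0 := by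
  rw [real_inner_comm, horTrace, inner_basisSum]
  simp only [real_inner_comm ζ, inner_ζ_horTensor h]
  exact basisSum_const_zero

include hT

omit h in
theorem inner_ζ_T_ζ (u : V) : ⟪ζ, T u ζ⟫ = 0 := hT.inner_self_zero u ζ

omit h in
theorem inner_T_ζ_ζ (u : V) : ⟪T u ζ, ζ⟫ = 0 := by rw [real_inner_comm, hT.inner_ζ_T_ζ]

theorem basisSum_self : basisSum (fun e ↦ T e e) = horTrace ζ T - reebTrace ζ T • ζ + T ζ ζ := by
  have h1 : ∀ e, T e e = (horTensor ζ T e e - ⟪reebL ζ T e, e⟫ • ζ) + ⟪ζ, e⟫ •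
      (reebL ζ T e + (alongL ζ T e + ⟪ζ, e⟫ • T ζ ζ - ⟪T ζ ζ, e⟫ • ζ)) := fun e ↦ by
    conv_lhs => rw [hT.apply_eq h]
    module
  have h2 : IsLinearMap ℝ fun e ↦ reebL ζ T e + (alongL ζ T e + ⟪ζ, e⟫ • T ζ ζ - ⟪T ζ ζ, e⟫ • ζ) := by
    constructor <;> intros <;>
      simp only [map_add, map_smul, inner_add_right, real_inner_smul_right] <;> module
  rw [basisSum_congr h1, basisSum_add, basisSum_inner_smul_of h2, basisSum_sub, horTrace, reebTrace,
    reebL_ζ h, alongL_ζ h, h.inner_ζ, hT.inner_T_ζ_ζ]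
  congr 1
  · congr 1
    exact (Finset.sum_smul ..).symm
  · module

theorem basisSum_φ_self :
    basisSum (fun e ↦ T e (φ e)) = - φ (horTrace ζ T) - reebTraceφ φ ζ T • ζ := by
  have h1 : ∀ e, T e (φ e) = (- φ (horTensor ζ T e e) - ⟪reebL ζ T e, φ e⟫ • ζ) + ⟪ζ, e⟫ •
      (alongL ζ T (φ e) - ⟪T ζ ζ, φ e⟫ • ζ) := fun e ↦ by
    conv_lhs => rw [hT.apply_eq h, hT.horTensor_φ h, h.inner_ζ_φ]
    module
  have h2 : IsLinearMap ℝ fun e ↦ alongL ζ T (φ e) - ⟪T ζ ζ, φ e⟫ • ζ := by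
    constructor <;> intros <;>
      simp only [map_add, map_smul, inner_add_right, real_inner_smul_right] <;> module
  rw [basisSum_congr h1, basisSum_add, basisSum_inner_smul_of h2, basisSum_sub, basisSum_neg,
    horTrace, reebTraceφ, h.φ_ζ, map_zero, inner_zero_right, zero_smul, sub_zero, add_zero]
  congr 1
  · congr 1
    exact (map_basisSum φ.toLinearMap _).symm
  · exact (Finset.sum_smul ..).symm

theorem hor_apply (u v : V) : hor ζ (T u v) = horTensor ζ T u v + ⟪ζ, v⟫ • reebL ζ T u
      + ⟪ζ, u⟫ • (alongL ζ T v + ⟪ζ, v⟫ • T ζ ζ) := by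
  rw [hT.apply_eq h u v]
  simp only [hor_add, hor_sub, hor_smul, h.hor_ζ, smul_zero, sub_zero, hor_horTensor h,
    hor_reebL h, hor_alongL h, hT.hor_T_ζ]

end IsTorsion

open _root_.ACM.IsTorsion

namespace IsPointData

variable (D : IsPointData φ ζ T A R)
include D

theorem codiff_skew (v w : V) : ⟪codiff T A v, w⟫ = - ⟪v, codiff T A w⟫ := by
  rw [codiff, codiff, inner_sub_left, inner_neg_left, inner_basisSum, D.tor.skew, inner_sub_right,
    inner_neg_right, real_inner_comm (basisSum _) v, inner_basisSum]
  have : basisSum (fun e ↦ ⟪A e e v, w⟫) = - basisSum (fun e ↦ ⟪A e e w, v⟫) := by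
    rw [← basisSum_neg]
    exact basisSum_congr fun e ↦ by rw [(D.torA e).skew, real_inner_comm]
  rw [this]; ring

/-- The operator `d^*T` on `ζ^⊥`. -/
theorem hor_codiff_hor (X : V) : hor ζ (codiff T A (hor ζ X)) =
    - basisSum (fun e ↦ horTensor ζ (A e) e X) - alongL ζ (A ζ) X - horTensor ζ T (horTrace ζ T) X
      + reebTrace ζ T • alongL ζ T X - horTensor ζ T (T ζ ζ) X := by
  have h1 : ∀ e, hor ζ (A e e (hor ζ X)) = horTensor ζ (A e) e X + ⟪ζ, e⟫ • alongL ζ (A e) X :=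
    fun e ↦ by
      rw [(D.torA e).hor_apply D.acm, D.acm.inner_ζ_hor, horTensor_hor_right D.acm,
        alongL_hor D.acm]
      module
  have h2 : IsLinearMap ℝ fun e ↦ alongL ζ (A e) X := by
    constructor <;> intros <;> simp [alongL_apply, hor_add, hor_smul]
  have h3 : hor ζ (basisSum fun e ↦ A e e (hor ζ X)) = basisSum fun e ↦ hor ζ (A e e (hor ζ X)) :=
    map_basisSum (horL ζ) _
  rw [codiff, hor_sub, hor_neg, h3, basisSum_congr h1, basisSum_add, basisSum_inner_smul_of h2,
    D.tor.basisSum_self D.acm, D.tor.hor_apply D.acm, D.acm.inner_ζ_hor, inner_add_right,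
    inner_sub_right, inner_ζ_horTrace D.acm, real_inner_smul_right, D.acm.inner_ζ,
    D.tor.inner_ζ_T_ζ, horTensor_hor_right D.acm, alongL_hor D.acm]
  simp only [map_add, map_sub, map_smul, LinearMap.add_apply, LinearMap.sub_apply,
    LinearMap.smul_apply, horTensor_ζ_left D.acm]
  module

theorem codiff_ζ : codiff T A ζ =
    - basisSum (fun e ↦ reebL ζ (A e) e) - A ζ ζ ζ - reebL ζ T (horTrace ζ T)
      + reebTrace ζ T • T ζ ζ - reebL ζ T (T ζ ζ) := by
  have h1 : ∀ e, A e e ζ = reebL ζ (A e) e + ⟪ζ, e⟫ • A e ζ ζ := fun e ↦ by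
    conv_lhs => rw [← (D.torA e).hor_T_ζ, (D.torA e).hor_apply D.acm, D.acm.inner_ζ,
      horTensor_ζ_right D.acm, alongL_ζ D.acm]
    module
  have h2 : IsLinearMap ℝ fun e ↦ A e ζ ζ := by
    constructor <;> intros <;> simp
  rw [codiff, basisSum_congr h1, basisSum_add, basisSum_inner_smul_of h2,
    D.tor.basisSum_self D.acm, ← D.tor.hor_T_ζ (_ + _), D.tor.hor_apply D.acm, D.acm.inner_ζ,
    horTensor_ζ_right D.acm, alongL_ζ D.acm, inner_add_right,
    inner_sub_right, inner_ζ_horTrace D.acm, real_inner_smul_right, D.acm.inner_ζ,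
    D.tor.inner_ζ_T_ζ]
  simp only [map_add, map_sub, map_smul, reebL_ζ D.acm]
  module

/-- The operator `½ ∑ (R - R^U)_{e, φ e}` on `ζ^⊥`. -/
theorem hor_traceCurv_hor (X : V) : hor ζ (traceCurv φ T A (hor ζ X)) =
    basisSum (fun e ↦ horTensor ζ (A e) (φ e) X) - horTensor ζ T (φ (horTrace ζ T)) X
      - reebTraceφ φ ζ T • alongL ζ T X - basisSum (fun e ↦ horTensor ζ T e (horTensor ζ T (φ e) X))
      + basisSum (fun e ↦ ⟪reebL ζ T (φ e), X⟫ • reebL ζ T e) := by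
  have h1 : ∀ e, hor ζ (A e (φ e) (hor ζ X)) = horTensor ζ (A e) (φ e) X := fun e ↦ by
      rw [(D.torA e).hor_apply D.acm, D.acm.inner_ζ_hor, horTensor_hor_right D.acm,
        D.acm.inner_ζ_φ]
      module
  have h2 : ∀ e, hor ζ (T e (T (φ e) (hor ζ X))) = (horTensor ζ T e (horTensor ζ T (φ e) X)
      - ⟪reebL ζ T (φ e), X⟫ • reebL ζ T e) + ⟪ζ, e⟫ • (alongL ζ T (horTensor ζ T (φ e) X) -
        ⟪reebL ζ T (φ e), X⟫ • T ζ ζ) := fun e ↦ by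
      rw [D.tor.hor_apply D.acm, D.tor.apply_eq D.acm (φ e), D.acm.inner_ζ_hor,
        horTensor_hor_right D.acm, D.acm.inner_ζ_φ]
      simp only [zero_smul, add_zero, map_sub, map_smul, inner_sub_right, real_inner_smul_right,
        D.acm.inner_ζ, inner_ζ_horTensor D.acm, horTensor_ζ_right D.acm, alongL_ζ D.acm,
        ← inner_hor_left, hor_reebL D.acm]
      module
  have h3 : hor ζ (basisSum fun e ↦ A e (φ e) (hor ζ X)) =
      basisSum fun e ↦ hor ζ (A e (φ e) (hor ζ X)) := map_basisSum (horL ζ) _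
  have h4 : hor ζ (basisSum fun e ↦ T e (T (φ e) (hor ζ X))) =
      basisSum fun e ↦ hor ζ (T e (T (φ e) (hor ζ X))) := map_basisSum (horL ζ) _
  have h5 : IsLinearMap ℝ fun e ↦ alongL ζ T (horTensor ζ T (φ e) X) -
        ⟪reebL ζ T (φ e), X⟫ • T ζ ζ := by
    constructor <;> intros <;>
      simp only [map_add, map_smul, inner_add_left, real_inner_smul_left, LinearMap.add_apply,
        LinearMap.smul_apply] <;> module
  rw [traceCurv, hor_sub, hor_add, h3, h4, basisSum_congr h1, basisSum_congr h2, basisSum_add,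
    basisSum_inner_smul_of h5, basisSum_sub, D.acm.φ_ζ, D.tor.basisSum_φ_self D.acm,
    D.tor.hor_apply D.acm, D.acm.inner_ζ_hor, inner_sub_right, inner_neg_right, D.acm.inner_ζ_φ,
    real_inner_smul_right, D.acm.inner_ζ, horTensor_hor_right D.acm, alongL_hor D.acm]
  simp only [map_sub, map_smul, map_neg, map_zero, LinearMap.sub_apply, LinearMap.neg_apply,
    LinearMap.smul_apply, LinearMap.zero_apply, horTensor_ζ_left D.acm, inner_zero_left]
  module

theorem φ_traceCurv_ζ : φ (traceCurv φ T A ζ) = φ (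
    basisSum (fun e ↦ reebL ζ (A e) (φ e)) - reebL ζ T (φ (horTrace ζ T))
      - reebTraceφ φ ζ T • T ζ ζ - basisSum (fun e ↦ horTensor ζ T e (reebL ζ T (φ e)))) := by
  have hφ : ∀ {a b}, hor ζ a = b → φ a = φ b := fun {a b} hab ↦ by rw [← hab, D.acm.φ_hor]
  refine hφ ?_
  have h1 : ∀ e, hor ζ (A e (φ e) ζ) = reebL ζ (A e) (φ e) := fun e ↦ by
    rw [(D.torA e).hor_apply D.acm, D.acm.inner_ζ,
      horTensor_ζ_right D.acm, D.acm.inner_ζ_φ]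
    module
  have h2 : ∀ e, hor ζ (T e (T (φ e) ζ)) = horTensor ζ T e (reebL ζ T (φ e))
      + ⟪ζ, e⟫ • (alongL ζ T (reebL ζ T (φ e))) := fun e ↦ by
    have : T (φ e) ζ = reebL ζ T (φ e) := by
      rw [reebL_apply, D.acm.hor_φ, D.tor.hor_T_ζ]
    rw [D.tor.hor_apply D.acm, this, inner_ζ_reebL D.acm]
    module
  have h3 : hor ζ (basisSum fun e ↦ A e (φ e) ζ) =
      basisSum fun e ↦ hor ζ (A e (φ e) ζ) := map_basisSum (horL ζ) _
  have h4 : hor ζ (basisSum fun e ↦ T e (T (φ e) ζ)) =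
      basisSum fun e ↦ hor ζ (T e (T (φ e) ζ)) := map_basisSum (horL ζ) _
  have h5 : IsLinearMap ℝ fun e ↦ alongL ζ T (reebL ζ T (φ e)) := by
    constructor <;> intros <;> simp
  rw [traceCurv, hor_sub, hor_add, h3, h4, basisSum_congr h1, basisSum_congr h2, basisSum_add,
    basisSum_inner_smul_of h5, D.acm.φ_ζ, D.tor.basisSum_φ_self D.acm,
    D.tor.hor_apply D.acm, D.acm.inner_ζ, inner_sub_right, inner_neg_right, D.acm.inner_ζ_φ,
    real_inner_smul_right, D.acm.inner_ζ, horTensor_ζ_right D.acm, alongL_ζ D.acm]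
  simp only [map_sub, map_smul, map_neg, map_zero, reebL_ζ D.acm]
  module

/-- The skew-symmetric part of `Ric^*` on `ζ^⊥`, when `reebL` commutes or anticommutes with `φ`. -/
theorem starRicci_alt_eq {ε : ℝ} (hεε : ε * ε = 1)
    (hε : ∀ u, reebL ζ T (φ u) = ε • φ (reebL ζ T u)) (X Y : V) :
    (1 / 2 : ℝ) * (starRicci φ R (hor ζ X) (hor ζ Y) - starRicci φ R (hor ζ Y) (hor ζ X)) =
      ⟪φ (- basisSum (fun e ↦ horTensor ζ (A e) (φ e) X) + horTensor ζ T (φ (horTrace ζ T)) X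
        + reebTraceφ φ ζ T • alongL ζ T X), Y⟫ := by
  have h1 := D.hor_traceCurv_hor (φ X)
  rw [D.acm.hor_φ] at h1
  have h2 := congrArg φ (D.hor_traceCurv_hor X)
  rw [D.acm.φ_hor] at h2
  have h3 : basisSum (fun e ↦ horTensor ζ (A e) (φ e) (φ X)) =
      - φ (basisSum fun e ↦ horTensor ζ (A e) (φ e) X) := by
    rw [basisSum_congr fun e ↦ (D.torA e).horTensor_φ D.acm (φ e) X, basisSum_neg]
    congr 1
    exact (map_basisSum φ.toLinearMap _).symm
  have h4 : basisSum (fun e ↦ horTensor ζ T e (horTensor ζ T (φ e) (φ X))) =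
      φ (basisSum fun e ↦ horTensor ζ T e (horTensor ζ T (φ e) X)) := by
    refine Eq.trans (basisSum_congr fun e ↦ ?_) (map_basisSum φ.toLinearMap _).symm
    rw [D.tor.horTensor_φ D.acm (φ e) X, map_neg, D.tor.horTensor_φ D.acm, neg_neg]
    rfl
  have h5 : basisSum (fun e ↦ ⟪reebL ζ T (φ e), φ X⟫ • reebL ζ T e) =
      φ (basisSum fun e ↦ ⟪reebL ζ T (φ e), X⟫ • reebL ζ T e) := by
    have e1 : ∀ e, ⟪reebL ζ T (φ e), φ X⟫ • reebL ζ T e = ε • ⟪reebL ζ T e, X⟫ • reebL ζ T e :=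
      fun e ↦ by
        rw [hε, real_inner_smul_left, D.acm.inner_φ, inner_ζ_reebL D.acm, zero_mul, sub_zero,
          mul_smul]
    have e2 : ∀ e, φ (⟪reebL ζ T (φ e), X⟫ • reebL ζ T e)
        = ε • ⟪reebL ζ T (φ e), X⟫ • reebL ζ T (φ e) := fun e ↦ by
      rw [hε, map_smul, smul_comm ε _ (ε • _), smul_smul ε ε, hεε, one_smul]
    refine Eq.trans ?_ (map_basisSum φ.toLinearMap _).symm
    rw [basisSum_congr e1]
    refine Eq.trans ?_ (basisSum_congr e2).symm
    rw [basisSum_smul, basisSum_smul]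
    have e3 := D.acm.basisSum_φ (B := fun a b ↦ ⟪reebL ζ T a, X⟫ • reebL ζ T (φ b)) (by
      constructor <;> intros <;>
        simp only [map_add, map_smul, inner_add_left, real_inner_smul_left] <;> module)
    rw [e3, ← basisSum_neg]
    congr 1
    refine basisSum_congr fun e ↦ ?_
    rw [D.acm.φ_φ_eq, map_neg, reebL_hor D.acm, smul_neg, neg_neg]
  rw [D.starRicci_alt, ← inner_hor_left, hor_sub, D.acm.hor_φ, h1, h2, h3, h4, h5,
    D.tor.horTensor_φ D.acm, D.tor.alongL_φ D.acm, ← real_inner_smul_left]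
  congr 1
  simp only [map_add, map_sub, map_neg, map_smul]
  module

theorem starRicci_ζ_eq : sharp (starRicci φ R ζ) =
    φ (- basisSum (fun e ↦ reebL ζ (A e) (φ e)) + reebL ζ T (φ (horTrace ζ T))
      + reebTraceφ φ ζ T • T ζ ζ + basisSum (fun e ↦ horTensor ζ T e (reebL ζ T (φ e)))) := by
  refine ext_inner_right ℝ fun v ↦ ?_
  have h1 : starRicci φ R ζ = fun v ↦ ⟪- φ (traceCurv φ T A ζ), v⟫ := funext D.starRicci_ζ
  rw [inner_sharp (by
    rw [h1]; constructor <;> intros <;> simp [inner_add_right, real_inner_smul_right]), h1,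
    D.φ_traceCurv_ζ]
  refine congrArg (⟪·, v⟫) ?_
  simp only [map_add, map_sub, map_neg, map_smul]
  module

end IsPointData

end PointwiseTraces

open _root_.ACM.IsTorsion

section Components

variable {V : Type*} [NormedAddCommGroup V] [InnerProductSpace ℝ V] [FiniteDimensional ℝ V]

/-! ### The twelve components -/

/-- The tensor in `C_4` with Lee vector `θ`. -/
def leePart (φ : V →L[ℝ] V) (ζ θ u v : V) : V :=
  (1 / 4 : ℝ) • (⟪hor ζ u, v⟫ • θ - ⟪θ, v⟫ • hor ζ u - ⟪φ u, v⟫ • φ θ + ⟪φ θ, v⟫ • φ u)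

variable {φ : V →L[ℝ] V} {ζ : V} {T : V →ₗ[ℝ] V →ₗ[ℝ] V} {A R : V →ₗ[ℝ] V →ₗ[ℝ] V →ₗ[ℝ] V}
  {n : ℕ}

theorem comp4_eq (n : ℕ) (φ : V →L[ℝ] V) (ζ : V) (T : V → V → V) :
    comp4 n φ ζ T = leePart φ ζ (traceVec n ζ T) := rfl

theorem traceVec_eq : traceVec n ζ (T · ·) = (2 / ((n : ℝ) - 1)) • horTrace ζ T := rfl

theorem commPart_eq (u v : V) : commPart φ ζ (T · ·) u v =
    (1 / 2 : ℝ) • (horTensor ζ T u v + horTensor ζ T (φ u) (φ v)) := rfl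

theorem antiPart_eq (u v : V) : antiPart φ ζ (T · ·) u v =
    (1 / 2 : ℝ) • (horTensor ζ T u v - horTensor ζ T (φ u) (φ v)) := rfl

theorem reebComm_eq (u : V) : reebComm φ ζ (T · ·) u =
    (1 / 2 : ℝ) • (reebL ζ T u - φ (reebL ζ T (φ u))) := rfl

theorem reebAnti_eq (u : V) : reebAnti φ ζ (T · ·) u =
    (1 / 2 : ℝ) • (reebL ζ T u + φ (reebL ζ T (φ u))) := rfl

theorem inner_leePart_right (φ : V →L[ℝ] V) (ζ θ u v w : V) : ⟪leePart φ ζ θ u v, w⟫ =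
    (1 / 4 : ℝ) * (⟪hor ζ u, v⟫ * ⟪θ, w⟫ - ⟪θ, v⟫ * ⟪hor ζ u, w⟫ - ⟪φ u, v⟫ * ⟪φ θ, w⟫
      + ⟪φ θ, v⟫ * ⟪φ u, w⟫) := by
  simp only [leePart, inner_add_left, inner_sub_left, real_inner_smul_left]

theorem leePart_self {θ : V} (hθ : hor ζ θ = θ) (v : V) : leePart φ ζ θ θ v = 0 := by
  rw [leePart, hθ]; module

theorem leePart_smul_left (φ : V →L[ℝ] V) (ζ θ v : V) (c : ℝ) (u : V) :
    leePart φ ζ θ (c • u) v = c • leePart φ ζ θ u v := by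
  simp only [leePart, hor_smul, map_smul, real_inner_smul_left]
  module

theorem transp_eq (L : V →ₗ[ℝ] V) (u : V) : transp (L ·) u = LinearMap.adjoint L u := by
  refine ext_inner_right ℝ fun w ↦ ?_
  rw [transp, inner_sharp (by constructor <;> intros <;>
    simp [inner_add_left, real_inner_smul_left]), LinearMap.adjoint_inner_left, real_inner_comm]

theorem comp1_add_comp2 (T : V → V → V) (u v : V) :
    comp1 φ ζ T u v + comp2 φ ζ T u v = antiPart φ ζ T u v := by
  rw [comp2]; abel

theorem comp3_add_comp4 (T : V → V → V) (u v : V) :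
    comp3 n φ ζ T u v + comp4 n φ ζ T u v = commPart φ ζ T u v := by
  rw [comp3]; abel

theorem reeb9_add_reeb10 (T : V → V → V) (u : V) :
    reeb9 φ ζ T u + reeb10 φ ζ T u = reebAnti φ ζ T u := by
  rw [reeb9, reeb10]; module

theorem reeb_comm_sum (T : V → V → V) (u : V) : reeb5 n ζ T u + reeb6 n φ ζ T u
    + reeb7 n φ ζ T u + reeb8 n φ ζ T u = reebComm φ ζ T u := by
  rw [reeb7, reeb8]; module

theorem antiPart_skew (h : IsACM φ ζ) (hT : IsTorsion φ ζ T) (u v w : V) :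
    ⟪antiPart φ ζ (T · ·) u v, w⟫ = - ⟪v, antiPart φ ζ (T · ·) u w⟫ := by
  simp only [antiPart_eq, real_inner_smul_left, inner_sub_left, real_inner_smul_right,
    inner_sub_right, hT.horTensor_skew h u v w, hT.horTensor_skew h (φ u) (φ v) w,
    h.inner_φ_left v, hT.horTensor_φ h (φ u) w, inner_neg_right]
  ring

theorem inner_comp1 (h : IsACM φ ζ) (hT : IsTorsion φ ζ T) (u v w : V) :
    ⟪comp1 φ ζ (T · ·) u v, w⟫ = (1 / 3 : ℝ) * (⟪antiPart φ ζ (T · ·) u v, w⟫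
      + ⟪antiPart φ ζ (T · ·) v w, u⟫ + ⟪antiPart φ ζ (T · ·) w u, v⟫) := by
  have h1 : IsLinearMap ℝ fun w ↦ ⟪antiPart φ ζ (T · ·) w u, v⟫ := by
    constructor <;> intros <;> simp only [antiPart_eq, map_add, map_smul, LinearMap.add_apply,
      LinearMap.smul_apply, real_inner_smul_left, inner_add_left, inner_sub_left, smul_eq_mul] <;>
      ring
  have h2 : ⟪antiPart φ ζ (T · ·) v w, u⟫ = - ⟪antiPart φ ζ (T · ·) v u, w⟫ := by
    rw [antiPart_skew h hT, real_inner_comm]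
  rw [comp1, real_inner_smul_left, inner_add_left, inner_sub_left, inner_sharp h1, h2]
  ring

section Constraints

variable (h : IsACM φ ζ) (hT : IsTorsion φ ζ T)
include h

theorem hor_traceVec : hor ζ (traceVec n ζ (T · ·)) = traceVec n ζ (T · ·) := by
  rw [traceVec_eq, hor_smul, h.hor_of (inner_ζ_horTrace h T)]

theorem hor_leePart {θ : V} (hθ : hor ζ θ = θ) (u v : V) :
    hor ζ (leePart φ ζ θ u v) = leePart φ ζ θ u v := by
  simp only [leePart, hor_smul, hor_add, hor_sub, h.hor_φ, h.hor_hor, hθ]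

theorem leePart_hor_left (θ u v : V) : leePart φ ζ θ (hor ζ u) v = leePart φ ζ θ u v := by
  simp only [leePart, h.hor_hor, h.φ_hor]

theorem leePart_hor_right {θ : V} (hθ : hor ζ θ = θ) (u v : V) :
    leePart φ ζ θ u (hor ζ v) = leePart φ ζ θ u v := by
  simp only [leePart, ← inner_hor_left, h.hor_hor, h.hor_φ, hθ]

theorem leePart_ζ {θ : V} (hθ : hor ζ θ = θ) (u : V) : leePart φ ζ θ u ζ = 0 := by
  rw [← leePart_hor_right h hθ, h.hor_ζ]
  simp [leePart]

theorem hor_lift (L : V → V) (u v : V) : hor ζ (lift ζ L u v) = ⟪ζ, v⟫ • hor ζ (L u) := by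
  rw [lift, hor_sub, hor_smul, hor_smul, h.hor_ζ]; module

theorem antiPart_hor (u v : V) :
    antiPart φ ζ (T · ·) (hor ζ u) (hor ζ v) = antiPart φ ζ (T · ·) u v := by
  simp only [antiPart_eq, h.φ_hor, horTensor_hor_left h, horTensor_hor_right h]

theorem commPart_hor (u v : V) :
    commPart φ ζ (T · ·) (hor ζ u) (hor ζ v) = commPart φ ζ (T · ·) u v := by
  simp only [commPart_eq, h.φ_hor, horTensor_hor_left h, horTensor_hor_right h]

theorem antiPart_ζ (u : V) : antiPart φ ζ (T · ·) u ζ = 0 := by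
  simp [antiPart_eq, h.φ_ζ, horTensor_ζ_right h]

theorem commPart_ζ (u : V) : commPart φ ζ (T · ·) u ζ = 0 := by
  simp [commPart_eq, h.φ_ζ, horTensor_ζ_right h]

theorem comp11_hor (v : V) (u : V) : comp11 ζ (T · ·) (hor ζ u) v = 0 := by
  rw [comp11, h.inner_ζ_hor, zero_smul]

theorem comp12_hor (v : V) (u : V) : comp12 ζ (T · ·) (hor ζ u) v = 0 := by
  rw [comp12, h.inner_ζ_hor, zero_smul]

theorem comm_of_reebComm (hL : ∀ u, reebL ζ T u = reebComm φ ζ (T · ·) (hor ζ u)) (u : V) :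
    reebL ζ T (φ u) = φ (reebL ζ T u) := by
  have h1 : reebL ζ T u = - φ (reebL ζ T (φ u)) := by
    have := hL u
    rw [reebComm_eq, h.φ_hor, reebL_hor h] at this
    linear_combination (norm := module) (2 : ℝ) • this
  rw [h1, map_neg, h.φ_φ_eq, hor_reebL h, neg_neg]

theorem anti_of_reebAnti (hL : ∀ u, reebL ζ T u = reebAnti φ ζ (T · ·) (hor ζ u)) (u : V) :
    reebL ζ T (φ u) = - φ (reebL ζ T u) := by
  have h1 : reebL ζ T u = φ (reebL ζ T (φ u)) := by
    have := hL u
    rw [reebAnti_eq, h.φ_hor, reebL_hor h] at this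
    linear_combination (norm := module) (2 : ℝ) • this
  rw [h1, h.φ_φ_eq, hor_reebL h, neg_neg]

theorem hor_reebComm (u : V) : hor ζ (reebComm φ ζ (T · ·) u) = reebComm φ ζ (T · ·) u := by
  rw [reebComm_eq, hor_smul, hor_sub, hor_reebL h, h.hor_φ]

theorem hor_reebAnti (u : V) : hor ζ (reebAnti φ ζ (T · ·) u) = reebAnti φ ζ (T · ·) u := by
  rw [reebAnti_eq, hor_smul, hor_add, hor_reebL h, h.hor_φ]

/-- Type `A ⊕ C_4 ⊕ C ⊕ E`. -/
theorem anti_comm_of_type (hs : ∀ u v, T u v =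
      ∑ i ∈ ({1, 2, 4, 5, 6, 7, 8, 11, 12} : Finset ℕ), component n φ ζ (T · ·) i u v) :
    (∀ u v, horTensor ζ T u v + horTensor ζ T (φ u) (φ v)
      = (2 : ℝ) • leePart φ ζ (traceVec n ζ (T · ·)) u v) ∧
    ∀ u, reebL ζ T (φ u) = φ (reebL ζ T u) := by
  have hs' : ∀ u v, T u v = antiPart φ ζ (T · ·) u v + leePart φ ζ (traceVec n ζ (T · ·)) u v
      + (lift ζ (reeb5 n ζ (T · ·)) u v + lift ζ (reeb6 n φ ζ (T · ·)) u v
      + lift ζ (reeb7 n φ ζ (T · ·)) u v + lift ζ (reeb8 n φ ζ (T · ·)) u v)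
      + comp11 ζ (T · ·) u v + comp12 ζ (T · ·) u v := fun u v ↦ by
    rw [hs, ← comp1_add_comp2, ← comp4_eq]
    simp [component]
    abel
  have hθ := hor_traceVec (n := n) (T := T) h
  constructor
  · intro u v
    have h1 := congrArg (hor ζ) (hs' (hor ζ u) (hor ζ v))
    rw [← horTensor_apply] at h1
    simp only [hor_add, hor_lift h, h.inner_ζ_hor, zero_smul, comp11_hor h, comp12_hor h,
      antiPart_hor h, leePart_hor_left h, leePart_hor_right h hθ,
      hor_leePart h hθ, add_zero, hor_zero, antiPart_eq,
      hor_smul, hor_sub, hor_horTensor h] at h1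
    linear_combination (norm := module) (2 : ℝ) • h1
  · refine comm_of_reebComm h fun u ↦ ?_
    have h1 := congrArg (hor ζ) (hs' (hor ζ u) ζ)
    rw [← reebL_apply] at h1
    rw [h1]
    simp only [hor_add, hor_lift h, h.inner_ζ, comp11_hor h, comp12_hor h,
      antiPart_ζ h, leePart_ζ h hθ, hor_zero, zero_add, add_zero, one_smul]
    rw [← hor_add, ← hor_add, ← hor_add, reeb_comm_sum, hor_reebComm h]

/-- Type `A ⊕ C_4 ⊕ D ⊕ E`. -/
theorem anti_anti_of_type (hs : ∀ u v, T u v =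
      ∑ i ∈ ({1, 2, 4, 9, 10, 11, 12} : Finset ℕ), component n φ ζ (T · ·) i u v) :
    (∀ u v, horTensor ζ T u v + horTensor ζ T (φ u) (φ v)
      = (2 : ℝ) • leePart φ ζ (traceVec n ζ (T · ·)) u v) ∧
    ∀ u, reebL ζ T (φ u) = - φ (reebL ζ T u) := by
  have hs' : ∀ u v, T u v = antiPart φ ζ (T · ·) u v + leePart φ ζ (traceVec n ζ (T · ·)) u v
      + (lift ζ (reeb9 φ ζ (T · ·)) u v + lift ζ (reeb10 φ ζ (T · ·)) u v)
      + comp11 ζ (T · ·) u v + comp12 ζ (T · ·) u v := fun u v ↦ by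
    rw [hs, ← comp1_add_comp2, ← comp4_eq]
    simp [component]
    abel
  have hθ := hor_traceVec (n := n) (T := T) h
  constructor
  · intro u v
    have h1 := congrArg (hor ζ) (hs' (hor ζ u) (hor ζ v))
    rw [← horTensor_apply] at h1
    simp only [hor_add, hor_lift h, h.inner_ζ_hor, zero_smul, comp11_hor h, comp12_hor h,
      antiPart_hor h, leePart_hor_left h, leePart_hor_right h hθ,
      hor_leePart h hθ, add_zero, hor_zero, antiPart_eq,
      hor_smul, hor_sub, hor_horTensor h] at h1
    linear_combination (norm := module) (2 : ℝ) • h1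
  · refine anti_of_reebAnti h fun u ↦ ?_
    have h1 := congrArg (hor ζ) (hs' (hor ζ u) ζ)
    rw [← reebL_apply] at h1
    rw [h1]
    simp only [hor_add, hor_lift h, h.inner_ζ, comp11_hor h, comp12_hor h,
      antiPart_ζ h, leePart_ζ h hθ, hor_zero, zero_add, add_zero, one_smul]
    rw [← hor_add, reeb9_add_reeb10, hor_reebAnti h]

/-- Type `B ⊕ C ⊕ E`. -/
theorem comm_comm_of_type (hs : ∀ u v, T u v =
      ∑ i ∈ ({3, 4, 5, 6, 7, 8, 11, 12} : Finset ℕ), component n φ ζ (T · ·) i u v) :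
    (∀ u v, horTensor ζ T (φ u) (φ v) = horTensor ζ T u v) ∧
    ∀ u, reebL ζ T (φ u) = φ (reebL ζ T u) := by
  have hs' : ∀ u v, T u v = commPart φ ζ (T · ·) u v
      + (lift ζ (reeb5 n ζ (T · ·)) u v + lift ζ (reeb6 n φ ζ (T · ·)) u v
      + lift ζ (reeb7 n φ ζ (T · ·)) u v + lift ζ (reeb8 n φ ζ (T · ·)) u v)
      + comp11 ζ (T · ·) u v + comp12 ζ (T · ·) u v := fun u v ↦ by
    rw [hs, ← comp3_add_comp4 (n := n)]
    simp [component]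
    abel
  constructor
  · intro u v
    have h1 := congrArg (hor ζ) (hs' (hor ζ u) (hor ζ v))
    rw [← horTensor_apply] at h1
    simp only [hor_add, hor_lift h, h.inner_ζ_hor, zero_smul, comp11_hor h, comp12_hor h,
      commPart_hor h, add_zero, hor_zero, commPart_eq, hor_smul, hor_horTensor h] at h1
    linear_combination (norm := module) (-2 : ℝ) • h1
  · refine comm_of_reebComm h fun u ↦ ?_
    have h1 := congrArg (hor ζ) (hs' (hor ζ u) ζ)
    rw [← reebL_apply] at h1
    rw [h1]
    simp only [hor_add, hor_lift h, h.inner_ζ, comp11_hor h, comp12_hor h,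
      commPart_ζ h, hor_zero, zero_add, add_zero, one_smul]
    rw [← hor_add, ← hor_add, ← hor_add, reeb_comm_sum, hor_reebComm h]

/-- Type `B ⊕ D ⊕ E`. -/
theorem comm_anti_of_type (hs : ∀ u v, T u v =
      ∑ i ∈ ({3, 4, 9, 10, 11, 12} : Finset ℕ), component n φ ζ (T · ·) i u v) :
    (∀ u v, horTensor ζ T (φ u) (φ v) = horTensor ζ T u v) ∧
    ∀ u, reebL ζ T (φ u) = - φ (reebL ζ T u) := by
  have hs' : ∀ u v, T u v = commPart φ ζ (T · ·) u v
      + (lift ζ (reeb9 φ ζ (T · ·)) u v + lift ζ (reeb10 φ ζ (T · ·)) u v)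
      + comp11 ζ (T · ·) u v + comp12 ζ (T · ·) u v := fun u v ↦ by
    rw [hs, ← comp3_add_comp4 (n := n)]
    simp [component]
    abel
  constructor
  · intro u v
    have h1 := congrArg (hor ζ) (hs' (hor ζ u) (hor ζ v))
    rw [← horTensor_apply] at h1
    simp only [hor_add, hor_lift h, h.inner_ζ_hor, zero_smul, comp11_hor h, comp12_hor h,
      commPart_hor h, add_zero, hor_zero, commPart_eq, hor_smul, hor_horTensor h] at h1
    linear_combination (norm := module) (-2 : ℝ) • h1
  · refine anti_of_reebAnti h fun u ↦ ?_
    have h1 := congrArg (hor ζ) (hs' (hor ζ u) ζ)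
    rw [← reebL_apply] at h1
    rw [h1]
    simp only [hor_add, hor_lift h, h.inner_ζ, comp11_hor h, comp12_hor h,
      commPart_ζ h, hor_zero, zero_add, add_zero, one_smul]
    rw [← hor_add, reeb9_add_reeb10, hor_reebAnti h]

include hT

/-- In dimension three there is no part of `T` with all arguments in `ζ^⊥`. -/
theorem horTensor_eq_zero (hd : Module.finrank ℝ V = 3) (u v : V) : horTensor ζ T u v = 0 := by
  by_contra hne
  have hv : hor ζ v ≠ 0 := fun h0 ↦ hne (by rw [← horTensor_hor_right h, h0, map_zero])
  have hφ : φ v ≠ 0 := fun h0 ↦ hv (by rw [← neg_eq_zero, ← h.φ_φ_eq, h0, map_zero])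
  have hζ : ζ ≠ 0 := fun h0 ↦ by simpa [h0] using h.inner_ζ
  have hz : ⟪horTensor ζ T u v, hor ζ v⟫ = 0 := by
    have := hT.horTensor_skew h u v v
    rw [real_inner_comm] at this
    rw [← inner_hor_left, hor_horTensor h, real_inner_comm]
    linarith
  have hw : ⟪horTensor ζ T u v, φ v⟫ = 0 := by
    have := hT.horTensor_skew h u v (φ v)
    have h1 := h.inner_φ_left v (horTensor ζ T u v)
    rw [hT.horTensor_φ h, inner_neg_right, neg_neg] at this
    rw [real_inner_comm] at h1
    linarith
  have hvφ : ⟪hor ζ v, φ v⟫ = 0 := by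
    have := h.inner_φ_left v v
    rw [real_inner_comm] at this
    rw [inner_hor_left, h.hor_φ]
    linarith
  have hli : LinearIndependent ℝ ![ζ, hor ζ v, φ v, horTensor ζ T u v] := by
    refine linearIndependent_of_ne_zero_of_inner_eq_zero (fun i ↦ ?_) fun i j hij ↦ ?_
    · fin_cases i <;> simp [hne, hv, hφ, hζ]
    · fin_cases i <;> fin_cases j <;> first
        | exact absurd rfl hij
        | (simp [h.inner_ζ_hor, h.inner_ζ_φ, inner_ζ_horTensor h, hvφ, hz, hw]; done)
        | (rw [real_inner_comm]; simp [h.inner_ζ_hor, h.inner_ζ_φ, inner_ζ_horTensor h, hvφ, hz, hw])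
  have := hli.fintype_card_le_finrank
  rw [hd] at this
  simp at this

/-- `∑ T_e e` over a basis of `ζ^⊥` in terms of the Lee vector. -/
theorem horTrace_eq (hn : 1 ≤ n) (hd : Module.finrank ℝ V = 2 * n + 1) :
    horTrace ζ T = (((n : ℝ) - 1) / 2) • traceVec n ζ (T · ·) := by
  rcases hn.eq_or_lt with rfl | hn
  · rw [horTrace, basisSum_congr fun e ↦ horTensor_eq_zero h hT hd e e, basisSum_const_zero]
    simp
  · have : (n : ℝ) - 1 ≠ 0 := by
      have : (1 : ℝ) < n := by exact_mod_cast hn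
      linarith
    rw [traceVec_eq, smul_smul, div_mul_div_comm, mul_comm, div_self (by simpa), one_smul]

end Constraints

end Components

section HorizontalPart

variable {V : Type*} [NormedAddCommGroup V] [InnerProductSpace ℝ V] [FiniteDimensional ℝ V]

theorem basisSum_inner_mul_of {f : V → ℝ} (hf : IsLinearMap ℝ f) (a : V) :
    basisSum (fun e ↦ ⟪a, e⟫ * f e) = f a :=
  basisSum_inner_smul a hf.mk'

variable {φ : V →L[ℝ] V} {ζ : V} {T : V →ₗ[ℝ] V →ₗ[ℝ] V} {A R : V →ₗ[ℝ] V →ₗ[ℝ] V →ₗ[ℝ] V}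
  {n : ℕ} {θ : V}

theorem φ_horTensor_φ_left_of_anti (h : IsACM φ ζ) (hT : IsTorsion φ ζ T)
    (hK : ∀ u v, horTensor ζ T u v + horTensor ζ T (φ u) (φ v) = (2 : ℝ) • leePart φ ζ θ u v)
    (u v : V) : φ (horTensor ζ T (φ u) v)
      = horTensor ζ T u v - (2 : ℝ) • φ (leePart φ ζ θ u (φ v)) := by
  have h1 := congrArg φ (hK u (φ v))
  rw [h.φ_φ_eq, map_neg, horTensor_hor_right h, hT.horTensor_φ h, map_add, map_neg, h.φ_φ_eq,
    hor_horTensor h, map_neg, map_smul] at h1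
  rw [← h1]; abel

theorem φ_horTensor_φ_left_of_comm (h : IsACM φ ζ) (hT : IsTorsion φ ζ T)
    (hK : ∀ u v, horTensor ζ T (φ u) (φ v) = horTensor ζ T u v)
    (u v : V) : φ (horTensor ζ T (φ u) v) = - horTensor ζ T u v := by
  have h1 := congrArg φ (hK u (φ v))
  rw [h.φ_φ_eq, map_neg, horTensor_hor_right h, hT.horTensor_φ h, map_neg, map_neg, h.φ_φ_eq,
    hor_horTensor h] at h1
  rw [← neg_eq_iff_eq_neg.2 h1, neg_neg]

theorem inner_basisSum_leePart (h : IsACM φ ζ) (P : V →ₗ[ℝ] V) (hP : ∀ u, hor ζ (P u) = P u)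
    (X Y : V) : ⟪basisSum (fun e ↦ φ (leePart φ ζ (P e) e (φ X))), Y⟫ =
      (1 / 4 : ℝ) * (⟪P (hor ζ X), Y⟫ - ⟪P (hor ζ Y), X⟫ - ⟪P (φ X), φ Y⟫ + ⟪P (φ Y), φ X⟫) := by
  have h1 : ∀ e, ⟪φ (leePart φ ζ (P e) e (φ X)), Y⟫ = (1 / 4 : ℝ) *
      (⟪hor ζ X, e⟫ * ⟪P e, Y⟫ - ⟪hor ζ Y, e⟫ * ⟪P e, X⟫ - ⟪φ X, e⟫ * ⟪P e, φ Y⟫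
        + ⟪φ Y, e⟫ * ⟪P e, φ X⟫) := fun e ↦ by
    have h2 : ∀ v, ⟪φ (P e), φ v⟫ = ⟪P e, v⟫ := fun v ↦ by
      rw [h.inner_φ, ← hP e, h.inner_ζ_hor]; ring
    have h3 : ∀ v, ⟪φ e, φ v⟫ = ⟪hor ζ v, e⟫ := fun v ↦ by
      rw [h.inner_φ, hor, inner_sub_left, real_inner_smul_left, real_inner_comm]; ring
    rw [h.inner_φ_left, inner_leePart_right, h2, h2, h3, h3, inner_hor_left, h.hor_φ,
      inner_hor_left, h.hor_φ, real_inner_comm (φ X) e, real_inner_comm (φ Y) e]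
    ring
  have hl : ∀ v, IsLinearMap ℝ fun e ↦ ⟪P e, v⟫ := fun v ↦ by
    constructor <;> intros <;> simp [inner_add_left, real_inner_smul_left]
  rw [inner_basisSum, basisSum_congr h1, basisSum_mul, basisSum_add, basisSum_sub, basisSum_sub,
    basisSum_inner_mul_of (hl _), basisSum_inner_mul_of (hl _), basisSum_inner_mul_of (hl _),
    basisSum_inner_mul_of (hl _)]

namespace IsPointData

variable (D : IsPointData φ ζ T A R)
include D

/-- The skew-symmetric part of `Ric^*` on `ζ^⊥` for the types containing `A ⊕ C_4`. -/
theorem starRicci_alt_of_anti {ε : ℝ} (hεε : ε * ε = 1)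
    (hε : ∀ u, reebL ζ T (φ u) = ε • φ (reebL ζ T u)) (hθ : hor ζ θ = θ)
    (hH : horTrace ζ T = (((n : ℝ) - 1) / 2) • θ)
    (hK : ∀ u v, horTensor ζ T u v + horTensor ζ T (φ u) (φ v) = (2 : ℝ) • leePart φ ζ θ u v)
    (P : V →ₗ[ℝ] V) (hP : ∀ u, hor ζ (P u) = P u)
    (hA : ∀ w u v, horTensor ζ (A w) u v + horTensor ζ (A w) (φ u) (φ v)
      = (2 : ℝ) • leePart φ ζ (P w) u v) (X Y : V) :
    (1 / 2 : ℝ) * (starRicci φ R (hor ζ X) (hor ζ Y) - starRicci φ R (hor ζ Y) (hor ζ X)) =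
      ⟪hor ζ (codiff T A (hor ζ X)), Y⟫
      + lambda20 φ (fun u v ↦ ⟪P u - T u θ, v⟫ - ⟪P v - T v θ, u⟫) X Y
      + ((n : ℝ) - 3) * ⟪comp1 φ ζ (T · ·) θ X, Y⟫ + (n : ℝ) * ⟪comp2 φ ζ (T · ·) θ X, Y⟫
      - reebTrace ζ T * ⟪alongL ζ T X, Y⟫ - reebTraceφ φ ζ T * ⟪alongL ζ T (φ X), Y⟫
      + ⟪alongL ζ (A ζ) X, Y⟫ + ⟪comp1 φ ζ (T · ·) (T ζ ζ) X, Y⟫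
      + ⟪comp2 φ ζ (T · ·) (T ζ ζ) X, Y⟫ + ⟪leePart φ ζ θ (T ζ ζ) X, Y⟫ := by
  have e1 : φ (basisSum fun e ↦ horTensor ζ (A e) (φ e) X) =
      basisSum (fun e ↦ horTensor ζ (A e) e X)
        - (2 : ℝ) • basisSum (fun e ↦ φ (leePart φ ζ (P e) e (φ X))) := by
    rw [← basisSum_smul, ← basisSum_sub]
    exact (map_basisSum φ.toLinearMap _).trans
      (basisSum_congr fun e ↦ φ_horTensor_φ_left_of_anti D.acm (D.torA e) (hA e) e X)
  have e2 : φ (horTensor ζ T (φ (horTrace ζ T)) X) = horTensor ζ T (horTrace ζ T) X := by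
    rw [φ_horTensor_φ_left_of_anti D.acm D.tor hK, hH, leePart_smul_left, leePart_self hθ,
      smul_zero, map_zero, smul_zero, sub_zero]
  have e3 : ∀ u, horTensor ζ T u X = antiPart φ ζ (T · ·) u X + leePart φ ζ θ u X := fun u ↦ by
    rw [antiPart_eq]
    linear_combination (norm := module) (1 / 2 : ℝ) • hK u X
  have e4 : horTensor ζ T (horTrace ζ T) X = (((n : ℝ) - 1) / 2) • antiPart φ ζ (T · ·) θ X := by
    rw [hH, map_smul, LinearMap.smul_apply, e3, leePart_self hθ, add_zero]
  have e5 : lambda20 φ (fun u v ↦ ⟪P u - T u θ, v⟫ - ⟪P v - T v θ, u⟫) X Y =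
      (1 / 2 : ℝ) * (⟪P (hor ζ X), Y⟫ - ⟪P (hor ζ Y), X⟫ - ⟪P (φ X), φ Y⟫ + ⟪P (φ Y), φ X⟫)
      - ⟪antiPart φ ζ (T · ·) X θ, Y⟫ + ⟪antiPart φ ζ (T · ·) Y θ, X⟫ := by
    have e6 : ∀ u v, ⟪P (hor ζ u), hor ζ v⟫ = ⟪P (hor ζ u), v⟫ := fun u v ↦ by
      rw [← inner_hor_left, hP]
    have e7 : ∀ u v, ⟪T (hor ζ u) θ, hor ζ v⟫ = ⟪horTensor ζ T u θ, v⟫ := fun u v ↦ by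
      rw [horTensor_apply, inner_hor_left, hθ]
    have e8 : ∀ u v, ⟪T (φ u) θ, φ v⟫ = ⟪horTensor ζ T (φ u) (φ θ), v⟫ := fun u v ↦ by
      rw [D.tor.horTensor_φ D.acm, inner_neg_left, D.acm.inner_φ_left, neg_neg, horTensor_apply,
        D.acm.hor_φ, hθ, inner_hor_left, D.acm.hor_φ]
    simp only [lambda20, D.acm.φ_φ_eq, map_neg, inner_sub_left, inner_neg_left, inner_neg_right,
      LinearMap.neg_apply, e6, e7, e8, antiPart_eq, real_inner_smul_left]
    ring
  have e9 : ∀ u, comp2 φ ζ (T · ·) u X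
      = antiPart φ ζ (T · ·) u X - comp1 φ ζ (T · ·) u X := fun u ↦ rfl
  have e10 := antiPart_skew D.acm D.tor X θ Y
  have e11 : ⟪antiPart φ ζ (T · ·) X Y, θ⟫ = - ⟪antiPart φ ζ (T · ·) X θ, Y⟫ := by
    rw [antiPart_skew D.acm D.tor, real_inner_comm]
  rw [D.starRicci_alt_eq hεε hε, D.hor_codiff_hor, e5, e9, e9, D.tor.alongL_φ D.acm]
  simp only [map_add, map_neg, map_smul, e1, e2, e4, e3 (T ζ ζ), inner_add_left, inner_sub_left,
    inner_neg_left, real_inner_smul_left, inner_basisSum_leePart D.acm P hP,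
    inner_comp1 D.acm D.tor θ, e11]
  ring

/-- The skew-symmetric part of `Ric^*` on `ζ^⊥` for the types containing `B`. -/
theorem starRicci_alt_of_comm {ε : ℝ} (hεε : ε * ε = 1)
    (hε : ∀ u, reebL ζ T (φ u) = ε • φ (reebL ζ T u)) (hθ : hor ζ θ = θ)
    (hH : horTrace ζ T = (((n : ℝ) - 1) / 2) • θ) (hθT : θ = traceVec n ζ (T · ·))
    (hK : ∀ u v, horTensor ζ T (φ u) (φ v) = horTensor ζ T u v)
    (hA : ∀ w u v, horTensor ζ (A w) (φ u) (φ v) = horTensor ζ (A w) u v) (X Y : V) :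
    (1 / 2 : ℝ) * (starRicci φ R (hor ζ X) (hor ζ Y) - starRicci φ R (hor ζ Y) (hor ζ X)) =
      - ⟪hor ζ (codiff T A (hor ζ X)), Y⟫
      - ((n : ℝ) - 1) * ⟪comp3 n φ ζ (T · ·) θ X, Y⟫ - ⟪alongL ζ (A ζ) X, Y⟫
      - ⟪comp3 n φ ζ (T · ·) (T ζ ζ) X, Y⟫ - ⟪leePart φ ζ θ (T ζ ζ) X, Y⟫
      + reebTrace ζ T * ⟪alongL ζ T X, Y⟫ - reebTraceφ φ ζ T * ⟪alongL ζ T (φ X), Y⟫ := by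
  have e1 : φ (basisSum fun e ↦ horTensor ζ (A e) (φ e) X) =
      - basisSum (fun e ↦ horTensor ζ (A e) e X) := by
    rw [← basisSum_neg]
    exact (map_basisSum φ.toLinearMap _).trans
      (basisSum_congr fun e ↦ φ_horTensor_φ_left_of_comm D.acm (D.torA e) (hA e) e X)
  have e2 := φ_horTensor_φ_left_of_comm D.acm D.tor hK (horTrace ζ T) X
  have e3 : ∀ u, horTensor ζ T u X = comp3 n φ ζ (T · ·) u X + leePart φ ζ θ u X := fun u ↦ by
    rw [hθT, ← comp4_eq, comp3_add_comp4, commPart_eq, hK]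
    module
  have e4 : horTensor ζ T (horTrace ζ T) X = (((n : ℝ) - 1) / 2) • comp3 n φ ζ (T · ·) θ X := by
    rw [hH, map_smul, LinearMap.smul_apply, e3, leePart_self hθ, add_zero]
  rw [D.starRicci_alt_eq hεε hε, D.hor_codiff_hor, D.tor.alongL_φ D.acm]
  simp only [map_add, map_neg, map_smul, e1, e2, e4, e3 (T ζ ζ), inner_add_left, inner_sub_left,
    inner_neg_left, real_inner_smul_left]
  ring

end IsPointData

end HorizontalPart

section ReebPart

variable {V : Type*} [NormedAddCommGroup V] [InnerProductSpace ℝ V] [FiniteDimensional ℝ V]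
  {W : Type*} [AddCommGroup W] [Module ℝ W]

variable {φ : V →L[ℝ] V} {ζ : V} {T : V →ₗ[ℝ] V →ₗ[ℝ] V} {A R : V →ₗ[ℝ] V →ₗ[ℝ] V →ₗ[ℝ] V}
  {n : ℕ} {θ : V}

theorem IsACM.basisSum_φφ (h : IsACM φ ζ) {B : V → V → W} (hB : IsBilinearMap ℝ B) :
    basisSum (fun e ↦ B (φ e) (φ e)) = basisSum (fun e ↦ B e (hor ζ e)) := by
  have h1 := h.basisSum_φ (B := fun u v ↦ B u (φ v)) (by
    constructor <;> intros <;> simp [hB.add_left, hB.add_right, hB.smul_left, hB.smul_right])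
  rw [h1, ← basisSum_neg]
  refine basisSum_congr fun e ↦ ?_
  rw [h.φ_φ_eq, ← neg_one_smul ℝ (hor ζ e), hB.smul_right, neg_one_smul, neg_neg]

section Traces

variable (h : IsACM φ ζ) (hT : IsTorsion φ ζ T)
include h

theorem reebTrace_eq_zero (hL : ∀ u, reebL ζ T (φ u) = - φ (reebL ζ T u)) :
    reebTrace ζ T = 0 := by
  have h1 := h.basisSum_φφ (B := fun u v ↦ ⟪reebL ζ T u, v⟫) (by
    constructor <;> intros <;> simp [inner_add_left, inner_add_right, real_inner_smul_left,
      real_inner_smul_right])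
  have h2 : ∀ e, ⟪reebL ζ T (φ e), φ e⟫ = - ⟪reebL ζ T e, e⟫ := fun e ↦ by
    rw [hL, inner_neg_left, h.inner_φ, inner_ζ_reebL h, zero_mul, sub_zero]
  have h3 : ∀ e, ⟪reebL ζ T e, hor ζ e⟫ = ⟪reebL ζ T e, e⟫ := fun e ↦ by
    rw [← inner_hor_left, hor_reebL h]
  rw [basisSum_congr h2, basisSum_congr h3, basisSum_neg] at h1
  rw [reebTrace]; linarith

theorem reebTraceφ_eq_zero (hL : ∀ u, reebL ζ T (φ u) = - φ (reebL ζ T u)) :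
    reebTraceφ φ ζ T = 0 := by
  have h1 := h.basisSum_φφ (B := fun u v ↦ ⟪reebL ζ T u, φ v⟫) (by
    constructor <;> intros <;> simp [inner_add_left, inner_add_right, real_inner_smul_left,
      real_inner_smul_right])
  have h2 : ∀ e, ⟪reebL ζ T (φ e), φ (φ e)⟫ = - ⟪reebL ζ T e, φ e⟫ := fun e ↦ by
    rw [hL, inner_neg_left, h.inner_φ, inner_ζ_reebL h, zero_mul, sub_zero]
  simp only [h2, h.φ_hor, basisSum_neg] at h1
  rw [reebTraceφ]; linarith

theorem hor_adjoint_reebL (u : V) :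
    hor ζ (LinearMap.adjoint (reebL ζ T) u) = LinearMap.adjoint (reebL ζ T) u := by
  refine ext_inner_right ℝ fun v ↦ ?_
  rw [inner_hor_left, LinearMap.adjoint_inner_left, LinearMap.adjoint_inner_left, reebL_hor h]

theorem φ_adjoint_reebL_φ {ε : ℝ} (hL : ∀ u, reebL ζ T (φ u) = ε • φ (reebL ζ T u)) (u : V) :
    φ (LinearMap.adjoint (reebL ζ T) (φ u)) = - ε • LinearMap.adjoint (reebL ζ T) u := by
  refine ext_inner_right ℝ fun v ↦ ?_
  rw [h.inner_φ_left, LinearMap.adjoint_inner_left, hL, real_inner_smul_right, h.inner_φ,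
    inner_ζ_reebL h, mul_zero, sub_zero, real_inner_smul_left, LinearMap.adjoint_inner_left]
  ring

/-- The trace of `leePart θ · (reebL ·)`. -/
theorem basisSum_leePart_reebL : basisSum (fun e ↦ leePart φ ζ θ e (reebL ζ T e)) =
    (1 / 4 : ℝ) • (reebTrace ζ T • θ - LinearMap.adjoint (reebL ζ T) θ - reebTraceφ φ ζ T • φ θ
      + φ (LinearMap.adjoint (reebL ζ T) (φ θ))) := by
  have h1 : ∀ e, leePart φ ζ θ e (reebL ζ T e) = (1 / 4 : ℝ) • (⟪reebL ζ T e, e⟫ • θ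
      - ⟪LinearMap.adjoint (reebL ζ T) θ, e⟫ • horL ζ e - ⟪reebL ζ T e, φ e⟫ • φ θ
      + ⟪LinearMap.adjoint (reebL ζ T) (φ θ), e⟫ • φ.toLinearMap e) := fun e ↦ by
    rw [leePart, inner_hor_left, hor_reebL h, LinearMap.adjoint_inner_left,
      LinearMap.adjoint_inner_left, real_inner_comm, real_inner_comm (φ e)]
    rfl
  rw [basisSum_congr h1, basisSum_smul, basisSum_add, basisSum_sub, basisSum_sub,
    basisSum_inner_smul, basisSum_inner_smul, horL_apply, hor_adjoint_reebL h, reebTrace,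
    reebTraceφ]
  congr 3
  · congr 2
    · exact (Finset.sum_smul ..).symm
  · exact (Finset.sum_smul ..).symm

theorem basisSum_inner_hor (hd : Module.finrank ℝ V = 2 * n + 1) :
    basisSum (fun e ↦ ⟪hor ζ e, e⟫) = 2 * n := by
  have h1 : ∀ e, ⟪hor ζ e, e⟫ = ⟪e, e⟫ - ⟪ζ, e⟫ * ⟪ζ, e⟫ := fun e ↦ by
    rw [hor, inner_sub_left, real_inner_smul_left]
  rw [basisSum_congr h1, basisSum_sub, basisSum_inner_mul, h.inner_ζ]
  have h2 : basisSum (fun e : V ↦ ⟪e, e⟫) = (2 * n + 1 : ℕ) := by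
    simp [basisSum, ← hd]
  rw [h2]
  push_cast
  ring

theorem basisSum_inner_φ : basisSum (fun e ↦ ⟪φ e, e⟫) = 0 := by
  have h1 : ∀ e, ⟪φ e, e⟫ = 0 := fun e ↦ by
    have := h.inner_φ_left e e
    rw [real_inner_comm] at this
    rw [real_inner_comm]
    linarith
  rw [basisSum_congr h1, basisSum_const_zero]

theorem basisSum_leePart (hd : Module.finrank ℝ V = 2 * n + 1) (hθ : hor ζ θ = θ) :
    basisSum (fun e ↦ leePart φ ζ θ e e) = (((n : ℝ) - 1) / 2) • θ := by
  have h1 : ∀ e, leePart φ ζ θ e e = (1 / 4 : ℝ) • (⟪hor ζ e, e⟫ • θ - ⟪θ, e⟫ • horL ζ e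
      - ⟪φ e, e⟫ • φ θ + ⟪φ θ, e⟫ • φ.toLinearMap e) := fun e ↦ rfl
  have h2 : ∀ (f : V → ℝ) (v : V), basisSum (fun e ↦ f e • v) = basisSum f • v := fun f v ↦
    (Finset.sum_smul ..).symm
  rw [basisSum_congr h1, basisSum_smul, basisSum_add, basisSum_sub, basisSum_sub, h2, h2,
    basisSum_inner_smul, basisSum_inner_smul, basisSum_inner_hor h hd, basisSum_inner_φ h,
    horL_apply, hθ]
  have : φ.toLinearMap (φ θ) = - θ := (h.φ_φ_eq θ).trans (by rw [hθ])
  rw [this]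
  module

theorem leePart_φ_right (hθ : hor ζ θ = θ) (u v : V) :
    leePart φ ζ θ u (φ v) = - φ (leePart φ ζ θ u v) := by
  simp only [leePart, map_smul, map_add, map_sub, h.φ_hor, h.φ_φ_eq, hθ]
  have h1 : ∀ a b, ⟪φ a, φ b⟫ = ⟪hor ζ a, b⟫ := fun a b ↦ by
    rw [h.inner_φ, hor, inner_sub_left, real_inner_smul_left]
  have h2 : ⟪θ, φ v⟫ = - ⟪φ θ, v⟫ := by rw [h.inner_φ_left, neg_neg]
  have h3 : ⟪hor ζ u, φ v⟫ = - ⟪φ u, v⟫ := by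
    rw [h.inner_φ_left, neg_neg, inner_hor_left, h.hor_φ]
  rw [h1, h1, hθ, h2, h3]
  module

omit h in
theorem leePart_skew (u v w : V) : ⟪leePart φ ζ θ u v, w⟫ = - ⟪v, leePart φ ζ θ u w⟫ := by
  rw [inner_leePart_right, real_inner_comm (leePart φ ζ θ u w), inner_leePart_right]
  ring

omit h in
theorem leePart_add_right (u v w : V) :
    leePart φ ζ θ u (v + w) = leePart φ ζ θ u v + leePart φ ζ θ u w := by
  simp only [leePart, inner_add_right]; module

omit h in
theorem leePart_smul_right (c : ℝ) (u v : V) :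
    leePart φ ζ θ u (c • v) = c • leePart φ ζ θ u v := by
  simp only [leePart, real_inner_smul_right]; module

end Traces

/-! ### The operators `L_5, …, L_10` -/

section ReebOperators

variable (h : IsACM φ ζ)
include h

theorem reebComm_fun (hL : ∀ u, reebL ζ T (φ u) = φ (reebL ζ T u)) :
    reebComm φ ζ (T · ·) = (reebL ζ T ·) := by
  funext u
  rw [reebComm_eq, hL, h.φ_φ_eq, hor_reebL h]; module

theorem reebAnti_fun (hL : ∀ u, reebL ζ T (φ u) = - φ (reebL ζ T u)) :
    reebAnti φ ζ (T · ·) = (reebL ζ T ·) := by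
  funext u
  rw [reebAnti_eq, hL, map_neg, h.φ_φ_eq, hor_reebL h]; module

theorem reeb7_eq (hL : ∀ u, reebL ζ T (φ u) = φ (reebL ζ T u)) (u : V) :
    reeb7 n φ ζ (T · ·) u = (1 / 2 : ℝ) • (reebL ζ T u - LinearMap.adjoint (reebL ζ T) u)
      - (reebTraceφ φ ζ T / (2 * n)) • φ u := by
  rw [reeb7, reebComm_fun h hL, transp_eq]; rfl

theorem reeb8_eq (hL : ∀ u, reebL ζ T (φ u) = φ (reebL ζ T u)) (u : V) :
    reeb8 n φ ζ (T · ·) u = (1 / 2 : ℝ) • (reebL ζ T u + LinearMap.adjoint (reebL ζ T) u)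
      - (reebTrace ζ T / (2 * n)) • hor ζ u := by
  rw [reeb8, reebComm_fun h hL, transp_eq]; rfl

theorem reeb9_eq (hL : ∀ u, reebL ζ T (φ u) = - φ (reebL ζ T u)) (u : V) :
    reeb9 φ ζ (T · ·) u = (1 / 2 : ℝ) • (reebL ζ T u + LinearMap.adjoint (reebL ζ T) u) := by
  rw [reeb9, reebAnti_fun h hL, transp_eq]

theorem reeb10_eq (hL : ∀ u, reebL ζ T (φ u) = - φ (reebL ζ T u)) (u : V) :
    reeb10 φ ζ (T · ·) u = (1 / 2 : ℝ) • (reebL ζ T u - LinearMap.adjoint (reebL ζ T) u) := by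
  rw [reeb10, reebAnti_fun h hL, transp_eq]

omit h in
theorem lift_ζ_right (hζ : ⟪ζ, ζ⟫ = 1) {L : V → V} {u : V} (hL : hor ζ (L u) = L u) :
    lift ζ L u ζ = L u := by
  have : ⟪L u, ζ⟫ = 0 := by
    rw [← hL, hor, inner_sub_left, real_inner_smul_left, real_inner_comm, hζ]; ring
  rw [lift, hζ, this]; module

end ReebOperators

/-! ### Traces of `T_e L e` -/

section HorReeb

variable (h : IsACM φ ζ) (hT : IsTorsion φ ζ T)
include h

theorem basisSum_antiPart_reebL (hL : ∀ u, reebL ζ T (φ u) = φ (reebL ζ T u)) :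
    basisSum (fun e ↦ antiPart φ ζ (T · ·) e (reebL ζ T e)) = 0 := by
  have h1 := h.basisSum_φφ (B := fun u v ↦ antiPart φ ζ (T · ·) u (reebL ζ T v)) (by
    constructor <;> intros <;> simp only [antiPart_eq, map_add, map_smul, LinearMap.add_apply,
      LinearMap.smul_apply] <;> module)
  have h2 : ∀ e, antiPart φ ζ (T · ·) (φ e) (reebL ζ T (φ e))
      = - antiPart φ ζ (T · ·) e (reebL ζ T e) := fun e ↦ by
    simp only [antiPart_eq, hL, h.φ_φ_eq, map_neg, horTensor_hor_left h, horTensor_hor_right h,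
      LinearMap.neg_apply]
    module
  simp only [h2, reebL_hor h, basisSum_neg] at h1
  linear_combination (norm := module) (-1 / 2 : ℝ) • h1

/-- `∑ H_e L e` for types containing `A ⊕ C_4 ⊕ C`. -/
theorem basisSum_horTensor_reebL_anti_comm (hL : ∀ u, reebL ζ T (φ u) = φ (reebL ζ T u))
    (hK : ∀ u v, horTensor ζ T u v + horTensor ζ T (φ u) (φ v) = (2 : ℝ) • leePart φ ζ θ u v) :
    basisSum (fun e ↦ horTensor ζ T e (reebL ζ T e)) = (1 / 4 : ℝ) • (reebTrace ζ T • θ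
      - (2 : ℝ) • LinearMap.adjoint (reebL ζ T) θ - reebTraceφ φ ζ T • φ θ) := by
  have h1 : ∀ e, horTensor ζ T e (reebL ζ T e) = antiPart φ ζ (T · ·) e (reebL ζ T e)
      + leePart φ ζ θ e (reebL ζ T e) := fun e ↦ by
    rw [antiPart_eq]
    linear_combination (norm := module) (1 / 2 : ℝ) • hK e (reebL ζ T e)
  rw [basisSum_congr h1, basisSum_add, basisSum_antiPart_reebL h hL, basisSum_leePart_reebL h,
    φ_adjoint_reebL_φ h (ε := 1) (by simpa using hL)]
  module

/-- `∑ H_e L e` for types containing `B ⊕ D`. -/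
theorem basisSum_horTensor_reebL_comm_anti (hL : ∀ u, reebL ζ T (φ u) = - φ (reebL ζ T u))
    (hK : ∀ u v, horTensor ζ T (φ u) (φ v) = horTensor ζ T u v) :
    basisSum (fun e ↦ horTensor ζ T e (reebL ζ T e)) = 0 := by
  have h1 := h.basisSum_φφ (B := fun u v ↦ horTensor ζ T u (reebL ζ T v)) (by
    constructor <;> intros <;> simp only [map_add, map_smul, LinearMap.add_apply,
      LinearMap.smul_apply])
  simp only [hL, map_neg, hK, reebL_hor h, basisSum_neg] at h1
  linear_combination (norm := module) (-1 / 2 : ℝ) • h1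

include hT

theorem isBilinearMap_inner_comp1 (w : V) :
    IsBilinearMap ℝ fun u v ↦ ⟪comp1 φ ζ (T · ·) u v, w⟫ := by
  constructor <;> intros <;> simp only [inner_comp1 h hT, antiPart_eq, map_add, map_smul,
    LinearMap.add_apply, LinearMap.smul_apply, real_inner_smul_left, inner_add_left, inner_sub_left,
    real_inner_smul_right, inner_add_right, smul_eq_mul] <;> ring

theorem inner_comp1_swap (u v w : V) :
    ⟪comp1 φ ζ (T · ·) u v, w⟫ = - ⟪comp1 φ ζ (T · ·) v u, w⟫ := by
  have h1 : ∀ a b c, ⟪antiPart φ ζ (T · ·) a b, c⟫ = - ⟪antiPart φ ζ (T · ·) a c, b⟫ :=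
    fun a b c ↦ by rw [antiPart_skew h hT, real_inner_comm]
  rw [inner_comp1 h hT, inner_comp1 h hT, h1 u v w, h1 v w u, h1 w u v]
  ring

theorem basisSum_comp1_symm {L : V → V} (hL : ∀ u v, ⟪L u, v⟫ = ⟪u, L v⟫) (w : V) :
    basisSum (fun e ↦ ⟪comp1 φ ζ (T · ·) e (L e), w⟫) = 0 := by
  have h1 := basisSum_adjoint (isBilinearMap_inner_comp1 h hT w) hL
  rw [basisSum_congr fun e ↦ inner_comp1_swap h hT (L e) e w, basisSum_neg] at h1
  linarith

/-- `∑ H_e L e` for types containing `A ⊕ C_4 ⊕ D`. -/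
theorem basisSum_horTensor_reebL_anti_anti (hL : ∀ u, reebL ζ T (φ u) = - φ (reebL ζ T u))
    (hK : ∀ u v, horTensor ζ T u v + horTensor ζ T (φ u) (φ v) = (2 : ℝ) • leePart φ ζ θ u v) :
    basisSum (fun e ↦ horTensor ζ T e (reebL ζ T e)) =
      basisSum (fun e ↦ comp1 φ ζ (T · ·) e (reeb10 φ ζ (T · ·) e))
      + basisSum (fun e ↦ comp2 φ ζ (T · ·) e (reeb9 φ ζ (T · ·) e + reeb10 φ ζ (T · ·) e)) := by
  have h9 : ∀ u v, ⟪reeb9 φ ζ (T · ·) u, v⟫ = ⟪u, reeb9 φ ζ (T · ·) v⟫ := fun u v ↦ by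
    rw [reeb9_eq h hL, reeb9_eq h hL, real_inner_smul_left, real_inner_smul_right, inner_add_left,
      inner_add_right, LinearMap.adjoint_inner_left, LinearMap.adjoint_inner_right]
    ring
  have hsum : ∀ u, reeb9 φ ζ (T · ·) u + reeb10 φ ζ (T · ·) u = reebL ζ T u := fun u ↦ by
    rw [reeb9_add_reeb10, reebAnti_fun h hL]
  refine ext_inner_right ℝ fun w ↦ ?_
  have h0 := basisSum_comp1_symm h hT h9 w
  have hlee : basisSum (fun e ↦ ⟪leePart φ ζ θ e (reebL ζ T e), w⟫) = 0 := by
    rw [← inner_basisSum, basisSum_leePart_reebL h, reebTrace_eq_zero h hL,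
      reebTraceφ_eq_zero h hL, φ_adjoint_reebL_φ h (ε := -1) (by simpa using hL)]
    rw [show (1 / 4 : ℝ) • ((0 : ℝ) • θ - LinearMap.adjoint (reebL ζ T) θ - (0 : ℝ) • φ θ
      + -(-1 : ℝ) • LinearMap.adjoint (reebL ζ T) θ) = 0 by module, inner_zero_left]
  have h1 : ∀ e, ⟪horTensor ζ T e (reebL ζ T e), w⟫ =
      ⟪comp1 φ ζ (T · ·) e (reeb10 φ ζ (T · ·) e), w⟫
      + ⟪comp2 φ ζ (T · ·) e (reeb9 φ ζ (T · ·) e + reeb10 φ ζ (T · ·) e), w⟫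
      + ⟪comp1 φ ζ (T · ·) e (reeb9 φ ζ (T · ·) e), w⟫
      + ⟪leePart φ ζ θ e (reebL ζ T e), w⟫ := fun e ↦ by
    have e1 := (isBilinearMap_inner_comp1 h hT w).add_right e (reeb9 φ ζ (T · ·) e)
      (reeb10 φ ζ (T · ·) e)
    have e2 : horTensor ζ T e (reebL ζ T e) = comp1 φ ζ (T · ·) e (reebL ζ T e)
        + comp2 φ ζ (T · ·) e (reebL ζ T e) + leePart φ ζ θ e (reebL ζ T e) := by
      rw [comp1_add_comp2, antiPart_eq]
      linear_combination (norm := module) (1 / 2 : ℝ) • hK e (reebL ζ T e)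
    rw [hsum] at e1 ⊢
    rw [e2, inner_add_left, inner_add_left, e1]
    ring
  rw [inner_add_left, inner_basisSum, inner_basisSum, inner_basisSum, basisSum_congr h1,
    basisSum_add, basisSum_add, basisSum_add, h0, hlee]
  ring

theorem comp3_eq_of_comm (hK : ∀ u v, horTensor ζ T (φ u) (φ v) = horTensor ζ T u v)
    (hθT : θ = traceVec n ζ (T · ·)) (u v : V) :
    comp3 n φ ζ (T · ·) u v = horTensor ζ T u v - leePart φ ζ θ u v := by
  rw [comp3, commPart_eq, hK, comp4_eq, hθT]; module

theorem sharp_formInner_comp3 (hK : ∀ u v, horTensor ζ T (φ u) (φ v) = horTensor ζ T u v)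
    (hθT : θ = traceVec n ζ (T · ·)) (L : V → V) :
    sharp (fun w ↦ formInner (fun u v ↦ ⟪L u, v⟫) (fun u v ↦ ⟪comp3 n φ ζ (T · ·) u w, v⟫))
      = - basisSum (fun e ↦ comp3 n φ ζ (T · ·) e (L e)) := by
  refine ext_inner_right ℝ fun w ↦ ?_
  have h1 : ∀ w, formInner (fun u v ↦ ⟪L u, v⟫) (fun u v ↦ ⟪comp3 n φ ζ (T · ·) u w, v⟫)
      = - basisSum (fun e ↦ ⟪comp3 n φ ζ (T · ·) e (L e), w⟫) := fun w ↦ by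
    rw [formInner, ← basisSum_neg]
    refine basisSum_congr fun e ↦ ?_
    rw [basisSum_inner_mul, comp3_eq_of_comm h hT hK hθT, comp3_eq_of_comm h hT hK hθT,
      inner_sub_left, hT.horTensor_skew h, leePart_skew, inner_sub_right]
    ring
  rw [inner_sharp, h1, inner_neg_left, inner_basisSum]
  simp only [h1, ← inner_basisSum]
  constructor <;> intros <;> simp [inner_add_right, real_inner_smul_right, add_comm]

/-- `∑ H_e L e` for types containing `B ⊕ C`. -/
theorem basisSum_horTensor_reebL_comm_comm (hd : Module.finrank ℝ V = 2 * n + 1)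
    (hθ : hor ζ θ = θ) (hH : horTrace ζ T = (((n : ℝ) - 1) / 2) • θ)
    (hL : ∀ u, reebL ζ T (φ u) = φ (reebL ζ T u))
    (hK : ∀ u v, horTensor ζ T (φ u) (φ v) = horTensor ζ T u v)
    (hθT : θ = traceVec n ζ (T · ·)) :
    basisSum (fun e ↦ horTensor ζ T e (reebL ζ T e)) = (1 / 4 : ℝ) • (reebTrace ζ T • θ
      - (2 : ℝ) • LinearMap.adjoint (reebL ζ T) θ - reebTraceφ φ ζ T • φ θ)
      + basisSum (fun e ↦ comp3 n φ ζ (T · ·) e (reeb8 n φ ζ (T · ·) e))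
      + basisSum (fun e ↦ comp3 n φ ζ (T · ·) e (reeb7 n φ ζ (T · ·) e)) := by
  have h3 := comp3_eq_of_comm h hT hK hθT
  have hself : basisSum (fun e ↦ comp3 n φ ζ (T · ·) e e) = 0 := by
    rw [basisSum_congr fun e ↦ h3 e e, basisSum_sub, basisSum_leePart h hd hθ, ← horTrace, hH,
      sub_self]
  have hφ : basisSum (fun e ↦ comp3 n φ ζ (T · ·) e (φ e)) = 0 := by
    have h4 : ∀ e, comp3 n φ ζ (T · ·) e (φ e) = - φ.toLinearMap (comp3 n φ ζ (T · ·) e e) :=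
      fun e ↦ by
        rw [h3, h3, hT.horTensor_φ h, leePart_φ_right h hθ, map_sub]
        change _ = - (φ _ - φ _)
        abel
    rw [basisSum_congr h4, basisSum_neg, ← map_basisSum, hself, map_zero, neg_zero]
  have h5 : ∀ e, horTensor ζ T e (reebL ζ T e) = leePart φ ζ θ e (reebL ζ T e)
      + comp3 n φ ζ (T · ·) e (reeb8 n φ ζ (T · ·) e)
      + comp3 n φ ζ (T · ·) e (reeb7 n φ ζ (T · ·) e)
      + (reebTrace ζ T / (2 * n)) • comp3 n φ ζ (T · ·) e e
      + (reebTraceφ φ ζ T / (2 * n)) • comp3 n φ ζ (T · ·) e (φ e) := fun e ↦ by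
    have h6 : reebL ζ T e = reeb8 n φ ζ (T · ·) e + reeb7 n φ ζ (T · ·) e
        + (reebTrace ζ T / (2 * n)) • hor ζ e + (reebTraceφ φ ζ T / (2 * n)) • φ e := by
      rw [reeb7_eq h hL, reeb8_eq h hL]; module
    have h7 : comp3 n φ ζ (T · ·) e e = comp3 n φ ζ (T · ·) e (hor ζ e) := by
      rw [h3, h3, horTensor_hor_right h, leePart_hor_right h hθ]
    rw [h7]
    simp only [h3]
    have h8 := congrArg (horTensor ζ T e) h6
    have h9 := congrArg (leePart φ ζ θ e) h6
    simp only [map_add, map_smul, leePart_add_right, leePart_smul_right] at h8 h9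
    rw [h9]
    linear_combination (norm := module) h8
  rw [basisSum_congr h5, basisSum_add, basisSum_add, basisSum_add, basisSum_add, basisSum_smul,
    basisSum_smul, hself, hφ, basisSum_leePart_reebL h,
    φ_adjoint_reebL_φ h (ε := 1) (by simpa using hL)]
  module

end HorReeb

/-! ### The vector `Ric^*(ζ)` -/

namespace IsPointData

variable (D : IsPointData φ ζ T A R)
include D

theorem starRicci_ζ_of_comm (hL : ∀ u, reebL ζ T (φ u) = φ (reebL ζ T u))
    (hA : ∀ w u, reebL ζ (A w) (φ u) = φ (reebL ζ (A w) u)) :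
    sharp (starRicci φ R ζ) = - codiff T A ζ
      - (A ζ ζ ζ - alongL ζ T (T ζ ζ) - LinearMap.adjoint (reebL ζ T) (T ζ ζ))
      - alongL ζ T (T ζ ζ) - reebL ζ T (T ζ ζ) - LinearMap.adjoint (reebL ζ T) (T ζ ζ)
      - (2 : ℝ) • reebL ζ T (horTrace ζ T) + reebTrace ζ T • T ζ ζ
      + reebTraceφ φ ζ T • φ (T ζ ζ) + basisSum (fun e ↦ horTensor ζ T e (reebL ζ T e)) := by
  have h1 : φ (basisSum fun e ↦ reebL ζ (A e) (φ e)) = - basisSum fun e ↦ reebL ζ (A e) e := by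
    rw [← basisSum_neg]
    refine (map_basisSum φ.toLinearMap _).trans (basisSum_congr fun e ↦ ?_)
    change φ _ = _
    rw [hA, D.acm.φ_φ_eq, hor_reebL D.acm]
  have h2 : φ (basisSum fun e ↦ horTensor ζ T e (reebL ζ T (φ e))) =
      basisSum fun e ↦ horTensor ζ T e (reebL ζ T e) := by
    refine (map_basisSum φ.toLinearMap _).trans (basisSum_congr fun e ↦ ?_)
    change φ _ = _
    rw [hL, D.tor.horTensor_φ D.acm, map_neg, D.acm.φ_φ_eq, hor_horTensor D.acm, neg_neg]
  rw [D.starRicci_ζ_eq, D.codiff_ζ]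
  simp only [map_add, map_neg, map_smul, h1, h2]
  simp only [map_neg, hL, D.acm.φ_φ_eq, hor_reebL D.acm]
  module

theorem starRicci_ζ_of_anti (hL : ∀ u, reebL ζ T (φ u) = - φ (reebL ζ T u))
    (hA : ∀ w u, reebL ζ (A w) (φ u) = - φ (reebL ζ (A w) u)) :
    sharp (starRicci φ R ζ) = codiff T A ζ
      + (A ζ ζ ζ - alongL ζ T (T ζ ζ) - LinearMap.adjoint (reebL ζ T) (T ζ ζ))
      + alongL ζ T (T ζ ζ) + reebL ζ T (T ζ ζ) + LinearMap.adjoint (reebL ζ T) (T ζ ζ)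
      + (2 : ℝ) • reebL ζ T (horTrace ζ T)
      - basisSum (fun e ↦ horTensor ζ T e (reebL ζ T e)) := by
  have h1 : φ (basisSum fun e ↦ reebL ζ (A e) (φ e)) = basisSum fun e ↦ reebL ζ (A e) e := by
    refine (map_basisSum φ.toLinearMap _).trans (basisSum_congr fun e ↦ ?_)
    change φ _ = _
    rw [hA, map_neg, D.acm.φ_φ_eq, hor_reebL D.acm, neg_neg]
  have h2 : φ (basisSum fun e ↦ horTensor ζ T e (reebL ζ T (φ e))) =
      - basisSum fun e ↦ horTensor ζ T e (reebL ζ T e) := by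
    rw [← basisSum_neg]
    refine (map_basisSum φ.toLinearMap _).trans (basisSum_congr fun e ↦ ?_)
    change φ _ = _
    rw [hL, map_neg, D.tor.horTensor_φ D.acm, neg_neg, D.acm.φ_φ_eq, hor_horTensor D.acm]
  rw [D.starRicci_ζ_eq, D.codiff_ζ, reebTrace_eq_zero D.acm hL, reebTraceφ_eq_zero D.acm hL]
  simp only [map_add, map_neg, map_smul, h1, h2]
  simp only [map_neg, hL, D.acm.φ_φ_eq, hor_reebL D.acm]
  module

end IsPointData

end ReebPart

section Comparison

variable {V : Type*} [NormedAddCommGroup V] [InnerProductSpace ℝ V] [FiniteDimensional ℝ V]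
  {W : Type*} [AddCommGroup W] [Module ℝ W]

variable {φ : V →L[ℝ] V} {ζ : V} {T : V →ₗ[ℝ] V →ₗ[ℝ] V} {A R : V →ₗ[ℝ] V →ₗ[ℝ] V →ₗ[ℝ] V}
  {n : ℕ} {θ : V}

theorem IsACM.basisSum_hor_hor (h : IsACM φ ζ) {B : V → V → W} (hB : IsBilinearMap ℝ B) :
    basisSum (fun e ↦ B (hor ζ e) (hor ζ e)) = basisSum (fun e ↦ B e e) - B ζ ζ := by
  have h1 : ∀ e, B (hor ζ e) (hor ζ e) = (B e e - ⟪ζ, e⟫ • B ζ e)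
      - ⟪ζ, e⟫ • (B e ζ - ⟪ζ, e⟫ • B ζ ζ) := fun e ↦ by
    have hs : ∀ (c : ℝ) a b, B (a - c • ζ) b = B a b - c • B ζ b := fun c a b ↦ by
      rw [sub_eq_add_neg, ← neg_smul, hB.add_left, hB.smul_left]; module
    have hs' : ∀ (c : ℝ) a b, B a (b - c • ζ) = B a b - c • B a ζ := fun c a b ↦ by
      rw [sub_eq_add_neg, ← neg_smul, hB.add_right, hB.smul_right]; module
    simp only [hor, hs, hs']
    module
  have h2 : IsLinearMap ℝ fun e ↦ B ζ e := by
    constructor <;> intros <;> simp [hB.add_right, hB.smul_right]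
  have h3 : IsLinearMap ℝ fun e ↦ B e ζ - ⟪ζ, e⟫ • B ζ ζ := by
    constructor <;> intros <;> simp only [hB.add_left, hB.smul_left, inner_add_right,
      real_inner_smul_right] <;> module
  rw [basisSum_congr h1, basisSum_sub, basisSum_sub, basisSum_inner_smul_of h2,
    basisSum_inner_smul_of h3, h.inner_ζ]
  module

namespace IsPointData

variable (D : IsPointData φ ζ T A R)
include D

theorem starRicci_ζ_eq_of_comm (hn : 1 ≤ n) (hθ : hor ζ θ = θ)
    (hH : horTrace ζ T = (((n : ℝ) - 1) / 2) • θ)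
    (hL : ∀ u, reebL ζ T (φ u) = φ (reebL ζ T u))
    (hA : ∀ w u, reebL ζ (A w) (φ u) = φ (reebL ζ (A w) u)) {Q : V}
    (hQ : basisSum (fun e ↦ horTensor ζ T e (reebL ζ T e)) = (1 / 4 : ℝ) • (reebTrace ζ T • θ
      - (2 : ℝ) • LinearMap.adjoint (reebL ζ T) θ - reebTraceφ φ ζ T • φ θ) + Q) :
    sharp (starRicci φ R ζ) = - codiff T A ζ +
      (- (A ζ ζ ζ - alongL ζ T (T ζ ζ) - LinearMap.adjoint (reebL ζ T) (T ζ ζ)) + Q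
      - (((n : ℝ) - 1) / (4 * n) * reebTrace ζ T) • θ
      - ((2 * (n : ℝ) - 1) / 2) • reeb8 n φ ζ (T · ·) θ
      - (3 * ((n : ℝ) - 1) / (4 * n) * reebTraceφ φ ζ T) • φ θ
      - ((2 * (n : ℝ) - 3) / 2) • reeb7 n φ ζ (T · ·) θ
      + (((n : ℝ) - 1) / n * reebTrace ζ T) • T ζ ζ
      - (2 : ℝ) • reeb8 n φ ζ (T · ·) (T ζ ζ)
      + reebTraceφ φ ζ T • φ (T ζ ζ) - alongL ζ T (T ζ ζ)) := by
  have hn0 : (n : ℝ) ≠ 0 := by positivity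
  rw [D.starRicci_ζ_of_comm hL hA, hQ, reeb8_eq D.acm hL, reeb7_eq D.acm hL, reeb8_eq D.acm hL,
    hH, hθ, D.tor.hor_T_ζ, map_smul]
  match_scalars <;> field_simp <;> ring

theorem starRicci_ζ_eq_of_anti (hH : horTrace ζ T = (((n : ℝ) - 1) / 2) • θ)
    (hL : ∀ u, reebL ζ T (φ u) = - φ (reebL ζ T u))
    (hA : ∀ w u, reebL ζ (A w) (φ u) = - φ (reebL ζ (A w) u)) {Q : V}
    (hQ : basisSum (fun e ↦ horTensor ζ T e (reebL ζ T e)) = Q) :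
    sharp (starRicci φ R ζ) = codiff T A ζ +
      ((A ζ ζ ζ - alongL ζ T (T ζ ζ) - LinearMap.adjoint (reebL ζ T) (T ζ ζ)) - Q
      + ((n : ℝ) - 1) • reeb9 φ ζ (T · ·) θ + ((n : ℝ) - 1) • reeb10 φ ζ (T · ·) θ
      + (2 : ℝ) • reeb9 φ ζ (T · ·) (T ζ ζ) + alongL ζ T (T ζ ζ)) := by
  rw [D.starRicci_ζ_of_anti hL hA, hQ, reeb9_eq D.acm hL, reeb9_eq D.acm hL, reeb10_eq D.acm hL,
    hH, map_smul]
  module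

/-- The vanishing of `d^*T`, split into its two parts. -/
theorem codiff_eq_zero_iff : (∀ v, codiff T A v = 0) ↔
    (∀ X Y, ⟪hor ζ (codiff T A (hor ζ X)), Y⟫ = 0) ∧ codiff T A ζ = 0 := by
  refine ⟨fun h0 ↦ ⟨fun X Y ↦ by rw [h0, hor_zero, inner_zero_left], h0 ζ⟩, fun ⟨h1, h2⟩ v ↦ ?_⟩
  have hadd : ∀ u v, codiff T A (u + v) = codiff T A u + codiff T A v := fun u v ↦ by
    simp only [codiff, map_add, basisSum_add]; abel
  have hsmul : ∀ (c : ℝ) v, codiff T A (c • v) = c • codiff T A v := fun c v ↦ by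
    simp only [codiff, map_smul, basisSum_smul]; module
  rw [← D.acm.hor_add_smul v, hadd, hsmul, h2, smul_zero, add_zero,
    ← D.acm.hor_add_smul (codiff T A (hor ζ v)),
    ← neg_eq_iff_eq_neg.2 (D.codiff_skew ζ (hor ζ v)), h2, inner_zero_left, neg_zero, zero_smul,
    add_zero]
  exact ext_inner_right ℝ fun Y ↦ by rw [h1, inner_zero_left]

/-! ### Pair symmetry -/

theorem curv_pair (a b c d : V) : ⟪R a b c, d⟫ = ⟪R c d a, b⟫ :=
  pair_symm_of_bianchi (K := fun a b c d ↦ ⟪R a b c, d⟫)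
    (fun a b c d ↦ by rw [D.curv_swap, inner_neg_left])
    (fun a b c d ↦ by rw [D.curv_skew, real_inner_comm])
    (fun a b c d ↦ by rw [← inner_add_left, ← inner_add_left, D.bianchi, inner_zero_left]) a b c d

theorem ricci_symm (X Y : V) :
    basisSum (fun e ↦ ⟪R e X e, Y⟫) = basisSum (fun e ↦ ⟪R e Y e, X⟫) :=
  basisSum_congr fun e ↦ D.curv_pair e X e Y

/-- The contraction of the torsion part of the curvature that measures the asymmetry of `Ric^*`. -/
theorem starRicci_sub_symm (X Y : V) :
    starRicci φ R (hor ζ X) (hor ζ Y)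
      - basisSum (fun e ↦ ⟪torsionCurv T A (hor ζ e) (hor ζ X) (φ e), φ Y⟫
        - ⟪torsionCurv T A (hor ζ e) (hor ζ X) (hor ζ e), hor ζ Y⟫) =
    basisSum (fun e ↦ ⟪R e (hor ζ X) e, hor ζ Y⟫) - ⟪R ζ (hor ζ X) ζ, hor ζ Y⟫ := by
  have hS1 : IsBilinearMap ℝ fun a b ↦ ⟪torsionCurv T A a (hor ζ X) (φ b), φ Y⟫ := by
    constructor <;> intros <;> simp only [torsionCurv, map_add, map_smul, map_sub,
      LinearMap.add_apply, LinearMap.smul_apply, LinearMap.sub_apply, inner_add_left,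
      inner_sub_left, real_inner_smul_left, smul_eq_mul] <;> ring
  have hS2 : IsBilinearMap ℝ fun a b ↦ ⟪torsionCurv T A a (hor ζ X) b, hor ζ Y⟫ := by
    constructor <;> intros <;> simp only [torsionCurv, map_add, map_smul, map_sub,
      LinearMap.add_apply, LinearMap.smul_apply, LinearMap.sub_apply, inner_add_left,
      inner_sub_left, real_inner_smul_left, smul_eq_mul] <;> ring
  have e1 := D.acm.basisSum_hor_hor hS1
  have e2 := D.acm.basisSum_hor_hor hS2
  simp only [D.acm.φ_hor, D.acm.φ_ζ] at e1
  have e3 : torsionCurv T A ζ (hor ζ X) 0 = 0 := by simp [torsionCurv]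
  rw [e3, inner_zero_left, sub_zero] at e1
  rw [basisSum_sub, e1, e2, starRicci, D.curv_ζ]
  have e4 : ∀ e, ⟪R e (hor ζ X) (φ e), φ (hor ζ Y)⟫ =
      ⟪torsionCurv T A e (hor ζ X) (φ e), φ Y⟫ + ⟪R e (hor ζ X) e, hor ζ Y⟫
        - ⟪torsionCurv T A e (hor ζ X) e, hor ζ Y⟫ := fun e ↦ by
    have h1 := congrArg (⟪·, φ (hor ζ Y)⟫) (D.curv_φ e (hor ζ X) e)
    simp only [inner_sub_left, D.acm.inner_φ, D.acm.inner_ζ_hor, mul_zero, sub_zero] at h1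
    rw [D.acm.φ_hor] at h1 ⊢
    linarith
  rw [basisSum_congr e4, basisSum_sub, basisSum_add]
  ring

theorem hor_torsionCurv (a X w : V) :
    hor ζ (torsionCurv T A (hor ζ a) (hor ζ X) (hor ζ w)) =
      horTensor ζ (A a) X w - ⟪ζ, a⟫ • horTensor ζ (A ζ) X w
      - horTensor ζ (A X) a w + ⟪ζ, X⟫ • horTensor ζ (A ζ) a w
      + horTensor ζ T (horTensor ζ T a X - horTensor ζ T X a) w
      - (⟪reebL ζ T a, X⟫ - ⟪reebL ζ T X, a⟫) • alongL ζ T w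
      - horTensor ζ T a (horTensor ζ T X w) + ⟪reebL ζ T X, w⟫ • reebL ζ T a
      + horTensor ζ T X (horTensor ζ T a w) - ⟪reebL ζ T a, w⟫ • reebL ζ T X := by
  have h1 : ∀ a b, T (hor ζ a) (hor ζ b) = horTensor ζ T a b - ⟪reebL ζ T a, b⟫ • ζ := fun a b ↦ by
    rw [D.tor.apply_eq D.acm, horTensor_hor_left D.acm, horTensor_hor_right D.acm,
      D.acm.inner_ζ_hor, D.acm.inner_ζ_hor, reebL_hor D.acm, ← inner_hor_left, hor_reebL D.acm]
    module
  have h2 : ∀ c a b, hor ζ (A c (hor ζ a) (hor ζ b)) = horTensor ζ (A c) a b := fun c a b ↦ rfl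
  have h3 : ∀ a b, hor ζ (T (hor ζ a) b) = horTensor ζ T a b + ⟪ζ, b⟫ • reebL ζ T a :=
    fun a b ↦ by
      rw [D.tor.hor_apply D.acm, horTensor_hor_left D.acm, D.acm.inner_ζ_hor, reebL_hor D.acm]
      module
  have h4 : ∀ a b, hor ζ (T a (hor ζ b)) = horTensor ζ T a b + ⟪ζ, a⟫ • alongL ζ T b :=
    fun a b ↦ by
      rw [D.tor.hor_apply D.acm, horTensor_hor_right D.acm, D.acm.inner_ζ_hor, alongL_hor D.acm]
      module
  have h5 : ∀ c a b, hor ζ (A (hor ζ c) (hor ζ a) (hor ζ b)) = horTensor ζ (A c) a b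
      - ⟪ζ, c⟫ • horTensor ζ (A ζ) a b := fun c a b ↦ by
    rw [← h2, ← h2, ← hor_smul, ← hor_sub]
    conv_lhs => rw [hor.eq_1 ζ c]
    simp only [map_sub, map_smul, LinearMap.sub_apply, LinearMap.smul_apply]
  simp only [torsionCurv, hor_add, hor_sub, hor_smul, h5, h4, h3, h1 _ w, h1 (hor ζ a), h1 a X, h1 X a,
    map_sub, map_smul, LinearMap.sub_apply, LinearMap.smul_apply, inner_sub_right,
    real_inner_smul_right, D.acm.inner_ζ, inner_ζ_horTensor D.acm, horTensor_ζ_right D.acm,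
    horTensor_ζ_left D.acm]
  module

end IsPointData

end Comparison

section SymmetricContraction

variable {V : Type*} [NormedAddCommGroup V] [InnerProductSpace ℝ V] [FiniteDimensional ℝ V]

variable {φ : V →L[ℝ] V} {ζ : V} {T : V →ₗ[ℝ] V →ₗ[ℝ] V} {A R : V →ₗ[ℝ] V →ₗ[ℝ] V →ₗ[ℝ] V}
  {n : ℕ} {θ : V}

theorem basisSum_comm {W : Type*} [AddCommMonoid W] (f : V → V → W) :
    basisSum (fun a ↦ basisSum fun b ↦ f a b) = basisSum fun b ↦ basisSum fun a ↦ f a b :=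
  Finset.sum_comm

/-- The contraction `∑ ⟨H_{H_e X} e, Y⟩`. -/
def horSquare (ζ : V) (T : V →ₗ[ℝ] V →ₗ[ℝ] V) (X Y : V) : ℝ :=
  basisSum fun e ↦ ⟪horTensor ζ T (horTensor ζ T e X) e, Y⟫

theorem horSquare_symm (h : IsACM φ ζ) (hT : IsTorsion φ ζ T) (X Y : V) :
    horSquare ζ T X Y = horSquare ζ T Y X := by
  have h1 : ∀ X Y, horSquare ζ T X Y = basisSum fun e ↦ basisSum fun f ↦
      - (⟪X, horTensor ζ T e f⟫ * ⟪Y, horTensor ζ T f e⟫) := fun X Y ↦ by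
    refine basisSum_congr fun e ↦ ?_
    have hl : IsLinearMap ℝ fun f ↦ ⟪horTensor ζ T f e, Y⟫ := by
      constructor <;> intros <;> simp [inner_add_left, real_inner_smul_left]
    rw [← basisSum_inner_mul_of hl]
    refine basisSum_congr fun f ↦ ?_
    rw [hT.horTensor_skew h, real_inner_comm Y]
    ring
  rw [h1, h1, basisSum_comm]
  exact basisSum_congr fun e ↦ basisSum_congr fun f ↦ by ring

namespace IsPointData

variable (D : IsPointData φ ζ T A R)
include D

theorem inner_torsionCurv_sub (e X Y : V) :
    ⟪torsionCurv T A (hor ζ e) (hor ζ X) (φ e), φ Y⟫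
        - ⟪torsionCurv T A (hor ζ e) (hor ζ X) (hor ζ e), hor ζ Y⟫ =
      -2 * ⟪horTensor ζ (A e) X e, Y⟫ + 2 * (⟪ζ, e⟫ * ⟪horTensor ζ (A ζ) X e, Y⟫)
      + 2 * ⟪horTensor ζ (A X) e e, Y⟫ - 2 * ⟪ζ, X⟫ * ⟪horTensor ζ (A ζ) e e, Y⟫
      - 2 * ⟪horTensor ζ T (horTensor ζ T e X) e, Y⟫
      + 2 * ⟪horTensor ζ T (horTensor ζ T X e) e, Y⟫
      + 2 * (⟪LinearMap.adjoint (reebL ζ T) X, e⟫ * ⟪alongL ζ T e, Y⟫)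
      - 2 * (⟪reebL ζ T X, e⟫ * ⟪alongL ζ T e, Y⟫)
      - ⟪φ (reebL ζ T X), e⟫ * ⟪reebL ζ T e, φ Y⟫ - ⟪reebL ζ T X, e⟫ * ⟪reebL ζ T e, Y⟫
      - ⟪reebL ζ T X, φ Y⟫ * ⟪reebL ζ T e, φ e⟫ + ⟪reebL ζ T X, Y⟫ * ⟪reebL ζ T e, e⟫ := by
  have h1 : ∀ U u v, ⟪φ (horTensor ζ U u v), φ Y⟫ = ⟪horTensor ζ U u v, Y⟫ := fun U u v ↦ by
    rw [D.acm.inner_φ, inner_ζ_horTensor D.acm]; ring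
  have h2 : ⟪φ (alongL ζ T e), φ Y⟫ = ⟪alongL ζ T e, Y⟫ := by
    rw [D.acm.inner_φ, inner_ζ_alongL D.acm]; ring
  have e1 : ⟪torsionCurv T A (hor ζ e) (hor ζ X) (φ e), φ Y⟫ =
      ⟪hor ζ (torsionCurv T A (hor ζ e) (hor ζ X) (hor ζ (φ e))), φ Y⟫ := by
    rw [inner_hor_left, D.acm.hor_φ, D.acm.hor_φ]
  have e2 : ⟪reebL ζ T X, φ e⟫ = - ⟪φ (reebL ζ T X), e⟫ := by rw [D.acm.inner_φ_left, neg_neg]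
  have e3 : ⟪reebL ζ T e, X⟫ = ⟪LinearMap.adjoint (reebL ζ T) X, e⟫ := by
    rw [LinearMap.adjoint_inner_left, real_inner_comm]
  rw [e1, ← inner_hor_left, D.hor_torsionCurv, D.hor_torsionCurv]
  simp only [(D.torA _).horTensor_φ D.acm, D.tor.horTensor_φ D.acm, D.tor.alongL_φ D.acm, map_neg,
    inner_add_left, inner_sub_left, inner_neg_left, inner_neg_right, real_inner_smul_left, h1, h2,
    map_sub, LinearMap.sub_apply, e2, e3]
  ring

theorem basisSum_torsionCurv_sub (P : V →ₗ[ℝ] V)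
    (hP : ∀ w, (2 : ℝ) • basisSum (fun e ↦ horTensor ζ (A w) e e) = ((n : ℝ) - 1) • P w) (X Y : V) :
    basisSum (fun e ↦ ⟪torsionCurv T A (hor ζ e) (hor ζ X) (φ e), φ Y⟫
        - ⟪torsionCurv T A (hor ζ e) (hor ζ X) (hor ζ e), hor ζ Y⟫) =
      -2 * basisSum (fun e ↦ ⟪horTensor ζ (A e) X e, Y⟫) + ((n : ℝ) - 1) * ⟪P (hor ζ X), Y⟫
      - 2 * horSquare ζ T X Y
      + 2 * basisSum (fun e ↦ ⟪horTensor ζ T (horTensor ζ T X e) e, Y⟫)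
      + 2 * ⟪alongL ζ T (LinearMap.adjoint (reebL ζ T) X), Y⟫ - 2 * ⟪alongL ζ T (reebL ζ T X), Y⟫
      - ⟪reebL ζ T (φ (reebL ζ T X)), φ Y⟫ - ⟪reebL ζ T (reebL ζ T X), Y⟫
      - reebTraceφ φ ζ T * ⟪reebL ζ T X, φ Y⟫ + reebTrace ζ T * ⟪reebL ζ T X, Y⟫ := by
  have l1 : IsLinearMap ℝ fun e ↦ ⟪horTensor ζ (A ζ) X e, Y⟫ := by
    constructor <;> intros <;> simp [inner_add_left, real_inner_smul_left]
  have l2 : IsLinearMap ℝ fun e ↦ ⟪alongL ζ T e, Y⟫ := by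
    constructor <;> intros <;> simp [inner_add_left, real_inner_smul_left]
  have l3 : ∀ Y, IsLinearMap ℝ fun e ↦ ⟪reebL ζ T e, Y⟫ := fun Y ↦ by
    constructor <;> intros <;> simp [inner_add_left, real_inner_smul_left]
  have hP' : ∀ w, 2 * basisSum (fun e ↦ ⟪horTensor ζ (A w) e e, Y⟫) = ((n : ℝ) - 1) * ⟪P w, Y⟫ :=
    fun w ↦ by rw [← inner_basisSum, ← real_inner_smul_left, hP, real_inner_smul_left]
  simp only [D.inner_torsionCurv_sub, basisSum_add, basisSum_sub, basisSum_mul,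
    basisSum_inner_mul_of l1, basisSum_inner_mul_of l2, basisSum_inner_mul_of (l3 _),
    horTensor_ζ_right D.acm, inner_zero_left]
  rw [hP', mul_right_comm, hP', hor, map_sub, map_smul, inner_sub_left, real_inner_smul_left,
    horSquare, reebTrace, reebTraceφ]
  ring

theorem starRicci_alt_φ {ε : ℝ} (hεε : ε * ε = 1)
    (hε : ∀ u, reebL ζ T (φ u) = ε • φ (reebL ζ T u)) (X Y : V) :
    (1 / 2 : ℝ) * (starRicci φ R (hor ζ (φ X)) (hor ζ (φ Y))
        - starRicci φ R (hor ζ (φ Y)) (hor ζ (φ X))) =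
      - ((1 / 2 : ℝ) * (starRicci φ R (hor ζ X) (hor ζ Y) - starRicci φ R (hor ζ Y) (hor ζ X))) := by
  rw [D.starRicci_alt_eq hεε hε, D.starRicci_alt_eq hεε hε]
  have h1 : basisSum (fun e ↦ horTensor ζ (A e) (φ e) (φ X)) =
      - φ (basisSum fun e ↦ horTensor ζ (A e) (φ e) X) := by
    rw [basisSum_congr fun e ↦ (D.torA e).horTensor_φ D.acm (φ e) X, basisSum_neg]
    congr 1
    exact (map_basisSum φ.toLinearMap _).symm
  rw [h1, D.tor.horTensor_φ D.acm, D.tor.alongL_φ D.acm]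
  have h2 : ∀ u v, ⟪φ (- φ u), φ v⟫ = - ⟪φ u, v⟫ := fun u v ↦ by
    rw [map_neg, inner_neg_left, D.acm.inner_φ, D.acm.inner_ζ_φ, zero_mul, sub_zero]
  rw [← h2]
  congr 2
  simp only [map_add, map_neg, map_smul]
  module

/-- The skew-symmetric part of `Ric^*` on `ζ^⊥` for the types containing `B`, computed from the
symmetry of the Ricci tensor. -/
theorem starRicci_alt_of_comm_of_symm {ε : ℝ} (hεε : ε * ε = 1)
    (hε : ∀ u, reebL ζ T (φ u) = ε • φ (reebL ζ T u)) (hθ : hor ζ θ = θ)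
    (hK : ∀ u v, horTensor ζ T (φ u) (φ v) = horTensor ζ T u v)
    (hA : ∀ w u v, horTensor ζ (A w) (φ u) (φ v) = horTensor ζ (A w) u v)
    (P : V →ₗ[ℝ] V) (hPh : ∀ u, hor ζ (P u) = P u)
    (hP : ∀ w, (2 : ℝ) • basisSum (fun e ↦ horTensor ζ (A w) e e) = ((n : ℝ) - 1) • P w) (X Y : V) :
    (1 / 2 : ℝ) * (starRicci φ R (hor ζ X) (hor ζ Y) - starRicci φ R (hor ζ Y) (hor ζ X)) =
      ((n : ℝ) - 1) / 2 * lambda20 φ (fun u v ↦ ⟪P u - T u θ, v⟫ - ⟪P v - T v θ, u⟫) X Y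
      - (1 + ε) / 2 * (⟪alongL ζ T (reebL ζ T X - LinearMap.adjoint (reebL ζ T) X), Y⟫
        - ⟪alongL ζ T (reebL ζ T Y - LinearMap.adjoint (reebL ζ T) Y), X⟫) := by
  have hφφ : ∀ {u}, ⟪ζ, u⟫ = 0 → ∀ v, ⟪φ u, φ v⟫ = ⟪u, v⟫ := fun hu v ↦ by
    rw [D.acm.inner_φ, hu]; ring
  have hadj : ∀ u, LinearMap.adjoint (reebL ζ T) (φ u) = ε • φ (LinearMap.adjoint (reebL ζ T) u) :=
    fun u ↦ by
      refine ext_inner_right ℝ fun v ↦ ?_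
      rw [LinearMap.adjoint_inner_left, real_inner_smul_left, D.acm.inner_φ_left,
        D.acm.inner_φ_left, LinearMap.adjoint_inner_left, hε, real_inner_smul_right]
      linear_combination ⟪u, φ (reebL ζ T v)⟫ * hεε
  have key : ∀ X Y, basisSum (fun e ↦ ⟪torsionCurv T A (hor ζ e) (hor ζ X) (φ e), φ Y⟫
        - ⟪torsionCurv T A (hor ζ e) (hor ζ X) (hor ζ e), hor ζ Y⟫)
      - basisSum (fun e ↦ ⟪torsionCurv T A (hor ζ e) (hor ζ (φ X)) (φ e), φ (φ Y)⟫
        - ⟪torsionCurv T A (hor ζ e) (hor ζ (φ X)) (hor ζ e), hor ζ (φ Y)⟫)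
      = ((n : ℝ) - 1) * (⟪P (hor ζ X), Y⟫ - ⟪P (φ X), φ Y⟫) - 4 * horSquare ζ T X Y
      - 2 * (1 + ε) * ⟪alongL ζ T (reebL ζ T X - LinearMap.adjoint (reebL ζ T) X), Y⟫ :=
      fun X Y ↦ by
    rw [D.basisSum_torsionCurv_sub P hP, D.basisSum_torsionCurv_sub P hP, D.acm.hor_φ]
    have e1 : ∀ e, ⟪horTensor ζ (A e) (φ X) e, φ Y⟫ = ⟪horTensor ζ (A e) X e, Y⟫ := fun e ↦ by
      rw [← hA e X e, (D.torA e).horTensor_φ D.acm, inner_neg_left, D.acm.inner_φ_left, neg_neg]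
    have e2 : horSquare ζ T (φ X) (φ Y) = - horSquare ζ T X Y := by
      rw [horSquare, horSquare, ← basisSum_neg]
      refine basisSum_congr fun e ↦ ?_
      have := φ_horTensor_φ_left_of_comm D.acm D.tor hK (horTensor ζ T e X) e
      rw [D.tor.horTensor_φ D.acm e X, map_neg, LinearMap.neg_apply, inner_neg_left,
        ← neg_eq_iff_eq_neg.2 this, inner_neg_left, D.acm.inner_φ_left, neg_neg]
    have e3 : ∀ e, ⟪horTensor ζ T (horTensor ζ T (φ X) e) e, φ Y⟫ =
        ⟪horTensor ζ T (horTensor ζ T X e) e, Y⟫ := fun e ↦ by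
      have h1 := φ_horTensor_φ_left_of_comm D.acm D.tor hK (horTensor ζ T X e) e
      have h2 : horTensor ζ T (φ X) e = φ (horTensor ζ T X e) := by
        rw [← neg_eq_iff_eq_neg.2 (φ_horTensor_φ_left_of_comm D.acm D.tor hK X e), map_neg,
          D.acm.φ_φ_eq, hor_horTensor D.acm, neg_neg]
      rw [h2, ← neg_eq_iff_eq_neg.2 h1, inner_neg_left, D.acm.inner_φ_left, neg_neg]
    have e4 : ⟪alongL ζ T (LinearMap.adjoint (reebL ζ T) (φ X)), φ Y⟫ =
        - ε * ⟪alongL ζ T (LinearMap.adjoint (reebL ζ T) X), Y⟫ := by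
      rw [hadj, map_smul, D.tor.alongL_φ D.acm, real_inner_smul_left, inner_neg_left,
        hφφ (inner_ζ_alongL D.acm _ _)]
      ring
    have e5 : ⟪alongL ζ T (reebL ζ T (φ X)), φ Y⟫ = - ε * ⟪alongL ζ T (reebL ζ T X), Y⟫ := by
      rw [hε, map_smul, D.tor.alongL_φ D.acm, real_inner_smul_left, inner_neg_left,
        hφφ (inner_ζ_alongL D.acm _ _)]
      ring
    have e6 : ⟪reebL ζ T (φ (reebL ζ T X)), φ Y⟫ = ε * ⟪reebL ζ T (reebL ζ T X), Y⟫ := by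
      rw [hε, real_inner_smul_left, hφφ (inner_ζ_reebL D.acm _ _)]
    have e7 : ⟪reebL ζ T (φ (reebL ζ T (φ X))), φ (φ Y)⟫ = ε * ⟪reebL ζ T (reebL ζ T X), Y⟫ := by
      rw [hε X, map_smul, map_smul, D.acm.φ_φ_eq (reebL ζ T X), hor_reebL D.acm, map_neg,
        D.acm.φ_φ_eq Y, inner_neg_right, real_inner_smul_left, inner_neg_left, ← inner_hor_left,
        hor_reebL D.acm]
      ring
    have e8 : ⟪reebL ζ T (reebL ζ T (φ X)), φ Y⟫ = ⟪reebL ζ T (reebL ζ T X), Y⟫ := by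
      rw [hε X, map_smul, hε, smul_smul, hεε, one_smul, hφφ (inner_ζ_reebL D.acm _ _)]
    have e9 : ⟪reebL ζ T (φ X), φ (φ Y)⟫ = ε * ⟪reebL ζ T X, φ Y⟫ := by
      rw [hε X, real_inner_smul_left, hφφ (inner_ζ_reebL D.acm _ _)]
    have e10 : ⟪reebL ζ T (φ X), φ Y⟫ = ε * ⟪reebL ζ T X, Y⟫ := by
      rw [hε X, real_inner_smul_left, hφφ (inner_ζ_reebL D.acm _ _)]
    have e11 : (1 - ε) * reebTrace ζ T = 0 ∧ (1 - ε) * reebTraceφ φ ζ T = 0 := by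
      rcases mul_self_eq_one_iff.1 hεε with rfl | rfl
      · simp
      · rw [reebTrace_eq_zero D.acm (by simpa using hε),
          reebTraceφ_eq_zero D.acm (by simpa using hε)]
        simp
    rw [basisSum_congr e1, e2, basisSum_congr e3, e4, e5, e6, e7, e8, e9, e10, map_sub,
      inner_sub_left]
    linear_combination ⟪reebL ζ T X, Y⟫ * e11.1 - ⟪reebL ζ T X, φ Y⟫ * e11.2
  have hsym : ∀ X Y, starRicci φ R (hor ζ X) (hor ζ Y) - starRicci φ R (hor ζ Y) (hor ζ X) =
      basisSum (fun e ↦ ⟪torsionCurv T A (hor ζ e) (hor ζ X) (φ e), φ Y⟫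
        - ⟪torsionCurv T A (hor ζ e) (hor ζ X) (hor ζ e), hor ζ Y⟫)
      - basisSum (fun e ↦ ⟪torsionCurv T A (hor ζ e) (hor ζ Y) (φ e), φ X⟫
        - ⟪torsionCurv T A (hor ζ e) (hor ζ Y) (hor ζ e), hor ζ X⟫) := fun X Y ↦ by
    have h1 := D.starRicci_sub_symm X Y
    have h2 := D.starRicci_sub_symm Y X
    rw [D.ricci_symm, D.curv_pair] at h1
    linarith
  have hlam : lambda20 φ (fun u v ↦ ⟪P u - T u θ, v⟫ - ⟪P v - T v θ, u⟫) X Y =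
      (1 / 2 : ℝ) * (⟪P (hor ζ X), Y⟫ - ⟪P (hor ζ Y), X⟫ - ⟪P (φ X), φ Y⟫ + ⟪P (φ Y), φ X⟫) := by
    have e6 : ∀ u v, ⟪P (hor ζ u), hor ζ v⟫ = ⟪P (hor ζ u), v⟫ := fun u v ↦ by
      rw [← inner_hor_left, hPh]
    have e7 : ∀ u v, ⟪T (hor ζ u) θ, hor ζ v⟫ = ⟪horTensor ζ T u θ, v⟫ := fun u v ↦ by
      rw [horTensor_apply, inner_hor_left, hθ]
    have e8 : ∀ u v, ⟪T (φ u) θ, φ v⟫ = ⟪horTensor ζ T u θ, v⟫ := fun u v ↦ by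
      rw [← hK, D.tor.horTensor_φ D.acm, inner_neg_left, D.acm.inner_φ_left, neg_neg,
        horTensor_apply, D.acm.hor_φ, hθ, inner_hor_left, D.acm.hor_φ]
    simp only [lambda20, D.acm.φ_φ_eq, map_neg, inner_sub_left, inner_neg_left, inner_neg_right,
      LinearMap.neg_apply, e6, e7, e8]
    ring
  have hanti := D.starRicci_alt_φ hεε hε X Y
  rw [hsym (φ X) (φ Y)] at hanti
  have h1 := hsym X Y
  rw [hlam]
  linear_combination (1 / 4 : ℝ) * h1 + (1 / 2 : ℝ) * hanti + (1 / 4 : ℝ) * key X Y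
    - (1 / 4 : ℝ) * key Y X - horSquare_symm D.acm D.tor X Y

end IsPointData

end SymmetricContraction

section IntrinsicTorsion

variable {E : Type*} [NormedAddCommGroup E] [NormedSpace ℝ E] [FiniteDimensional ℝ E]
  {H : Type*} [TopologicalSpace H] {I : ModelWithCorners ℝ E H}
  {M : Type*} [TopologicalSpace M] [ChartedSpace H M] [IsManifold I ∞ M]
  [RiemannianBundle (fun x : M ↦ TangentSpace I x)]
  [IsContMDiffRiemannianBundle I ∞ E (fun x : M ↦ TangentSpace I x)]
  {x : M} {f : M → ℝ} {σ τ X Y Z : Π y : M, TangentSpace I y}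

/-! ### The Levi-Civita connection at a vector -/

theorem leviCivita_add (hσ : MDiffAt (T% σ) x) (hτ : MDiffAt (T% τ) x) (u : TangentSpace I x) :
    leviCivita I M (fun y ↦ σ y + τ y) x u = leviCivita I M σ x u + leviCivita I M τ x u :=
  congrArg (· u) (isCovariantDerivativeOn_leviCivitaFun.add hσ hτ (Set.mem_univ x))

theorem leviCivita_smul (hf : MDiffAt f x) (hσ : MDiffAt (T% σ) x) (u : TangentSpace I x) :
    leviCivita I M (fun y ↦ f y • σ y) x u =
      f x • leviCivita I M σ x u + mvfderiv I f x u • σ x :=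
  congrArg (· u) (isCovariantDerivativeOn_leviCivitaFun.leibniz hσ hf (Set.mem_univ x))

theorem mdiffAt_const_smul (c : ℝ) (hσ : MDiffAt (T% σ) x) : MDiffAt (T% (fun y ↦ c • σ y)) x := by
  have h : MDiffAt (fun _ : M ↦ c) x := mdifferentiableAt_const
  exact h.smul_section hσ

theorem leviCivita_const_smul (c : ℝ) (hσ : MDiffAt (T% σ) x) (u : TangentSpace I x) :
    leviCivita I M (fun y ↦ c • σ y) x u = c • leviCivita I M σ x u := by
  rw [leviCivita_smul mdifferentiableAt_const hσ]
  simp [mvfderiv_const]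

theorem leviCivita_congr (hσ : MDiffAt (T% σ) x) (he : ∀ᶠ y in 𝓝 x, τ y = σ y)
    (u : TangentSpace I x) : leviCivita I M τ x u = leviCivita I M σ x u := by
  have hτ : MDiffAt (T% τ) x :=
    hσ.congr_of_eventuallyEq (he.mono fun z hz ↦ by simp [hz])
  exact congrArg (· u) (isCovariantDerivativeOn_leviCivitaFun.congr_of_eventuallyEq
    hτ hσ Filter.univ_mem he)

theorem mvfderiv_inner (hY : MDiffAt (T% Y) x) (hZ : MDiffAt (T% Z) x) (u : TangentSpace I x) :
    mvfderiv I (fun y ↦ ⟪Y y, Z y⟫) x u =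
      ⟪leviCivita I M Y x u, Z x⟫ + ⟪Y x, leviCivita I M Z x u⟫ := by
  have := leviCivita_metric (mdiffAt_ext I u) hY hZ
  simpa only [ext_self] using this

theorem leviCivita_sub_eq_mlieBracket (hX : MDiffAt (T% X) x) (hY : MDiffAt (T% Y) x) :
    leviCivita I M Y x (X x) - leviCivita I M X x (Y x) = mlieBracket I X Y x :=
  (CovariantDerivative.torsion_eq_zero_iff _).1 leviCivita_torsion hX hY

namespace AlmostContactMetric

variable (S : AlmostContactMetric I M)

theorem isACM (x : M) : IsACM (S.φ x) (S.ζ x) := ⟨S.inner_ζ x, S.φ_φ x, S.inner_φ x⟩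

theorem mdiffAt_ζ (x : M) : MDiffAt (T% S.ζ) x := (S.smoothVec_ζ x).mdiffAt

theorem nablaφ_apply (hσ : MDiffAt (T% σ) x) (u : TangentSpace I x) :
    S.nablaφ x u (σ x) = leviCivita I M (fun y ↦ S.φ y (σ y)) x u
      - S.φ x (leviCivita I M σ x u) := by
  have hT : TensorialAt I E (fun σ : Π y : M, TangentSpace I y ↦
      leviCivita I M (fun y ↦ S.φ y (σ y)) x u - S.φ x (leviCivita I M σ x u)) x := by
    constructor
    · intro f σ hf hσ
      have h1 : (fun y ↦ S.φ y ((f • σ) y)) = fun y ↦ f y • S.φ y (σ y) := by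
        funext y; exact map_smul ..
      have h2 := leviCivita_smul hf hσ u
      change leviCivita I M (f • σ) x u = _ at h2
      rw [h1, h2, leviCivita_smul hf (S.mdiffAt_φ hσ), map_add, map_smul, map_smul]
      module
    · intro σ τ hσ hτ
      have h1 : (fun y ↦ S.φ y ((σ + τ) y)) = fun y ↦ S.φ y (σ y) + S.φ y (τ y) := by
        funext y; exact map_add ..
      have h2 := leviCivita_add hσ hτ u
      change leviCivita I M (σ + τ) x u = _ at h2
      rw [h1, h2, leviCivita_add (S.mdiffAt_φ hσ) (S.mdiffAt_φ hτ), map_add]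
      abel
  exact hT.pointwise (mdiffAt_ext I _) hσ (ext_self _)

theorem nablaφ_add_right (u v w : TangentSpace I x) :
    S.nablaφ x u (v + w) = S.nablaφ x u v + S.nablaφ x u w := by
  have hv := mdiffAt_ext I v
  have hw := mdiffAt_ext I w
  have h := S.nablaφ_apply (mdifferentiableAt_add_section hv hw) u
  have h1 : (fun y ↦ S.φ y ((ext I v + ext I w) y))
      = fun y ↦ S.φ y (ext I v y) + S.φ y (ext I w y) := by
    funext y; exact map_add ..
  have h2 := leviCivita_add hv hw u
  change leviCivita I M (ext I v + ext I w) x u = _ at h2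
  rw [Pi.add_apply, ext_self, ext_self] at h
  rw [h, h1, h2, leviCivita_add (S.mdiffAt_φ hv) (S.mdiffAt_φ hw), map_add, nablaφ, nablaφ]
  abel

theorem nablaφ_smul_right (c : ℝ) (u v : TangentSpace I x) :
    S.nablaφ x u (c • v) = c • S.nablaφ x u v := by
  have hv := mdiffAt_ext I v
  have h := S.nablaφ_apply (mdiffAt_const_smul c hv) u
  have h1 : (fun y ↦ S.φ y (c • ext I v y)) = fun y ↦ c • S.φ y (ext I v y) := by
    funext y; exact map_smul ..
  rw [ext_self] at h
  rw [h, h1, leviCivita_const_smul c hv, leviCivita_const_smul c (S.mdiffAt_φ hv), map_smul, nablaφ]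
  module

theorem nablaη_eq (u v : TangentSpace I x) :
    S.nablaη x u v = ⟪leviCivita I M S.ζ x u, v⟫ := by
  have h := mvfderiv_inner (S.mdiffAt_ζ x) (mdiffAt_ext I v) u
  rw [ext_self] at h
  change mvfderiv I (fun y ↦ ⟪S.ζ y, ext I v y⟫) x u - ⟪S.ζ x, _⟫ = _
  rw [h]; ring

theorem inner_nablaφ (u v w : TangentSpace I x) :
    ⟪S.nablaφ x u v, w⟫ = - ⟪v, S.nablaφ x u w⟫ := by
  have hv := mdiffAt_ext I v
  have hw := mdiffAt_ext I w
  have h1 := mvfderiv_inner (S.mdiffAt_φ hv) hw u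
  have h2 := mvfderiv_inner (mdiffAt_const_smul (-1) hv) (S.mdiffAt_φ hw) u
  have h3 : (fun y ↦ ⟪S.φ y (ext I v y), ext I w y⟫)
      = fun y ↦ ⟪(-1 : ℝ) • ext I v y, S.φ y (ext I w y)⟫ := by
    funext y
    rw [(S.isACM y).inner_φ_left, real_inner_smul_left, neg_one_mul]
  rw [h3, h2, leviCivita_const_smul _ hv] at h1
  simp only [ext_self, neg_one_smul, inner_neg_left] at h1
  rw [nablaφ, nablaφ, inner_sub_left, inner_sub_right, (S.isACM x).inner_φ_left,
    ← neg_neg ⟪v, S.φ x (leviCivita I M (ext I w) x u)⟫, ← (S.isACM x).inner_φ_left v]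
  linarith

theorem inner_nablaζ (u : TangentSpace I x) : ⟪leviCivita I M S.ζ x u, S.ζ x⟫ = 0 := by
  have h := mvfderiv_inner (S.mdiffAt_ζ x) (S.mdiffAt_ζ x) u
  have h1 : (fun y ↦ ⟪S.ζ y, S.ζ y⟫) = fun _ ↦ 1 := funext S.inner_ζ
  rw [h1, mvfderiv_const, real_inner_comm (leviCivita I M S.ζ x u)] at h
  have h2 : (0 : ℝ) = ⟪leviCivita I M S.ζ x u, S.ζ x⟫ + ⟪leviCivita I M S.ζ x u, S.ζ x⟫ := by
    simpa using h
  linarith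

theorem nablaφ_ζ (u : TangentSpace I x) :
    S.nablaφ x u (S.ζ x) = - S.φ x (leviCivita I M S.ζ x u) := by
  rw [S.nablaφ_apply (S.mdiffAt_ζ x)]
  have h1 : (fun y ↦ S.φ y (S.ζ y)) = fun y ↦ (0 : ℝ) • S.ζ y := by
    funext y; rw [(S.isACM y).φ_ζ, zero_smul]
  rw [h1, leviCivita_const_smul _ (S.mdiffAt_ζ x), zero_smul, zero_sub]

theorem nablaφ_φ (u v : TangentSpace I x) :
    S.nablaφ x u (S.φ x v) + S.φ x (S.nablaφ x u v) =
      ⟪leviCivita I M S.ζ x u, v⟫ • S.ζ x + ⟪S.ζ x, v⟫ • leviCivita I M S.ζ x u := by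
  have hv := mdiffAt_ext I v
  have hζ := S.mdiffAt_ζ x
  have h1 := S.nablaφ_apply (S.mdiffAt_φ hv) u
  have h2 : (fun y ↦ S.φ y (S.φ y (ext I v y)))
      = fun y ↦ (-1 : ℝ) • ext I v y + ⟪S.ζ y, ext I v y⟫ • S.ζ y := by
    funext y; rw [S.φ_φ, neg_one_smul]
  have h3 : MDiffAt (T% (fun y ↦ (-1 : ℝ) • ext I v y)) x := mdiffAt_const_smul _ hv
  have h4 : MDiffAt (T% (fun y ↦ ⟪S.ζ y, ext I v y⟫ • S.ζ y)) x :=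
    (mdiffAt_inner hζ hv).smul_section hζ
  rw [h2, leviCivita_add h3 h4, leviCivita_const_smul _ hv,
    leviCivita_smul (mdiffAt_inner hζ hv) hζ, mvfderiv_inner hζ hv] at h1
  simp only [ext_self] at h1
  rw [h1, nablaφ, map_sub, S.φ_φ]
  module

/-- The intrinsic torsion at a point as a bilinear map. -/
def ξL (x : M) : TangentSpace I x →ₗ[ℝ] TangentSpace I x →ₗ[ℝ] TangentSpace I x :=
  LinearMap.mk₂ ℝ (S.ξ x)
    (fun u u' v ↦ by
      simp only [ξ, nablaη_eq, nablaφ, map_add, map_sub, inner_add_left]; module)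
    (fun c u v ↦ by
      simp only [ξ, nablaη_eq, nablaφ, map_smul, map_sub, real_inner_smul_left]; module)
    (fun u v v' ↦ by
      simp only [ξ, nablaη_eq, nablaφ_add_right, map_add, η, inner_add_right]; module)
    (fun c u v ↦ by
      simp only [ξ, nablaη_eq, nablaφ_smul_right, map_smul, η, real_inner_smul_right]; module)

theorem ξL_apply (u v : TangentSpace I x) : S.ξL x u v = S.ξ x u v := rfl

theorem ξL_ζ (u : TangentSpace I x) : S.ξL x u (S.ζ x) = - leviCivita I M S.ζ x u := by
  rw [ξL_apply, ξ, nablaφ_ζ, nablaη_eq, inner_nablaζ, η, S.inner_ζ, map_neg, S.φ_φ,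
    real_inner_comm, inner_nablaζ]
  module

theorem φ_ξL_sub (u v : TangentSpace I x) :
    S.φ x (S.ξL x u v) - S.ξL x u (S.φ x v) = S.nablaφ x u v := by
  have h := S.isACM x
  have h1 := S.nablaφ_φ u v
  have h2 : ⟪S.ζ x, S.nablaφ x u v⟫ = - ⟪leviCivita I M S.ζ x u, S.φ x v⟫ := by
    rw [← neg_eq_iff_eq_neg.2 (S.inner_nablaφ u (S.ζ x) v), nablaφ_ζ, inner_neg_left,
      h.inner_φ_left]
    ring
  have h3 : S.φ x (S.φ x (S.nablaφ x u v)) = - S.nablaφ x u v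
      - ⟪leviCivita I M S.ζ x u, S.φ x v⟫ • S.ζ x := by
    rw [S.φ_φ, h2]; module
  have h4 : S.φ x (S.nablaφ x u (S.φ x v)) = ⟪S.ζ x, v⟫ • S.φ x (leviCivita I M S.ζ x u)
      - S.φ x (S.φ x (S.nablaφ x u v)) := by
    rw [eq_sub_iff_add_eq, ← map_add, h1, map_add, map_smul, map_smul, h.φ_ζ]
    module
  simp only [ξL_apply, ξ, nablaη_eq, η, map_add, map_sub, map_smul, h.φ_ζ, h.inner_ζ_φ, h4, h3]
  module

theorem isTorsion_ξL (x : M) : IsTorsion (S.φ x) (S.ζ x) (S.ξL x) := by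
  have h := S.isACM x
  have hskew : ∀ u v w, ⟪S.ξL x u v, w⟫ = - ⟪v, S.ξL x u w⟫ := fun u v w ↦ by
    have h1 := congrArg (⟪v, ·⟫) (S.nablaφ_φ u w)
    simp only [inner_add_right, real_inner_smul_right] at h1
    have h2 : ⟪S.φ x (S.nablaφ x u v), w⟫ = ⟪v, S.nablaφ x u (S.φ x w)⟫ := by
      rw [h.inner_φ_left, inner_nablaφ, neg_neg]
    simp only [ξL_apply, ξ, nablaη_eq, η, inner_add_left, inner_sub_left, real_inner_smul_left,
      inner_add_right, inner_sub_right, real_inner_smul_right, h2]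
    rw [real_inner_comm (S.ζ x) v, real_inner_comm (leviCivita I M S.ζ x u) v] at *
    linear_combination (-1 / 2 : ℝ) * h1
  refine ⟨hskew, fun u v ↦ ?_⟩
  have h1 := S.φ_ξL_sub u v
  have h2 := S.nablaφ_φ u v
  have h3 : S.φ x (S.ξL x u (hor (S.ζ x) v)) = S.φ x (S.ξL x u v)
      + ⟪S.ζ x, v⟫ • S.φ x (leviCivita I M S.ζ x u) := by
    rw [hor, map_sub, map_smul, ξL_ζ, map_sub, map_smul, map_neg]; module
  have h4 : S.φ x (S.ξL x u v) = -(1 / 2 : ℝ) • S.φ x (S.φ x (S.nablaφ x u v))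
      - ((1 / 2 : ℝ) * ⟪S.ζ x, v⟫) • S.φ x (leviCivita I M S.ζ x u) := by
    simp only [ξL_apply, ξ, map_add, map_sub, map_smul, h.φ_ζ, η]; module
  have h5 : S.ξL x u (S.φ x v) = S.φ x (S.ξL x u v) - S.nablaφ x u v := by rw [← h1]; abel
  rw [h5, hor_sub, h.hor_φ, h3, h4, h.φ_φ_eq]
  module

end AlmostContactMetric

end IntrinsicTorsion

section MinimalConnection

variable {E : Type*} [NormedAddCommGroup E] [NormedSpace ℝ E] [FiniteDimensional ℝ E]
  {H : Type*} [TopologicalSpace H] {I : ModelWithCorners ℝ E H}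
  {M : Type*} [TopologicalSpace M] [ChartedSpace H M] [IsManifold I ∞ M]
  [RiemannianBundle (fun x : M ↦ TangentSpace I x)]
  [IsContMDiffRiemannianBundle I ∞ E (fun x : M ↦ TangentSpace I x)]
  {x : M} {f : M → ℝ} {σ τ X Y Z : Π y : M, TangentSpace I y}

theorem mdiffAt_congr (hσ : MDiffAt (T% σ) x) (he : ∀ᶠ y in 𝓝 x, τ y = σ y) :
    MDiffAt (T% τ) x :=
  hσ.congr_of_eventuallyEq (he.mono fun z hz ↦ by simp [hz])

namespace AlmostContactMetric

variable (S : AlmostContactMetric I M)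

/-! ### Smoothness of the intrinsic torsion -/

theorem smoothVec_ξ (hσ : SmoothVec I σ x) (hτ : SmoothVec I τ x) :
    SmoothVec I (fun y ↦ S.ξ y (σ y) (τ y)) x := by
  have hζ := S.smoothVec_ζ x
  have h1 : SmoothVec I (fun y ↦ S.nablaφ y (σ y) (τ y)) x := by
    refine ((S.smoothVec_leviCivita hσ (S.smoothVec_φ hτ)).sub
      (S.smoothVec_φ (S.smoothVec_leviCivita hσ hτ))).congr ?_
    filter_upwards [hτ.eventually] with y hy using S.nablaφ_apply hy.mdiffAt _
  have h2 := S.smoothVec_leviCivita hσ hζ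
  have h3 := (SmoothVec.const_smul (-(1 / 2)) (S.smoothVec_φ h1)).add
    (SmoothVec.smul (h2.inner hτ) hζ)
  have h4 := SmoothVec.smul ((SmoothFun.const (1 / 2)).mul (hζ.inner hτ)) h2
  refine (h3.sub h4).congr (Filter.Eventually.of_forall fun y ↦ ?_)
  simp only [ξ, nablaη_eq, η]

theorem mdiffAt_ξ (hσ : MDiffAt (T% σ) x) (hτ : MDiffAt (T% τ) x) :
    MDiffAt (T% (fun y ↦ S.ξ y (σ y) (τ y))) x := by
  obtain ⟨e, he, hb⟩ := exists_orthonormalFrame I x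
  have h1 : MDiffAt (T% (fun y ↦ ∑ i, ∑ j,
      (⟪e i y, σ y⟫ * ⟪e j y, τ y⟫) • S.ξ y (e i y) (e j y))) x := by
    refine .sum_section fun i _ ↦ .sum_section fun j _ ↦ ?_
    have h2 := mdiffAt_inner (he i).mdiffAt hσ
    have h3 := mdiffAt_inner (he j).mdiffAt hτ
    exact (h2.mul h3).smul_section (S.smoothVec_ξ (he i) (he j)).mdiffAt
  refine mdiffAt_congr h1 ?_
  filter_upwards [hb] with y ⟨b, hby⟩
  simp only [← hby, ← S.ξL_apply]
  conv_lhs => rw [← b.sum_repr' (σ y), ← b.sum_repr' (τ y)]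
  simp only [map_sum, map_smul, LinearMap.sum_apply, LinearMap.smul_apply, Finset.smul_sum,
    smul_smul]
  rw [Finset.sum_comm]
  exact Finset.sum_congr rfl fun i _ ↦ Finset.sum_congr rfl fun j _ ↦ by rw [mul_comm]

theorem mdiffAt_ξL (hσ : MDiffAt (T% σ) x) (hτ : MDiffAt (T% τ) x) :
    MDiffAt (T% (fun y ↦ S.ξL y (σ y) (τ y))) x := S.mdiffAt_ξ hσ hτ

/-! ### The minimal connection -/

theorem minConn_eq (σ : Π y : M, TangentSpace I y) (u : TangentSpace I x) :
    S.minConn σ x u = leviCivita I M σ x u + S.ξL x u (σ x) := rfl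

theorem smoothVec_minConn (hX : SmoothVec I X x) (hY : SmoothVec I Y x) :
    SmoothVec I (fun y ↦ S.minConn Y y (X y)) x :=
  (S.smoothVec_leviCivita hX hY).add (S.smoothVec_ξ hX hY)

theorem minConn_add_right (u v : TangentSpace I x) :
    S.minConn σ x (u + v) = S.minConn σ x u + S.minConn σ x v := by
  simp only [minConn_eq, map_add, LinearMap.add_apply]; abel

theorem minConn_smul_right (c : ℝ) (u : TangentSpace I x) :
    S.minConn σ x (c • u) = c • S.minConn σ x u := by
  simp only [minConn_eq, map_smul, LinearMap.smul_apply, smul_add]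

theorem minConn_congr (hσ : MDiffAt (T% σ) x) (he : ∀ᶠ y in 𝓝 x, τ y = σ y)
    (u : TangentSpace I x) : S.minConn τ x u = S.minConn σ x u := by
  rw [minConn_eq, minConn_eq, leviCivita_congr hσ he, he.self_of_nhds]

theorem minConn_add (hσ : MDiffAt (T% σ) x) (hτ : MDiffAt (T% τ) x) (u : TangentSpace I x) :
    S.minConn (fun y ↦ σ y + τ y) x u = S.minConn σ x u + S.minConn τ x u := by
  simp only [minConn_eq, leviCivita_add hσ hτ, map_add]; abel

theorem minConn_smul (hf : MDiffAt f x) (hσ : MDiffAt (T% σ) x) (u : TangentSpace I x) :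
    S.minConn (fun y ↦ f y • σ y) x u = f x • S.minConn σ x u + mvfderiv I f x u • σ x := by
  simp only [minConn_eq, leviCivita_smul hf hσ, map_smul]; module

theorem minConn_const_smul (c : ℝ) (hσ : MDiffAt (T% σ) x) (u : TangentSpace I x) :
    S.minConn (fun y ↦ c • σ y) x u = c • S.minConn σ x u := by
  simp only [minConn_eq, leviCivita_const_smul c hσ, map_smul]; module

theorem minConn_sub (hσ : MDiffAt (T% σ) x) (hτ : MDiffAt (T% τ) x) (u : TangentSpace I x) :
    S.minConn (fun y ↦ σ y - τ y) x u = S.minConn σ x u - S.minConn τ x u := by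
  have h : (fun y ↦ σ y - τ y) = fun y ↦ σ y + (-1 : ℝ) • τ y := by funext y; module
  rw [h, S.minConn_add hσ (mdiffAt_const_smul _ hτ), S.minConn_const_smul _ hτ]; module

theorem minConn_sum {ι : Type*} (s : Finset ι) {t : ι → Π y : M, TangentSpace I y}
    (h : ∀ i, MDiffAt (T% (t i)) x) (u : TangentSpace I x) :
    S.minConn (fun y ↦ ∑ i ∈ s, t i y) x u = ∑ i ∈ s, S.minConn (t i) x u := by
  classical
  induction s using Finset.induction_on with
  | empty =>
    have h0 : (fun y : M ↦ ∑ i ∈ (∅ : Finset ι), t i y) = fun y ↦ (0 : ℝ) • S.ζ y := by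
      funext y; simp
    rw [h0, S.minConn_const_smul _ (S.mdiffAt_ζ x)]; simp
  | insert a s ha ih =>
    have h1 : (fun y ↦ ∑ i ∈ insert a s, t i y) = fun y ↦ t a y + ∑ i ∈ s, t i y := by
      funext y; exact Finset.sum_insert ha
    rw [h1, S.minConn_add (h a) (.sum_section fun i _ ↦ h i), ih, Finset.sum_insert ha]

theorem mvfderiv_inner_minConn (hY : MDiffAt (T% Y) x) (hZ : MDiffAt (T% Z) x)
    (u : TangentSpace I x) :
    mvfderiv I (fun y ↦ ⟪Y y, Z y⟫) x u = ⟪S.minConn Y x u, Z x⟫ + ⟪Y x, S.minConn Z x u⟫ := by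
  rw [mvfderiv_inner hY hZ, minConn_eq, minConn_eq, inner_add_left, inner_add_right,
    (S.isTorsion_ξL x).skew]
  ring

theorem minConn_φ (hσ : MDiffAt (T% σ) x) (u : TangentSpace I x) :
    S.minConn (fun y ↦ S.φ y (σ y)) x u = S.φ x (S.minConn σ x u) := by
  have h1 := S.nablaφ_apply hσ u
  have h2 := S.φ_ξL_sub u (σ x)
  rw [minConn_eq, minConn_eq, map_add]
  linear_combination (norm := module) -h1 - h2

theorem minConn_ζ (u : TangentSpace I x) : S.minConn S.ζ x u = 0 := by
  rw [minConn_eq, ξL_ζ, add_neg_cancel]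

theorem inner_ζ_minConn (hσ : MDiffAt (T% σ) x) (u : TangentSpace I x) :
    mvfderiv I (fun y ↦ ⟪S.ζ y, σ y⟫) x u = ⟪S.ζ x, S.minConn σ x u⟫ := by
  rw [S.mvfderiv_inner_minConn (S.mdiffAt_ζ x) hσ, minConn_ζ, inner_zero_left, zero_add]

theorem mdiffAt_hor (hσ : MDiffAt (T% σ) x) : MDiffAt (T% (fun y ↦ hor (S.ζ y) (σ y))) x := by
  have h1 := (mdiffAt_inner (S.mdiffAt_ζ x) hσ).smul_section (S.mdiffAt_ζ x)
  exact mdifferentiableAt_sub_section hσ h1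

theorem minConn_hor (hσ : MDiffAt (T% σ) x) (u : TangentSpace I x) :
    S.minConn (fun y ↦ hor (S.ζ y) (σ y)) x u = hor (S.ζ x) (S.minConn σ x u) := by
  have hi := mdiffAt_inner (S.mdiffAt_ζ x) hσ
  have h1 : MDiffAt (T% (fun y ↦ ⟪S.ζ y, σ y⟫ • S.ζ y)) x := hi.smul_section (S.mdiffAt_ζ x)
  simp only [hor]
  rw [S.minConn_sub hσ h1, S.minConn_smul hi (S.mdiffAt_ζ x), minConn_ζ, S.inner_ζ_minConn hσ]
  module

theorem minConn_inner_smul (hX : MDiffAt (T% X) x) (hY : MDiffAt (T% Y) x)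
    (hZ : MDiffAt (T% Z) x) (u : TangentSpace I x) :
    S.minConn (fun y ↦ ⟪X y, Y y⟫ • Z y) x u =
      (⟪S.minConn X x u, Y x⟫ + ⟪X x, S.minConn Y x u⟫) • Z x
        + ⟪X x, Y x⟫ • S.minConn Z x u := by
  rw [S.minConn_smul (mdiffAt_inner hX hY) hZ, S.mvfderiv_inner_minConn hX hY]
  module

theorem minConn_sub_minConn (hX : MDiffAt (T% X) x) (hY : MDiffAt (T% Y) x) :
    S.minConn Y x (X x) - S.minConn X x (Y x) =
      mlieBracket I X Y x + S.ξL x (X x) (Y x) - S.ξL x (Y x) (X x) := by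
  rw [minConn_eq, minConn_eq, ← leviCivita_sub_eq_mlieBracket hX hY]; abel

/-! ### The covariant derivative of the intrinsic torsion -/

theorem covξ_apply (hσ : MDiffAt (T% σ) x) (hτ : MDiffAt (T% τ) x) (u : TangentSpace I x) :
    covTensor I S.minConn S.ξ x u (σ x) (τ x) =
      S.minConn (fun y ↦ S.ξ y (σ y) (τ y)) x u - S.ξL x (S.minConn σ x u) (τ x)
        - S.ξL x (σ x) (S.minConn τ x u) := by
  let Φ : (Π y : M, TangentSpace I y) → (Π y : M, TangentSpace I y) → TangentSpace I x :=
    fun σ τ ↦ S.minConn (fun y ↦ S.ξL y (σ y) (τ y)) x u - S.ξL x (S.minConn σ x u) (τ x)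
        - S.ξL x (σ x) (S.minConn τ x u)
  have hΦ₁ : ∀ τ, MDiffAt (T% τ) x → TensorialAt I E (Φ · τ) x := by
    intro τ hτ
    constructor
    · intro f σ hf hσ
      have h1 : (fun y ↦ S.ξL y ((f • σ) y) (τ y)) = fun y ↦ f y • S.ξL y (σ y) (τ y) := by
        funext y; simp
      have h2 : S.minConn (f • σ) x u = _ := S.minConn_smul hf hσ u
      simp only [Φ]
      rw [h1, h2, S.minConn_smul hf (S.mdiffAt_ξL hσ hτ)]
      simp only [Pi.smul_apply', map_add, map_smul, LinearMap.add_apply, LinearMap.smul_apply]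
      module
    · intro σ σ' hσ hσ'
      have h1 : (fun y ↦ S.ξL y ((σ + σ') y) (τ y))
          = fun y ↦ S.ξL y (σ y) (τ y) + S.ξL y (σ' y) (τ y) := by
        funext y; simp
      have h2 : S.minConn (σ + σ') x u = _ := S.minConn_add hσ hσ' u
      simp only [Φ]
      rw [h1, h2, S.minConn_add (S.mdiffAt_ξL hσ hτ) (S.mdiffAt_ξL hσ' hτ)]
      simp only [Pi.add_apply, map_add, LinearMap.add_apply]
      abel
  have hΦ₂ : ∀ σ, MDiffAt (T% σ) x → TensorialAt I E (Φ σ ·) x := by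
    intro σ hσ
    constructor
    · intro f τ hf hτ
      have h1 : (fun y ↦ S.ξL y (σ y) ((f • τ) y)) = fun y ↦ f y • S.ξL y (σ y) (τ y) := by
        funext y; simp
      have h2 : S.minConn (f • τ) x u = _ := S.minConn_smul hf hτ u
      simp only [Φ]
      rw [h1, h2, S.minConn_smul hf (S.mdiffAt_ξL hσ hτ)]
      simp only [Pi.smul_apply', map_add, map_smul]
      module
    · intro τ τ' hτ hτ'
      have h1 : (fun y ↦ S.ξL y (σ y) ((τ + τ') y))
          = fun y ↦ S.ξL y (σ y) (τ y) + S.ξL y (σ y) (τ' y) := by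
        funext y; simp
      have h2 : S.minConn (τ + τ') x u = _ := S.minConn_add hτ hτ' u
      simp only [Φ]
      rw [h1, h2, S.minConn_add (S.mdiffAt_ξL hσ hτ) (S.mdiffAt_ξL hσ hτ')]
      simp only [Pi.add_apply, map_add]
      abel
  have h := TensorialAt.pointwise₂ hΦ₁ hΦ₂ (mdiffAt_ext I (σ x)) hσ (mdiffAt_ext I (τ x)) hτ
    (ext_self _) (ext_self _)
  simp only [Φ, ext_self] at h
  exact h

theorem minConn_ξ (hσ : MDiffAt (T% σ) x) (hτ : MDiffAt (T% τ) x) (u : TangentSpace I x) :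
    S.minConn (fun y ↦ S.ξL y (σ y) (τ y)) x u =
      covTensor I S.minConn S.ξ x u (σ x) (τ x) + S.ξL x (S.minConn σ x u) (τ x)
        + S.ξL x (σ x) (S.minConn τ x u) := by
  rw [S.covξ_apply hσ hτ]
  simp only [ξL_apply]
  abel

/-- The covariant derivative of the intrinsic torsion for the minimal connection. -/
def covξL (x : M) :
    TangentSpace I x →ₗ[ℝ] TangentSpace I x →ₗ[ℝ] TangentSpace I x →ₗ[ℝ] TangentSpace I x where
  toFun u := LinearMap.mk₂ ℝ (covTensor I S.minConn S.ξ x u)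
    (fun v v' w ↦ by
      have hv := mdiffAt_ext I v
      have hv' := mdiffAt_ext I v'
      have hw := mdiffAt_ext I w
      have h := S.covξ_apply (mdifferentiableAt_add_section hv hv') hw u
      have h1 : (fun y ↦ S.ξ y ((ext I v + ext I v') y) (ext I w y))
          = fun y ↦ S.ξ y (ext I v y) (ext I w y) + S.ξ y (ext I v' y) (ext I w y) := by
        funext y; simp only [← ξL_apply, Pi.add_apply, map_add, LinearMap.add_apply]
      have h2 : S.minConn (ext I v + ext I v') x u = _ := S.minConn_add hv hv' u
      rw [h1, h2, S.minConn_add (S.mdiffAt_ξ hv hw) (S.mdiffAt_ξ hv' hw)] at h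
      simp only [Pi.add_apply, ext_self, map_add, LinearMap.add_apply] at h
      rw [h]; simp only [covTensor, ξL_apply]
      abel)
    (fun c v w ↦ by
      have hv := mdiffAt_ext I v
      have hw := mdiffAt_ext I w
      have h := S.covξ_apply (mdiffAt_const_smul c hv) hw u
      have h1 : (fun y ↦ S.ξ y (c • ext I v y) (ext I w y))
          = fun y ↦ c • S.ξ y (ext I v y) (ext I w y) := by
        funext y; simp only [← ξL_apply, map_smul, LinearMap.smul_apply]
      rw [h1, S.minConn_const_smul c hv, S.minConn_const_smul c (S.mdiffAt_ξ hv hw)] at h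
      simp only [ext_self, map_smul, LinearMap.smul_apply] at h
      rw [h]; simp only [covTensor, ξL_apply]
      module)
    (fun v w w' ↦ by
      have hv := mdiffAt_ext I v
      have hw' := mdiffAt_ext I w'
      have hw := mdiffAt_ext I w
      have h := S.covξ_apply hv (mdifferentiableAt_add_section hw hw') u
      have h1 : (fun y ↦ S.ξ y (ext I v y) ((ext I w + ext I w') y))
          = fun y ↦ S.ξ y (ext I v y) (ext I w y) + S.ξ y (ext I v y) (ext I w' y) := by
        funext y; simp only [← ξL_apply, Pi.add_apply, map_add]
      have h2 : S.minConn (ext I w + ext I w') x u = _ := S.minConn_add hw hw' u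
      rw [h1, h2, S.minConn_add (S.mdiffAt_ξ hv hw) (S.mdiffAt_ξ hv hw')] at h
      simp only [Pi.add_apply, ext_self, map_add] at h
      rw [h]; simp only [covTensor, ξL_apply]
      abel)
    (fun c v w ↦ by
      have hv := mdiffAt_ext I v
      have hw := mdiffAt_ext I w
      have h := S.covξ_apply hv (mdiffAt_const_smul c hw) u
      have h1 : (fun y ↦ S.ξ y (ext I v y) (c • ext I w y))
          = fun y ↦ c • S.ξ y (ext I v y) (ext I w y) := by
        funext y; simp only [← ξL_apply, map_smul]
      rw [h1, S.minConn_const_smul c hw, S.minConn_const_smul c (S.mdiffAt_ξ hv hw)] at h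
      simp only [ext_self, map_smul] at h
      rw [h]; simp only [covTensor, ξL_apply]
      module)
  map_add' u u' := by
    ext v w
    simp only [LinearMap.mk₂_apply, LinearMap.add_apply, covTensor, minConn_add_right,
      ← ξL_apply, map_add]
    abel
  map_smul' c u := by
    ext v w
    simp only [LinearMap.mk₂_apply, LinearMap.smul_apply, covTensor, minConn_smul_right,
      ← ξL_apply, map_smul, RingHom.id_apply]
    module

theorem minConn_ξL (hσ : MDiffAt (T% σ) x) (hτ : MDiffAt (T% τ) x) (u : TangentSpace I x) :
    S.minConn (fun y ↦ S.ξL y (σ y) (τ y)) x u =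
      S.covξL x u (σ x) (τ x) + S.ξL x (S.minConn σ x u) (τ x)
        + S.ξL x (σ x) (S.minConn τ x u) :=
  S.minConn_ξ hσ hτ u

theorem isTorsion_covξL (x : M) (u : TangentSpace I x) :
    IsTorsion (S.φ x) (S.ζ x) (S.covξL x u) := by
  refine ⟨fun v w z ↦ ?_, fun v w ↦ ?_⟩
  · have hv := mdiffAt_ext I v
    have hw := mdiffAt_ext I w
    have hz := mdiffAt_ext I z
    have h1 := S.mvfderiv_inner_minConn (S.mdiffAt_ξL hv hw) hz u
    have h2 := S.mvfderiv_inner_minConn (mdiffAt_const_smul (-1) hw) (S.mdiffAt_ξL hv hz) u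
    have h3 : (fun y ↦ ⟪S.ξL y (ext I v y) (ext I w y), ext I z y⟫)
        = fun y ↦ ⟪(-1 : ℝ) • ext I w y, S.ξL y (ext I v y) (ext I z y)⟫ := by
      funext y; rw [(S.isTorsion_ξL y).skew, real_inner_smul_left, neg_one_mul]
    rw [h3, h2, S.minConn_ξL hv hw, S.minConn_ξL hv hz, S.minConn_const_smul _ hw] at h1
    simp only [ext_self, inner_add_left, inner_add_right, real_inner_smul_left] at h1
    have h4 := (S.isTorsion_ξL x).skew v (S.minConn (ext I w) x u) z
    have h5 := (S.isTorsion_ξL x).skew v w (S.minConn (ext I z) x u)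
    have h6 := (S.isTorsion_ξL x).skew (S.minConn (ext I v) x u) w z
    linarith
  · have hv := mdiffAt_ext I v
    have hw := mdiffAt_ext I w
    have h1 := S.minConn_hor (S.mdiffAt_ξL hv (S.mdiffAt_φ hw)) u
    have h2 := S.minConn_const_smul (-1)
      (S.mdiffAt_φ (S.mdiffAt_ξL hv (S.mdiffAt_hor hw))) u
    have h3 : (fun y ↦ hor (S.ζ y) (S.ξL y (ext I v y) (S.φ y (ext I w y))))
        = fun y ↦ (-1 : ℝ) • S.φ y (S.ξL y (ext I v y) (hor (S.ζ y) (ext I w y))) := by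
      funext y; rw [(S.isTorsion_ξL y).anti, neg_one_smul]
    rw [h3, h2, S.minConn_φ (S.mdiffAt_ξL hv (S.mdiffAt_hor hw)), S.minConn_ξL hv (S.mdiffAt_φ hw),
      S.minConn_ξL hv (S.mdiffAt_hor hw), S.minConn_φ hw, S.minConn_hor hw] at h1
    simp only [ext_self, hor_add, map_add, (S.isTorsion_ξL x).anti] at h1
    linear_combination (norm := module) -h1

end AlmostContactMetric

end MinimalConnection

section Curvature

variable {E : Type*} [NormedAddCommGroup E] [NormedSpace ℝ E] [FiniteDimensional ℝ E]
  {H : Type*} [TopologicalSpace H] {I : ModelWithCorners ℝ E H}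
  {M : Type*} [TopologicalSpace M] [ChartedSpace H M] [IsManifold I ∞ M]
  [RiemannianBundle (fun x : M ↦ TangentSpace I x)]
  [IsContMDiffRiemannianBundle I ∞ E (fun x : M ↦ TangentSpace I x)]
  {x : M} {f : M → ℝ} {U V W Z : Π y : M, TangentSpace I y}

/-- The curvature `D_{[U,V]} W - D_U D_V W + D_V D_U W` of a connection `D` on vector fields. -/
def curvField (D : (Π y : M, TangentSpace I y) → Π y : M, TangentSpace I y → TangentSpace I y)
    (U V W : Π y : M, TangentSpace I y) (x : M) : TangentSpace I x :=
  D W x (mlieBracket I U V x) - D (fun y ↦ D W y (V y)) x (U x) + D (fun y ↦ D W y (U y)) x (V x)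

theorem curvature_eq (u v w : TangentSpace I x) : curvature I x u v w =
    curvField (fun σ y u ↦ leviCivita I M σ y u) (ext I u) (ext I v) (ext I w) x := by
  simp only [curvField, curvature, ext_self]

theorem mvfderiv_congr {f g : M → ℝ} (h : f =ᶠ[𝓝 x] g) (u : TangentSpace I x) :
    mvfderiv I f x u = mvfderiv I g x u := by
  simp only [mvfderiv, h.mfderiv_eq, h.self_of_nhds]
  rfl

namespace AlmostContactMetric

variable (S : AlmostContactMetric I M)

section
include S

theorem inner_curvField (hU : SmoothVec I U x) (hV : SmoothVec I V x) (hW : SmoothVec I W x)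
    (hZ : SmoothVec I Z x) :
    ⟪curvField (fun σ y u ↦ leviCivita I M σ y u) U V W x, Z x⟫ =
      - ⟪W x, curvField (fun σ y u ↦ leviCivita I M σ y u) U V Z x⟫ := by
  have key : ∀ {V : Π y : M, TangentSpace I y}, SmoothVec I V x → ∀ u,
      mvfderiv I (fun y ↦ mvfderiv I (fun y ↦ ⟪W y, Z y⟫) y (V y)) x u =
        ⟪leviCivita I M (fun y ↦ leviCivita I M W y (V y)) x u, Z x⟫
        + ⟪leviCivita I M W x (V x), leviCivita I M Z x u⟫
        + (⟪leviCivita I M W x u, leviCivita I M Z x (V x)⟫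
        + ⟪W x, leviCivita I M (fun y ↦ leviCivita I M Z y (V y)) x u⟫) := by
    intro V hV u
    have h1 := S.smoothVec_leviCivita hV hW
    have h2 := S.smoothVec_leviCivita hV hZ
    have h3 : (fun y ↦ mvfderiv I (fun y ↦ ⟪W y, Z y⟫) y (V y)) =ᶠ[𝓝 x] fun y ↦
        ⟪leviCivita I M W y (V y), Z y⟫ + ⟪W y, leviCivita I M Z y (V y)⟫ := by
      filter_upwards [hW.eventually, hZ.eventually] with y hw hz
      exact mvfderiv_inner hw.mdiffAt hz.mdiffAt _
    have h4 := mvfderiv_fun_add (mdiffAt_inner h1.mdiffAt hZ.mdiffAt)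
      (mdiffAt_inner hW.mdiffAt h2.mdiffAt)
    have h5 := mvfderiv_inner h1.mdiffAt hZ.mdiffAt u
    have h6 := mvfderiv_inner hW.mdiffAt h2.mdiffAt u
    rw [mvfderiv_congr h3, h4, add_apply, h5, h6]
  have h := S.mvfderiv_mlieBracket (hW.inner hZ) hU hV
  rw [key hU, key hV, mvfderiv_inner hW.mdiffAt hZ.mdiffAt] at h
  simp only [curvField, inner_add_left, inner_sub_left, inner_add_right, inner_sub_right]
  linarith

theorem curvature_skew (u v w z : TangentSpace I x) :
    ⟪curvature I x u v w, z⟫ = - ⟪w, curvature I x u v z⟫ := by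
  have := S.inner_curvField (smoothVec_ext I u) (smoothVec_ext I v) (smoothVec_ext I w)
    (smoothVec_ext I z)
  simpa only [curvature_eq, ext_self] using this

theorem curvature_apply (u v : TangentSpace I x) (hW : SmoothVec I W x) :
    curvature I x u v (W x) =
      curvField (fun σ y u ↦ leviCivita I M σ y u) (ext I u) (ext I v) W x := by
  refine ext_inner_right ℝ fun z ↦ ?_
  have := S.inner_curvField (smoothVec_ext I u) (smoothVec_ext I v) hW (smoothVec_ext I z)
  rw [ext_self] at this
  rw [S.curvature_skew, this, curvature_eq]

omit S in
theorem curvature_swap (u v w : TangentSpace I x) :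
    curvature I x u v w = - curvature I x v u w := by
  have hs := mlieBracket_swap_apply (I := I) (V := ext I u) (W := ext I v) (x := x)
  rw [curvature, curvature, hs, map_neg]; abel

theorem curvature_bianchi (u v w : TangentSpace I x) :
    curvature I x u v w + curvature I x v w u + curvature I x w u v = 0 := by
  have : CompleteSpace E := FiniteDimensional.complete ℝ E
  have := isManifold_minSmoothness I M 3
  have := isManifold_minSmoothness I M 2
  have two : ∀ {V : Π y : M, TangentSpace I y}, SmoothVec I V x →
      ContMDiffAt I (I.prod 𝓘(ℝ, E)) (minSmoothness ℝ 2) (T% V) x := by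
    intro V hV
    rw [minSmoothness_of_isRCLikeNormedField]
    exact hV.self_of_nhds.of_le ENat.LEInfty.out
  have key : ∀ {U V W : Π y : M, TangentSpace I y}, SmoothVec I U x → SmoothVec I V x →
      SmoothVec I W x → leviCivita I M (fun y ↦ leviCivita I M W y (V y)) x (U x)
        - leviCivita I M (fun y ↦ leviCivita I M V y (W y)) x (U x)
        - leviCivita I M U x (mlieBracket I V W x) = mlieBracket I U (mlieBracket I V W) x := by
    intro U V W hU hV hW
    have h1 := S.smoothVec_leviCivita hV hW
    have h2 := S.smoothVec_leviCivita hW hV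
    have h3 := hV.mlieBracket hW
    have h4 : leviCivita I M (fun y ↦ leviCivita I M W y (V y)) x (U x)
        = leviCivita I M (fun y ↦ mlieBracket I V W y + leviCivita I M V y (W y)) x (U x) := by
      refine leviCivita_congr (h3.add h2).mdiffAt ?_ _
      filter_upwards [hV.eventually, hW.eventually] with y hv hw
      rw [← leviCivita_sub_eq_mlieBracket hv.mdiffAt hw.mdiffAt, sub_add_cancel]
    rw [h4, leviCivita_add h3.mdiffAt h2.mdiffAt,
      ← leviCivita_sub_eq_mlieBracket hU.mdiffAt h3.mdiffAt]
    abel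
  have hu := smoothVec_ext I u
  have hv := smoothVec_ext I v
  have hw := smoothVec_ext I w
  have J := leibniz_identity_mlieBracket_apply (two hu) (two hv) (two hw)
  have s1 := mlieBracket_swap_apply (I := I) (V := mlieBracket I (ext I u) (ext I v))
    (W := ext I w) (x := x)
  have s2 : mlieBracket I (ext I v) (mlieBracket I (ext I u) (ext I w)) x
      = - mlieBracket I (ext I v) (mlieBracket I (ext I w) (ext I u)) x := by
    rw [mlieBracket_swap (V := ext I u),
      show -mlieBracket I (ext I w) (ext I u) = (-1 : ℝ) • mlieBracket I (ext I w) (ext I u) by simp,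
      mlieBracket_const_smul_right (hw.mlieBracket hu).mdiffAt, neg_one_smul]
  have k1 := key hu hv hw
  have k2 := key hv hw hu
  have k3 := key hw hu hv
  simp only [ext_self] at k1 k2 k3
  rw [s1, s2] at J
  simp only [curvature]
  linear_combination (norm := module) -k1 - k2 - k3 - J

theorem curvature_pair (a b c d : TangentSpace I x) :
    ⟪curvature I x a b c, d⟫ = ⟪curvature I x c d a, b⟫ :=
  pair_symm_of_bianchi (K := fun a b c d : TangentSpace I x ↦ ⟪curvature I x a b c, d⟫)
    (fun a b c d ↦ by rw [curvature_swap, inner_neg_left])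
    (fun a b c d ↦ by rw [S.curvature_skew, real_inner_comm])
    (fun a b c d ↦ by
      rw [← inner_add_left, ← inner_add_left, S.curvature_bianchi, inner_zero_left]) a b c d

end

/-- The Riemann curvature tensor at a point as a trilinear map. -/
def curvL (x : M) :
    TangentSpace I x →ₗ[ℝ] TangentSpace I x →ₗ[ℝ] TangentSpace I x →ₗ[ℝ] TangentSpace I x :=
  have add_right : ∀ u v w w' : TangentSpace I x, curvature I x u v (w + w')
      = curvature I x u v w + curvature I x u v w' := fun u v w w' ↦
    ext_inner_right ℝ fun z ↦ by
      simp only [inner_add_left, S.curvature_skew u v _ z]; ring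
  have smul_right : ∀ (c : ℝ) (u v w : TangentSpace I x), curvature I x u v (c • w)
      = c • curvature I x u v w := fun c u v w ↦
    ext_inner_right ℝ fun z ↦ by
      simp only [real_inner_smul_left, S.curvature_skew u v _ z]; ring
  have add_left : ∀ u u' v w : TangentSpace I x, curvature I x (u + u') v w
      = curvature I x u v w + curvature I x u' v w := fun u u' v w ↦
    ext_inner_right ℝ fun z ↦ by
      simp only [inner_add_left, S.curvature_pair _ v w z, add_right]
  have smul_left : ∀ (c : ℝ) (u v w : TangentSpace I x), curvature I x (c • u) v w
      = c • curvature I x u v w := fun c u v w ↦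
    ext_inner_right ℝ fun z ↦ by
      simp only [real_inner_smul_left, S.curvature_pair _ v w z, smul_right]
  { toFun := fun u ↦ LinearMap.mk₂ ℝ (curvature I x u)
      (fun v v' w ↦ by
        rw [curvature_swap, add_left, curvature_swap v u, curvature_swap v' u]; abel)
      (fun c v w ↦ by rw [curvature_swap, smul_left, curvature_swap v u]; module)
      (add_right u) (fun c v w ↦ smul_right c u v w)
    map_add' := fun u u' ↦ by ext v w; exact add_left u u' v w
    map_smul' := fun c u ↦ by ext v w; exact smul_left c u v w }

theorem curvField_sub_torsionCurv (hU : SmoothVec I U x) (hV : SmoothVec I V x)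
    (hW : SmoothVec I W x) :
    curvField (fun σ y u ↦ leviCivita I M σ y u) U V W x
      - torsionCurv (S.ξL x) (S.covξL x) (U x) (V x) (W x) = curvField S.minConn U V W x := by
  have key : ∀ {U V : Π y : M, TangentSpace I y}, SmoothVec I U x → SmoothVec I V x →
      leviCivita I M (fun y ↦ leviCivita I M W y (V y)) x (U x) =
        S.minConn (fun y ↦ S.minConn W y (V y)) x (U x) - (S.covξL x (U x) (V x) (W x)
          + S.ξL x (S.minConn V x (U x)) (W x) + S.ξL x (V x) (S.minConn W x (U x)))
          - S.ξL x (U x) (S.minConn W x (V x)) + S.ξL x (U x) (S.ξL x (V x) (W x)) := by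
    intro U V hU hV
    have h1 : leviCivita I M (fun y ↦ leviCivita I M W y (V y)) x (U x) =
        S.minConn (fun y ↦ leviCivita I M W y (V y)) x (U x)
          - S.ξL x (U x) (leviCivita I M W x (V x)) := by
      rw [minConn_eq, add_sub_cancel_right]
    have h2 : leviCivita I M W x (V x) = S.minConn W x (V x) - S.ξL x (V x) (W x) := by
      rw [minConn_eq, add_sub_cancel_right]
    have h3 : (fun y ↦ leviCivita I M W y (V y))
        = fun y ↦ S.minConn W y (V y) - S.ξL y (V y) (W y) := by
      funext y; rw [minConn_eq, add_sub_cancel_right]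
    rw [h1, h2, h3, S.minConn_sub (S.smoothVec_minConn hV hW).mdiffAt
      (S.mdiffAt_ξL hV.mdiffAt hW.mdiffAt), S.minConn_ξL hV.mdiffAt hW.mdiffAt, map_sub]
    abel
  have h1 : leviCivita I M W x (mlieBracket I U V x) = S.minConn W x (mlieBracket I U V x)
      - S.ξL x (mlieBracket I U V x) (W x) := by rw [minConn_eq, add_sub_cancel_right]
  have h2 := congrArg (fun u ↦ S.ξL x u (W x)) (S.minConn_sub_minConn hU.mdiffAt hV.mdiffAt)
  simp only [map_sub, map_add, LinearMap.sub_apply, LinearMap.add_apply] at h2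
  simp only [curvField, torsionCurv, key hU hV, key hV hU, h1, map_sub, LinearMap.sub_apply]
  linear_combination (norm := module) h2

theorem curvField_minConn_φ (hU : SmoothVec I U x) (hV : SmoothVec I V x)
    (hW : SmoothVec I W x) :
    curvField S.minConn U V (fun y ↦ S.φ y (W y)) x = S.φ x (curvField S.minConn U V W x) := by
  have key : ∀ {U V : Π y : M, TangentSpace I y}, SmoothVec I U x → SmoothVec I V x →
      S.minConn (fun y ↦ S.minConn (fun y ↦ S.φ y (W y)) y (V y)) x (U x) =
        S.φ x (S.minConn (fun y ↦ S.minConn W y (V y)) x (U x)) := by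
    intro U V hU hV
    have h := (S.smoothVec_minConn hV hW).mdiffAt
    rw [← S.minConn_φ h]
    refine S.minConn_congr (S.mdiffAt_φ h) ?_ _
    filter_upwards [hW.eventually] with y hy using S.minConn_φ hy.mdiffAt _
  simp only [curvField, key hU hV, key hV hU, S.minConn_φ hW.mdiffAt, map_add, map_sub]

theorem curvField_minConn_ζ (U V : Π y : M, TangentSpace I y) (x : M) :
    curvField S.minConn U V S.ζ x = 0 := by
  have key : ∀ (V : Π y : M, TangentSpace I y) u,
      S.minConn (fun y ↦ S.minConn S.ζ y (V y)) x u = 0 := by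
    intro V u
    have h : (fun y ↦ S.minConn S.ζ y (V y)) = fun y ↦ (0 : ℝ) • S.ζ y := by
      funext y; rw [minConn_ζ, zero_smul]
    rw [h, S.minConn_const_smul _ (S.mdiffAt_ζ x), zero_smul]
  rw [curvField, key, key, minConn_ζ, sub_zero, add_zero]

theorem isPointData (x : M) :
    IsPointData (S.φ x) (S.ζ x) (S.ξL x) (S.covξL x) (S.curvL x) where
  acm := S.isACM x
  tor := S.isTorsion_ξL x
  torA := S.isTorsion_covξL x
  curv_swap := curvature_swap
  curv_skew := S.curvature_skew
  bianchi := S.curvature_bianchi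
  curv_ζ u v := by
    have h := S.curvField_sub_torsionCurv (smoothVec_ext I u) (smoothVec_ext I v) (S.smoothVec_ζ x)
    rw [← S.curvature_apply u v (S.smoothVec_ζ x), curvField_minConn_ζ, ext_self, ext_self] at h
    exact sub_eq_zero.1 h
  curv_φ u v w := by
    have hw := smoothVec_ext I w
    have h1 := S.curvField_sub_torsionCurv (smoothVec_ext I u) (smoothVec_ext I v) hw
    have h2 := S.curvField_sub_torsionCurv (smoothVec_ext I u) (smoothVec_ext I v)
      (S.smoothVec_φ hw)
    rw [← S.curvature_apply u v hw] at h1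
    rw [← S.curvature_apply u v (S.smoothVec_φ hw), S.curvField_minConn_φ (smoothVec_ext I u)
      (smoothVec_ext I v) hw, ← h1] at h2
    simp only [ext_self] at h2
    exact h2

end AlmostContactMetric

end Curvature

section Identification

variable {E : Type*} [NormedAddCommGroup E] [NormedSpace ℝ E] [FiniteDimensional ℝ E]
  {H : Type*} [TopologicalSpace H] {I : ModelWithCorners ℝ E H}
  {M : Type*} [TopologicalSpace M] [ChartedSpace H M] [IsManifold I ∞ M]
  [RiemannianBundle (fun x : M ↦ TangentSpace I x)]
  [IsContMDiffRiemannianBundle I ∞ E (fun x : M ↦ TangentSpace I x)]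
  {x : M} {f : M → ℝ} {σ τ Θ : Π y : M, TangentSpace I y}

/-- The exterior derivative of a one-form in terms of the Levi-Civita connection. -/
theorem extDeriv1_inner (hΘ : MDiffAt (T% Θ) x) (u v : TangentSpace I x) :
    extDeriv1 I (fun y w ↦ ⟪Θ y, w⟫) x u v =
      ⟪leviCivita I M Θ x u, v⟫ - ⟪leviCivita I M Θ x v, u⟫ := by
  have hu := mdiffAt_ext I u
  have hv := mdiffAt_ext I v
  have h := leviCivita_sub_eq_mlieBracket hu hv
  rw [extDeriv1, mvfderiv_inner hΘ hv, mvfderiv_inner hΘ hu, ← h, inner_sub_right]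
  simp only [ext_self]
  ring

theorem mdiffAt_add (hσ : MDiffAt (T% σ) x) (hτ : MDiffAt (T% τ) x) :
    MDiffAt (T% (fun y ↦ σ y + τ y)) x := mdifferentiableAt_add_section hσ hτ

theorem mdiffAt_sub (hσ : MDiffAt (T% σ) x) (hτ : MDiffAt (T% τ) x) :
    MDiffAt (T% (fun y ↦ σ y - τ y)) x := mdifferentiableAt_sub_section hσ hτ

namespace AlmostContactMetric

variable (S : AlmostContactMetric I M) {n : ℕ}

/-! ### Traces and codifferentials -/

theorem codiffξ_eq (v : TangentSpace I x) :
    S.codiffξ x v = codiff (S.ξL x) (S.covξL x) v := by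
  have h1 : ∀ e, covTensor I (fun σ y w ↦ leviCivita I M σ y w) S.ξ x e e v =
      S.covξL x e e v + S.ξL x (S.ξL x e e) v := fun e ↦ by
    have h2 : S.covξL x e e v = covTensor I S.minConn S.ξ x e e v := rfl
    rw [h2]
    simp only [covTensor, ← ξL_apply, minConn_eq, map_add, LinearMap.add_apply, ext_self]
    abel
  have h3 : basisSum (fun e ↦ S.ξL x (S.ξL x e e) v) = S.ξL x (basisSum fun e ↦ S.ξL x e e) v :=
    (map_basisSum ((S.ξL x).flip v) _).symm
  rw [codiffξ, basisSum_congr h1, basisSum_add, codiff, h3]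
  abel

theorem isHarmonic_iff : S.IsHarmonic ↔
    ∀ (x : M) (v : TangentSpace I x), codiff (S.ξL x) (S.covξL x) v = 0 := by
  simp only [IsHarmonic, codiffξ_eq]

theorem nablaζ_eq (u : TangentSpace I x) : leviCivita I M S.ζ x u = - S.ξL x u (S.ζ x) := by
  rw [ξL_ζ, neg_neg]

theorem codiffη_eq (x : M) : S.codiffη x = reebTrace (S.ζ x) (S.ξL x) := by
  have h := (S.isACM x).basisSum_hor (B := fun u v ↦ ⟪S.ξL x u (S.ζ x), v⟫) (by
    constructor <;> intros <;>
      simp [inner_add_left, inner_add_right, real_inner_smul_left, real_inner_smul_right])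
  have hT := S.isTorsion_ξL x
  have h1 : ∀ e : TangentSpace I x, ⟪reebL (S.ζ x) (S.ξL x) e, e⟫ =
      ⟪S.ξL x (hor (S.ζ x) e) (S.ζ x), e⟫ := fun e ↦ by rw [reebL_apply, hT.hor_T_ζ]
  rw [reebTrace, basisSum_congr h1, h, codiffη, ← basisSum_neg]
  exact basisSum_congr fun e ↦ by
    rw [nablaη_eq, nablaζ_eq, inner_neg_left, neg_neg, ← inner_hor_left, hT.hor_T_ζ]

theorem nablaF_eq (u v w : TangentSpace I x) : S.nablaF x u v w = ⟪v, S.nablaφ x u w⟫ := by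
  have hv := mdiffAt_ext I v
  have hw := mdiffAt_ext I w
  have h := mvfderiv_inner hv (S.mdiffAt_φ hw) u
  rw [nablaF, nablaφ, inner_sub_right]
  simp only [fund, h, ext_self]
  ring

theorem codiffF_eq (w : TangentSpace I x) : S.codiffF x w =
    ⟪(2 : ℝ) • S.φ x (horTrace (S.ζ x) (S.ξL x)) + S.φ x (S.ξL x (S.ζ x) (S.ζ x))
      + reebTraceφ (S.φ x) (S.ζ x) (S.ξL x) • S.ζ x, w⟫ := by
  have h := S.isACM x
  have hT := S.isTorsion_ξL x
  have h1 : ∀ e : TangentSpace I x, S.nablaF x e e w =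
      ⟪S.ξL x e (S.φ x e), w⟫ + ⟪S.ξL x e e, S.φ x w⟫ := fun e ↦ by
    rw [nablaF_eq, ← φ_ξL_sub, inner_sub_right, hT.skew, hT.skew e e, h.inner_φ_left]
    ring
  rw [codiffF, basisSum_congr h1, basisSum_add, ← inner_basisSum, ← inner_basisSum,
    hT.basisSum_φ_self h, hT.basisSum_self h]
  simp only [inner_add_left, inner_sub_left, inner_neg_left, real_inner_smul_left,
    h.inner_φ_left, h.inner_ζ_φ]
  ring

theorem codiffF_ζ (x : M) : S.codiffF x (S.ζ x) = reebTraceφ (S.φ x) (S.ζ x) (S.ξL x) := by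
  have h := S.isACM x
  rw [codiffF_eq, inner_add_left, inner_add_left, real_inner_smul_left, h.inner_φ_left,
    h.inner_φ_left, h.φ_ζ, inner_zero_right, inner_zero_right, real_inner_smul_left, S.inner_ζ]
  ring

theorem lee_eq (n : ℕ) (x : M) : S.lee n x = traceVec n (S.ζ x) (S.ξL x · ·) := by
  have h := S.isACM x
  have hT := S.isTorsion_ξL x
  have h1 : sharp (S.codiffF x) = (2 : ℝ) • S.φ x (horTrace (S.ζ x) (S.ξL x))
      + S.φ x (S.ξL x (S.ζ x) (S.ζ x)) + reebTraceφ (S.φ x) (S.ζ x) (S.ξL x) • S.ζ x := by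
    refine ext_inner_right ℝ fun w ↦ ?_
    rw [inner_sharp, codiffF_eq]
    constructor <;> intros <;> simp only [codiffF_eq, inner_add_right, real_inner_smul_right,
      smul_eq_mul]
  rw [lee, h1, traceVec_eq, nablaζ_eq, map_add, map_add, map_smul, map_smul, h.φ_ζ, h.φ_φ_eq,
    h.φ_φ_eq, hT.hor_T_ζ, h.hor_of (inner_ζ_horTrace h _)]
  module

theorem hor_lee (n : ℕ) (x : M) : hor (S.ζ x) (S.lee n x) = S.lee n x := by
  rw [lee_eq, hor_traceVec (S.isACM x)]

/-! ### Covariant derivatives of the parts of the intrinsic torsion -/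

theorem mdiffAt_horTensor (hσ : MDiffAt (T% σ) x) (hτ : MDiffAt (T% τ) x) :
    MDiffAt (T% (fun y ↦ horTensor (S.ζ y) (S.ξL y) (σ y) (τ y))) x :=
  mdiffAt_congr (S.mdiffAt_hor (S.mdiffAt_ξL (S.mdiffAt_hor hσ) (S.mdiffAt_hor hτ)))
    (Filter.Eventually.of_forall fun _ ↦ horTensor_apply ..)

theorem minConn_horTensor (hσ : MDiffAt (T% σ) x) (hτ : MDiffAt (T% τ) x) (u : TangentSpace I x) :
    S.minConn (fun y ↦ horTensor (S.ζ y) (S.ξL y) (σ y) (τ y)) x u =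
      horTensor (S.ζ x) (S.covξL x u) (σ x) (τ x)
        + horTensor (S.ζ x) (S.ξL x) (S.minConn σ x u) (τ x)
        + horTensor (S.ζ x) (S.ξL x) (σ x) (S.minConn τ x u) := by
  have hσ' := S.mdiffAt_hor hσ
  have hτ' := S.mdiffAt_hor hτ
  simp only [horTensor_apply]
  rw [S.minConn_hor (S.mdiffAt_ξL hσ' hτ'), S.minConn_ξL hσ' hτ', S.minConn_hor hσ,
    S.minConn_hor hτ, hor_add, hor_add]

theorem minConn_reebL (hσ : MDiffAt (T% σ) x) (u : TangentSpace I x) :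
    S.minConn (fun y ↦ reebL (S.ζ y) (S.ξL y) (σ y)) x u =
      reebL (S.ζ x) (S.covξL x u) (σ x) + reebL (S.ζ x) (S.ξL x) (S.minConn σ x u) := by
  have hσ' := S.mdiffAt_hor hσ
  have hζ := S.mdiffAt_ζ x
  simp only [reebL_apply]
  rw [S.minConn_hor (S.mdiffAt_ξL hσ' hζ), S.minConn_ξL hσ' hζ, S.minConn_hor hσ, minConn_ζ,
    map_zero, add_zero, hor_add]

theorem mdiffAt_reebL (hσ : MDiffAt (T% σ) x) :
    MDiffAt (T% (fun y ↦ reebL (S.ζ y) (S.ξL y) (σ y))) x :=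
  mdiffAt_congr (S.mdiffAt_hor (S.mdiffAt_ξL (S.mdiffAt_hor hσ) (S.mdiffAt_ζ x)))
    (Filter.Eventually.of_forall fun _ ↦ reebL_apply ..)

theorem mdiffAt_alongL (hσ : MDiffAt (T% σ) x) :
    MDiffAt (T% (fun y ↦ alongL (S.ζ y) (S.ξL y) (σ y))) x :=
  mdiffAt_congr (S.mdiffAt_hor (S.mdiffAt_ξL (S.mdiffAt_ζ x) (S.mdiffAt_hor hσ)))
    (Filter.Eventually.of_forall fun _ ↦ alongL_apply ..)

theorem minConn_alongL (hσ : MDiffAt (T% σ) x) (u : TangentSpace I x) :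
    S.minConn (fun y ↦ alongL (S.ζ y) (S.ξL y) (σ y)) x u =
      alongL (S.ζ x) (S.covξL x u) (σ x) + alongL (S.ζ x) (S.ξL x) (S.minConn σ x u) := by
  have hσ' := S.mdiffAt_hor hσ
  have hζ := S.mdiffAt_ζ x
  simp only [alongL_apply]
  rw [S.minConn_hor (S.mdiffAt_ξL hζ hσ'), S.minConn_ξL hζ hσ', S.minConn_hor hσ, minConn_ζ,
    map_zero, LinearMap.zero_apply, add_zero, hor_add]

theorem mdiffAt_leePart (hΘ : MDiffAt (T% Θ) x) (hσ : MDiffAt (T% σ) x) (hτ : MDiffAt (T% τ) x)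
    (u : TangentSpace I x) :
    MDiffAt (T% (fun y ↦ leePart (S.φ y) (S.ζ y) (Θ y) (σ y) (τ y))) x ∧
    S.minConn (fun y ↦ leePart (S.φ y) (S.ζ y) (Θ y) (σ y) (τ y)) x u =
      leePart (S.φ x) (S.ζ x) (S.minConn Θ x u) (σ x) (τ x)
        + leePart (S.φ x) (S.ζ x) (Θ x) (S.minConn σ x u) (τ x)
        + leePart (S.φ x) (S.ζ x) (Θ x) (σ x) (S.minConn τ x u) := by
  have hs := S.mdiffAt_hor hσ
  have hφ := S.mdiffAt_φ hσ
  have hφΘ := S.mdiffAt_φ hΘ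
  have d1 : MDiffAt (T% (fun y ↦ ⟪hor (S.ζ y) (σ y), τ y⟫ • Θ y)) x :=
    (mdiffAt_inner hs hτ).smul_section hΘ
  have d2 : MDiffAt (T% (fun y ↦ ⟪Θ y, τ y⟫ • hor (S.ζ y) (σ y))) x :=
    (mdiffAt_inner hΘ hτ).smul_section hs
  have d3 : MDiffAt (T% (fun y ↦ ⟪S.φ y (σ y), τ y⟫ • S.φ y (Θ y))) x :=
    (mdiffAt_inner hφ hτ).smul_section hφΘ
  have d4 : MDiffAt (T% (fun y ↦ ⟪S.φ y (Θ y), τ y⟫ • S.φ y (σ y))) x :=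
    (mdiffAt_inner hφΘ hτ).smul_section hφ
  have d12 := mdiffAt_sub d1 d2
  have d123 := mdiffAt_sub d12 d3
  have d := mdiffAt_add d123 d4
  refine ⟨mdiffAt_const_smul _ d, ?_⟩
  simp only [leePart]
  rw [S.minConn_const_smul _ d]
  rw [S.minConn_add d123 d4, S.minConn_sub d12 d3, S.minConn_sub d1 d2,
    S.minConn_inner_smul hs hτ hΘ, S.minConn_inner_smul hΘ hτ hs,
    S.minConn_inner_smul hφ hτ hφΘ, S.minConn_inner_smul hφΘ hτ hφ, S.minConn_hor hσ,
    S.minConn_φ hσ, S.minConn_φ hΘ]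
  module

/-! ### The Lee form -/

theorem sum_skew_eq_zero {V ι : Type*} [NormedAddCommGroup V] [InnerProductSpace ℝ V] [Fintype ι]
    (b : OrthonormalBasis ι ℝ V) (T : V →ₗ[ℝ] V →ₗ[ℝ] V) {d : ι → V}
    (hd : ∀ i j, ⟪d i, b j⟫ = - ⟪b i, d j⟫) : ∑ i, (T (d i) (b i) + T (b i) (d i)) = 0 := by
  have h1 : ∑ i, T (d i) (b i) = ∑ i, ∑ j, ⟪b j, d i⟫ • T (b j) (b i) :=
    Finset.sum_congr rfl fun i _ ↦ by
      conv_lhs => rw [← b.sum_repr' (d i)]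
      simp only [map_sum, map_smul, LinearMap.sum_apply, LinearMap.smul_apply]
  have h2 : ∑ i, T (b i) (d i) = ∑ i, ∑ j, ⟪b j, d i⟫ • T (b i) (b j) :=
    Finset.sum_congr rfl fun i _ ↦ by
      conv_lhs => rw [← b.sum_repr' (d i)]
      simp only [map_sum, map_smul]
  rw [Finset.sum_add_distrib, h1, h2, Finset.sum_comm, ← Finset.sum_add_distrib]
  refine Finset.sum_eq_zero fun i _ ↦ ?_
  rw [← Finset.sum_add_distrib]
  refine Finset.sum_eq_zero fun j _ ↦ ?_
  rw [real_inner_comm (d i) (b j), hd]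
  module

theorem mdiffAt_horTrace (u : TangentSpace I x) :
    MDiffAt (T% (fun y ↦ horTrace (S.ζ y) (S.ξL y))) x ∧
    S.minConn (fun y ↦ horTrace (S.ζ y) (S.ξL y)) x u = horTrace (S.ζ x) (S.covξL x u) := by
  obtain ⟨e, he, hb⟩ := exists_orthonormalFrame I x
  have hd : ∀ i, MDiffAt (T% (e i)) x := fun i ↦ (he i).mdiffAt
  have hζ := S.mdiffAt_ζ x
  have ht : ∀ i, MDiffAt (T% (fun y ↦ S.ξL y (e i y) (e i y))) x :=
    fun i ↦ S.mdiffAt_ξL (hd i) (hd i)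
  have hs : MDiffAt (T% (fun y ↦ ∑ i, S.ξL y (e i y) (e i y))) x := .sum_section fun i _ ↦ ht i
  have hZ := S.mdiffAt_ξL hζ hζ
  have hbil : ∀ T : TangentSpace I x →ₗ[ℝ] TangentSpace I x →ₗ[ℝ] TangentSpace I x,
      IsBilinearMap ℝ fun u v ↦ T u v := fun T ↦ by constructor <;> intros <;> simp
  have hh : ∀ᶠ y in 𝓝 x, horTrace (S.ζ y) (S.ξL y) =
      hor (S.ζ y) (∑ i, S.ξL y (e i y) (e i y)) - S.ξL y (S.ζ y) (S.ζ y) := by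
    filter_upwards [hb] with y ⟨b, hby⟩
    have h := S.isACM y
    have hT := S.isTorsion_ξL y
    have h1 := hT.basisSum_self h
    rw [basisSum_eq_sum b (by constructor <;> intros <;> simp)] at h1
    simp only [hby] at h1
    rw [h1, hor_add, hor_sub, hor_smul, h.hor_ζ, hT.hor_T_ζ, h.hor_of (inner_ζ_horTrace h _)]
    module
  have hm := mdiffAt_sub (S.mdiffAt_hor hs) hZ
  refine ⟨mdiffAt_congr hm hh, ?_⟩
  rw [S.minConn_congr hm hh]
  have h1 := S.minConn_sub (S.mdiffAt_hor hs) hZ u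
  obtain ⟨b, hbx⟩ := hb.self_of_nhds
  have h2 : ∑ i, (S.ξL x (S.minConn (e i) x u) (e i x) + S.ξL x (e i x) (S.minConn (e i) x u))
      = 0 := by
    simp only [← hbx]
    refine sum_skew_eq_zero b _ fun i j ↦ ?_
    have h3 := S.mvfderiv_inner_minConn (hd i) (hd j) u
    have h4 : (fun y ↦ ⟪e i y, e j y⟫) =ᶠ[𝓝 x] fun _ ↦ ⟪e i x, e j x⟫ := by
      filter_upwards [hb] with y ⟨b', hb'⟩
      simp only [← hb', ← hbx, orthonormal_iff_ite.1 b'.orthonormal,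
        orthonormal_iff_ite.1 b.orthonormal]
    rw [mvfderiv_congr h4, mvfderiv_const] at h3
    simp only [hbx]
    have h5 : (0 : ℝ) = _ := h3
    linarith
  have hT := S.isTorsion_covξL x u
  have h := S.isACM x
  have h6 := hT.basisSum_self h
  rw [basisSum_eq_sum b (hbil _)] at h6
  simp only [hbx] at h6
  refine Eq.trans h1 ?_
  rw [S.minConn_hor hs, S.minConn_sum _ ht, S.minConn_ξL hζ hζ]
  simp only [fun i ↦ S.minConn_ξL (hd i) (hd i) u, add_assoc]
  rw [Finset.sum_add_distrib, h2, h6, minConn_ζ, hor_add, hor_add, hor_sub, hor_smul, h.hor_ζ,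
    hT.hor_T_ζ, h.hor_of (inner_ζ_horTrace h _)]
  simp

theorem mdiffAt_lee (n : ℕ) (x : M) : MDiffAt (T% (S.lee n)) x := by
  have h1 : S.lee n = fun y ↦ (2 / ((n : ℝ) - 1)) • horTrace (S.ζ y) (S.ξL y) := by
    funext y; rw [lee_eq, traceVec_eq]
  rw [h1]
  exact mdiffAt_const_smul _ (S.mdiffAt_horTrace 0).1

/-- The derivative of the Lee vector field for the minimal connection. -/
def covLee (n : ℕ) (x : M) : TangentSpace I x →ₗ[ℝ] TangentSpace I x where
  toFun u := S.minConn (S.lee n) x u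
  map_add' := S.minConn_add_right
  map_smul' := S.minConn_smul_right

theorem covLee_apply (n : ℕ) (u : TangentSpace I x) :
    S.covLee n x u = S.minConn (S.lee n) x u := rfl

theorem covLee_eq (n : ℕ) (u : TangentSpace I x) :
    S.covLee n x u = traceVec n (S.ζ x) (S.covξL x u · ·) := by
  have h1 : S.lee n = fun y ↦ (2 / ((n : ℝ) - 1)) • horTrace (S.ζ y) (S.ξL y) := by
    funext y; rw [lee_eq, traceVec_eq]
  have h2 := S.mdiffAt_horTrace u
  rw [covLee_apply, h1, S.minConn_const_smul _ h2.1, h2.2, traceVec_eq]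

theorem hor_covLee (n : ℕ) (u : TangentSpace I x) :
    hor (S.ζ x) (S.covLee n x u) = S.covLee n x u := by
  rw [covLee_eq, hor_traceVec (S.isACM x)]

theorem extDeriv1_θ (n : ℕ) (x : M) : extDeriv1 I (S.θ n) x = fun u v ↦
    ⟪S.covLee n x u - S.ξL x u (S.lee n x), v⟫ - ⟪S.covLee n x v - S.ξL x v (S.lee n x), u⟫ := by
  funext u v
  simp only [covLee_apply, minConn_eq, add_sub_cancel_right]
  exact extDeriv1_inner (S.mdiffAt_lee n x) u v

/-! ### The remaining terms -/

theorem ξζη_eq (x : M) (v : TangentSpace I x) : S.ξζη x v = ⟪S.ξL x (S.ζ x) (S.ζ x), v⟫ := by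
  rw [(S.isTorsion_ξL x).skew]; rfl

theorem dξζη_eq (x : M) : S.dξζη x = S.covξL x (S.ζ x) (S.ζ x) (S.ζ x)
    - alongL (S.ζ x) (S.ξL x) (S.ξL x (S.ζ x) (S.ζ x))
    - LinearMap.adjoint (reebL (S.ζ x) (S.ξL x)) (S.ξL x (S.ζ x) (S.ζ x)) := by
  have h := S.isACM x
  have hT := S.isTorsion_ξL x
  have hζ := S.mdiffAt_ζ x
  have h1 : ∀ u v, extDeriv1 I S.ξζη x u v =
      ⟪S.covξL x u (S.ζ x) (S.ζ x) - S.ξL x u (S.ξL x (S.ζ x) (S.ζ x)), v⟫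
      - ⟪S.covξL x v (S.ζ x) (S.ζ x) - S.ξL x v (S.ξL x (S.ζ x) (S.ζ x)), u⟫ := fun u v ↦ by
    have h2 : S.ξζη = fun y w ↦ ⟪S.ξL y (S.ζ y) (S.ζ y), w⟫ := by
      funext y w; exact S.ξζη_eq y w
    have h3 : ∀ u, leviCivita I M (fun y ↦ S.ξL y (S.ζ y) (S.ζ y)) x u =
        S.covξL x u (S.ζ x) (S.ζ x) - S.ξL x u (S.ξL x (S.ζ x) (S.ζ x)) := fun u ↦ by
      have h4 := S.minConn_ξL hζ hζ u
      rw [minConn_ζ, map_zero, map_zero, LinearMap.zero_apply, add_zero, add_zero,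
        minConn_eq] at h4
      rw [← h4, add_sub_cancel_right]
    rw [h2, extDeriv1_inner (S.mdiffAt_ξL hζ hζ), h3, h3]
  refine ext_inner_right ℝ fun v ↦ ?_
  rw [dξζη, inner_sharp, h1]
  · have h5 := (S.isTorsion_covξL x v).inner_T_ζ_ζ (S.ζ x)
    have h6 := hT.skew v (S.ξL x (S.ζ x) (S.ζ x)) (S.ζ x)
    have h7 := hT.skew (S.ζ x) (S.ξL x (S.ζ x) (S.ζ x)) (S.ζ x)
    have h8 := congrArg (⟪S.ξL x (S.ζ x) (S.ζ x), ·⟫) (hT.apply_eq h v (S.ζ x))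
    have h9 := congrArg (⟪·, v⟫) (hT.apply_eq h (S.ζ x) (S.ξL x (S.ζ x) (S.ζ x)))
    simp only [inner_add_left, inner_sub_left, inner_add_right, inner_sub_right,
      real_inner_smul_left, real_inner_smul_right, horTensor_ζ_left h, horTensor_ζ_right h,
      inner_zero_left, inner_zero_right, S.inner_ζ, hT.inner_T_ζ_ζ, hT.inner_ζ_T_ζ, reebL_ζ h,
      alongL_ζ h] at h8 h9
    simp only [inner_sub_left, LinearMap.adjoint_inner_left]
    rw [h5, h6, h8, h9]
    ring
  · constructor <;> intros <;> simp only [h1, map_add, map_smul, LinearMap.add_apply,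
      LinearMap.smul_apply, inner_add_left, inner_add_right, inner_sub_left,
      real_inner_smul_left, real_inner_smul_right, smul_eq_mul] <;> ring

theorem ξc11_eq (n : ℕ) (u v : TangentSpace I x) :
    S.ξc n 11 x u v = ⟪S.ζ x, u⟫ • alongL (S.ζ x) (S.ξL x) v := rfl

theorem ξc11_ζ (n : ℕ) (v : TangentSpace I x) :
    S.ξc n 11 x (S.ζ x) v = alongL (S.ζ x) (S.ξL x) v := by
  rw [ξc11_eq, S.inner_ζ, one_smul]

theorem ξc12_ζ (n : ℕ) (x : M) :
    S.ξc n 12 x (S.ζ x) (S.ζ x) = S.ξL x (S.ζ x) (S.ζ x) := by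
  have hT := S.isTorsion_ξL x
  change ⟪S.ζ x, S.ζ x⟫ • lift (S.ζ x) (fun _ ↦ hor (S.ζ x) (S.ξL x (S.ζ x) (S.ζ x))) (S.ζ x)
    (S.ζ x) = _
  rw [hT.hor_T_ζ, S.inner_ζ, one_smul, lift, S.inner_ζ, hT.inner_T_ζ_ζ]
  module

theorem nablaξ11_eq (n : ℕ) (X : TangentSpace I x) :
    S.nablaξ11 n x X = alongL (S.ζ x) (S.covξL x (S.ζ x)) X := by
  have hζ := S.mdiffAt_ζ x
  have hz := mdiffAt_ext I (S.ζ x)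
  have hX := mdiffAt_ext I X
  rw [nablaξ11, covTensor]
  simp only [ξc11_eq]
  rw [S.minConn_inner_smul hζ hz (S.mdiffAt_alongL hX), S.minConn_alongL hX, minConn_ζ]
  simp only [ext_self, S.inner_ζ, inner_zero_left]
  module

theorem wedgeTerm_eq (n : ℕ) (X Y : TangentSpace I x) : S.wedgeTerm n x X Y =
    ⟪leePart (S.φ x) (S.ζ x) (S.lee n x) (S.ξL x (S.ζ x) (S.ζ x)) X, Y⟫ := by
  have h := S.isACM x
  rw [inner_leePart_right, (S.isTorsion_ξL x).hor_T_ζ]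
  simp only [wedgeTerm, wedge, actφ, ξζη_eq, θ, h.inner_φ_left]
  ring

end AlmostContactMetric

end Identification

section Harmonicity

variable {E : Type*} [NormedAddCommGroup E] [NormedSpace ℝ E] [FiniteDimensional ℝ E]
  {H : Type*} [TopologicalSpace H] {I : ModelWithCorners ℝ E H}
  {M : Type*} [TopologicalSpace M] [ChartedSpace H M] [IsManifold I ∞ M]
  [RiemannianBundle (fun x : M ↦ TangentSpace I x)]
  [IsContMDiffRiemannianBundle I ∞ E (fun x : M ↦ TangentSpace I x)]
  {x : M} {n : ℕ}

namespace AlmostContactMetric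

variable (S : AlmostContactMetric I M)

/-! ### Derivatives of pointwise identities -/

theorem covξL_anti (hK : ∀ (y : M) (u v : TangentSpace I y), horTensor (S.ζ y) (S.ξL y) u v
      + horTensor (S.ζ y) (S.ξL y) (S.φ y u) (S.φ y v)
      = (2 : ℝ) • leePart (S.φ y) (S.ζ y) (S.lee n y) u v) (w u v : TangentSpace I x) :
    horTensor (S.ζ x) (S.covξL x w) u v + horTensor (S.ζ x) (S.covξL x w) (S.φ x u) (S.φ x v)
      = (2 : ℝ) • leePart (S.φ x) (S.ζ x) (S.covLee n x w) u v := by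
  have hu := mdiffAt_ext I u
  have hv := mdiffAt_ext I v
  have hl := S.mdiffAt_leePart (S.mdiffAt_lee n x) hu hv w
  have h1 := S.minConn_add (S.mdiffAt_horTensor hu hv)
    (S.mdiffAt_horTensor (S.mdiffAt_φ hu) (S.mdiffAt_φ hv)) w
  have h2 := S.minConn_const_smul (2 : ℝ) hl.1 w
  have h3 : (fun y ↦ horTensor (S.ζ y) (S.ξL y) (ext I u y) (ext I v y)
      + horTensor (S.ζ y) (S.ξL y) (S.φ y (ext I u y)) (S.φ y (ext I v y)))
      = fun y ↦ (2 : ℝ) • leePart (S.φ y) (S.ζ y) (S.lee n y) (ext I u y) (ext I v y) := by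
    funext y; exact hK y _ _
  rw [h3, h2, hl.2, S.minConn_horTensor hu hv,
    S.minConn_horTensor (S.mdiffAt_φ hu) (S.mdiffAt_φ hv), S.minConn_φ hu, S.minConn_φ hv] at h1
  simp only [ext_self] at h1
  rw [covLee_apply]
  linear_combination (norm := module) -h1 - hK x (S.minConn (ext I u) x w) v
    - hK x u (S.minConn (ext I v) x w)

theorem covξL_comm (hK : ∀ (y : M) (u v : TangentSpace I y),
      horTensor (S.ζ y) (S.ξL y) (S.φ y u) (S.φ y v) = horTensor (S.ζ y) (S.ξL y) u v)
    (w u v : TangentSpace I x) :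
    horTensor (S.ζ x) (S.covξL x w) (S.φ x u) (S.φ x v) = horTensor (S.ζ x) (S.covξL x w) u v := by
  have hu := mdiffAt_ext I u
  have hv := mdiffAt_ext I v
  have h1 := S.minConn_horTensor (S.mdiffAt_φ hu) (S.mdiffAt_φ hv) w
  have h3 : (fun y ↦ horTensor (S.ζ y) (S.ξL y) (S.φ y (ext I u y)) (S.φ y (ext I v y)))
      = fun y ↦ horTensor (S.ζ y) (S.ξL y) (ext I u y) (ext I v y) := by
    funext y; exact hK y _ _
  rw [h3, S.minConn_horTensor hu hv, S.minConn_φ hu, S.minConn_φ hv] at h1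
  simp only [ext_self, hK] at h1
  linear_combination (norm := module) -h1

theorem reebL_covξL (ε : ℝ) (hL : ∀ (y : M) (u : TangentSpace I y),
      reebL (S.ζ y) (S.ξL y) (S.φ y u) = ε • S.φ y (reebL (S.ζ y) (S.ξL y) u))
    (w u : TangentSpace I x) :
    reebL (S.ζ x) (S.covξL x w) (S.φ x u) = ε • S.φ x (reebL (S.ζ x) (S.covξL x w) u) := by
  have hu := mdiffAt_ext I u
  have h1 := S.minConn_reebL (S.mdiffAt_φ hu) w
  have h3 : (fun y ↦ reebL (S.ζ y) (S.ξL y) (S.φ y (ext I u y)))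
      = fun y ↦ ε • S.φ y (reebL (S.ζ y) (S.ξL y) (ext I u y)) := by
    funext y; exact hL y _
  rw [h3, S.minConn_const_smul _ (S.mdiffAt_φ (S.mdiffAt_reebL hu)),
    S.minConn_φ (S.mdiffAt_reebL hu), S.minConn_reebL hu, S.minConn_φ hu] at h1
  simp only [ext_self, hL, map_add, smul_add] at h1
  linear_combination (norm := module) -h1

/-! ### The components applied to the Reeb vector field -/

section ReebComponents

variable (hL : ∀ u, reebL (S.ζ x) (S.ξL x) (S.φ x u) = S.φ x (reebL (S.ζ x) (S.ξL x) u))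
  (hL' : ∀ u, reebL (S.ζ x) (S.ξL x) (S.φ x u) = - S.φ x (reebL (S.ζ x) (S.ξL x) u))

include hL in
theorem hor_reeb7 (u : TangentSpace I x) :
    hor (S.ζ x) (reeb7 n (S.φ x) (S.ζ x) (S.ξL x · ·) u)
      = reeb7 n (S.φ x) (S.ζ x) (S.ξL x · ·) u := by
  have h := S.isACM x
  rw [reeb7_eq h hL, hor_sub, hor_smul, hor_sub, hor_smul, h.hor_φ, hor_reebL h,
    hor_adjoint_reebL h]

include hL in
theorem ξc7_ζ (u : TangentSpace I x) :
    S.ξc n 7 x u (S.ζ x) = reeb7 n (S.φ x) (S.ζ x) (S.ξL x · ·) u :=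
  lift_ζ_right (S.inner_ζ x) (S.hor_reeb7 hL u)

include hL in
theorem ξc8_ζ (u : TangentSpace I x) :
    S.ξc n 8 x u (S.ζ x) = reeb8 n (S.φ x) (S.ζ x) (S.ξL x · ·) u := by
  have h := S.isACM x
  refine lift_ζ_right (S.inner_ζ x) ?_
  change hor _ (reeb8 n (S.φ x) (S.ζ x) (S.ξL x · ·) u) = reeb8 n (S.φ x) (S.ζ x) (S.ξL x · ·) u
  rw [reeb8_eq h hL, hor_sub, hor_smul, hor_add, hor_smul, h.hor_hor, hor_reebL h,
    hor_adjoint_reebL h]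

include hL' in
theorem ξc9_ζ (u : TangentSpace I x) :
    S.ξc n 9 x u (S.ζ x) = reeb9 (S.φ x) (S.ζ x) (S.ξL x · ·) u := by
  have h := S.isACM x
  refine lift_ζ_right (S.inner_ζ x) ?_
  change hor _ (reeb9 (S.φ x) (S.ζ x) (S.ξL x · ·) u) = reeb9 (S.φ x) (S.ζ x) (S.ξL x · ·) u
  rw [reeb9_eq h hL', hor_smul, hor_add, hor_reebL h, hor_adjoint_reebL h]

include hL' in
theorem ξc10_ζ (u : TangentSpace I x) :
    S.ξc n 10 x u (S.ζ x) = reeb10 (S.φ x) (S.ζ x) (S.ξL x · ·) u := by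
  have h := S.isACM x
  refine lift_ζ_right (S.inner_ζ x) ?_
  change hor _ (reeb10 (S.φ x) (S.ζ x) (S.ξL x · ·) u) = reeb10 (S.φ x) (S.ζ x) (S.ξL x · ·) u
  rw [reeb10_eq h hL', hor_smul, hor_sub, hor_reebL h, hor_adjoint_reebL h]

include hL in
theorem ξcη7_eq (u v : TangentSpace I x) :
    S.ξcη n 7 x u v = ⟪reeb7 n (S.φ x) (S.ζ x) (S.ξL x · ·) u, v⟫ := by
  change - ⟪S.ζ x, ⟪S.ζ x, v⟫ • reeb7 n (S.φ x) (S.ζ x) (S.ξL x · ·) u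
    - ⟪reeb7 n (S.φ x) (S.ζ x) (S.ξL x · ·) u, v⟫ • S.ζ x⟫ = _
  rw [← S.hor_reeb7 hL, inner_sub_right, real_inner_smul_right, real_inner_smul_right,
    (S.isACM x).inner_ζ_hor, S.inner_ζ]
  ring

end ReebComponents

theorem ξζζ_eq (x : M) : S.ξζζ x = S.ξL x (S.ζ x) (S.ζ x) := rfl

theorem ricStarAlt_eq (u v : TangentSpace I x) : S.ricStarAlt x u v =
    (1 / 2 : ℝ) * (starRicci (S.φ x) (S.curvL x) u v - starRicci (S.φ x) (S.curvL x) v u) := rfl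

theorem ricStarζ_eq (x : M) :
    S.ricStarζ x = sharp (starRicci (S.φ x) (S.curvL x) (S.ζ x)) := rfl

theorem isHarmonic_iff_of_eq {a b : Π x : M, TangentSpace I x → TangentSpace I x → ℝ}
    {p q : Π x : M, TangentSpace I x} {c d : ℝ} (hc : c ≠ 0) (hd : d ≠ 0)
    (h1 : ∀ (x : M) (X Y : TangentSpace I x), a x X Y =
      c * ⟪hor (S.ζ x) (codiff (S.ξL x) (S.covξL x) (hor (S.ζ x) X)), Y⟫ + b x X Y)
    (h2 : ∀ x : M, p x = d • codiff (S.ξL x) (S.covξL x) (S.ζ x) + q x) :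
    S.IsHarmonic ↔ (∀ (x : M) (X Y : TangentSpace I x), a x X Y = b x X Y) ∧
      ∀ x : M, p x = q x := by
  simp only [isHarmonic_iff, fun x ↦ (S.isPointData x).codiff_eq_zero_iff, forall_and, h1, h2,
    add_eq_right, mul_eq_zero, smul_eq_zero, hc, hd, false_or]

end AlmostContactMetric

end Harmonicity

section Characterization

variable {E : Type*} [NormedAddCommGroup E] [NormedSpace ℝ E] [FiniteDimensional ℝ E]
  {H : Type*} [TopologicalSpace H] {I : ModelWithCorners ℝ E H}
  {M : Type*} [TopologicalSpace M] [ChartedSpace H M] [IsManifold I ∞ M]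
  [RiemannianBundle (fun x : M ↦ TangentSpace I x)]
  [IsContMDiffRiemannianBundle I ∞ E (fun x : M ↦ TangentSpace I x)]
  {n : ℕ}

namespace AlmostContactMetric

variable (S : AlmostContactMetric I M)

theorem horTrace_ξL (hn : 1 ≤ n) (hd : Module.finrank ℝ E = 2 * n + 1) (x : M) :
    horTrace (S.ζ x) (S.ξL x) = (((n : ℝ) - 1) / 2) • S.lee n x := by
  rw [lee_eq]
  exact horTrace_eq (S.isACM x) (S.isTorsion_ξL x) hn hd

theorem horTrace_covξL (hn : 1 ≤ n) (hd : Module.finrank ℝ E = 2 * n + 1) (x : M)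
    (w : TangentSpace I x) :
    (2 : ℝ) • basisSum (fun e ↦ horTensor (S.ζ x) (S.covξL x w) e e)
      = ((n : ℝ) - 1) • S.covLee n x w := by
  have h := horTrace_eq (S.isACM x) (S.isTorsion_covξL x w) hn hd
  rw [← covLee_eq] at h
  rw [← horTrace, h]
  module

/-! ### The skew-symmetric part of `Ric^*` -/

theorem ricStarAlt_of_anti (hn : 1 ≤ n) (hd : Module.finrank ℝ E = 2 * n + 1) {ε : ℝ}
    (hεε : ε * ε = 1)
    (hL : ∀ (y : M) (u : TangentSpace I y),
      reebL (S.ζ y) (S.ξL y) (S.φ y u) = ε • S.φ y (reebL (S.ζ y) (S.ξL y) u))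
    (hK : ∀ (y : M) (u v : TangentSpace I y), horTensor (S.ζ y) (S.ξL y) u v
      + horTensor (S.ζ y) (S.ξL y) (S.φ y u) (S.φ y v)
      = (2 : ℝ) • leePart (S.φ y) (S.ζ y) (S.lee n y) u v) (x : M) (X Y : TangentSpace I x) :
    S.ricStarAlt x (hor (S.ζ x) X) (hor (S.ζ x) Y) =
      1 * ⟪hor (S.ζ x) (codiff (S.ξL x) (S.covξL x) (hor (S.ζ x) X)), Y⟫
      + (lambda20 (S.φ x) (extDeriv1 I (S.θ n) x) X Y
        + ((n : ℝ) - 3) * ⟪S.ξc n 1 x (S.lee n x) X, Y⟫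
        + (n : ℝ) * ⟪S.ξc n 2 x (S.lee n x) X, Y⟫
        - S.codiffη x * ⟪S.ξc n 11 x (S.ζ x) X, Y⟫
        - S.codiffF x (S.ζ x) * ⟪S.ξc n 11 x (S.ζ x) (S.φ x X), Y⟫
        + ⟪S.nablaξ11 n x X, Y⟫
        + ⟪S.ξc n 1 x (S.ξc n 12 x (S.ζ x) (S.ζ x)) X, Y⟫
        + ⟪S.ξc n 2 x (S.ξc n 12 x (S.ζ x) (S.ζ x)) X, Y⟫
        + S.wedgeTerm n x X Y) := by
  have h := (S.isPointData x).starRicci_alt_of_anti hεε (hL x) (S.hor_lee n x)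
    (S.horTrace_ξL hn hd x) (hK x) (S.covLee n x) (S.hor_covLee n) (S.covξL_anti hK) X Y
  rw [ricStarAlt_eq, h, extDeriv1_θ, codiffη_eq, codiffF_ζ, ξc11_ζ, ξc11_ζ, nablaξ11_eq, ξc12_ζ,
    wedgeTerm_eq]
  change _ = _ + (_ + _ * ⟪comp1 (S.φ x) (S.ζ x) (S.ξL x · ·) _ _, _⟫
    + _ * ⟪comp2 (S.φ x) (S.ζ x) (S.ξL x · ·) _ _, _⟫ - _ - _ + _
    + ⟪comp1 (S.φ x) (S.ζ x) (S.ξL x · ·) _ _, _⟫ + ⟪comp2 (S.φ x) (S.ζ x) (S.ξL x · ·) _ _, _⟫ + _)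
  ring

theorem ricStarAlt_of_comm (hn : 1 ≤ n) (hd : Module.finrank ℝ E = 2 * n + 1) {ε : ℝ}
    (hεε : ε * ε = 1)
    (hL : ∀ (y : M) (u : TangentSpace I y),
      reebL (S.ζ y) (S.ξL y) (S.φ y u) = ε • S.φ y (reebL (S.ζ y) (S.ξL y) u))
    (hK : ∀ (y : M) (u v : TangentSpace I y),
      horTensor (S.ζ y) (S.ξL y) (S.φ y u) (S.φ y v) = horTensor (S.ζ y) (S.ξL y) u v)
    (x : M) (X Y : TangentSpace I x) :
    S.ricStarAlt x (hor (S.ζ x) X) (hor (S.ζ x) Y) =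
      (-1) * ⟪hor (S.ζ x) (codiff (S.ξL x) (S.covξL x) (hor (S.ζ x) X)), Y⟫
      + (- (((n : ℝ) - 1) * ⟪S.ξc n 3 x (S.lee n x) X, Y⟫)
        - ⟪S.nablaξ11 n x X, Y⟫
        - ⟪S.ξc n 3 x (S.ξζζ x) X, Y⟫
        - S.wedgeTerm n x X Y
        + S.codiffη x * ⟪S.ξc n 11 x (S.ζ x) X, Y⟫
        - S.codiffF x (S.ζ x) * ⟪S.ξc n 11 x (S.ζ x) (S.φ x X), Y⟫) := by
  have h := (S.isPointData x).starRicci_alt_of_comm hεε (hL x) (S.hor_lee n x)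
    (S.horTrace_ξL hn hd x) (S.lee_eq n x) (hK x) (S.covξL_comm hK) X Y
  rw [ricStarAlt_eq, h, codiffη_eq, codiffF_ζ, ξc11_ζ, ξc11_ζ, nablaξ11_eq, ξζζ_eq,
    wedgeTerm_eq]
  change _ = _ + (-(_ * ⟪comp3 n (S.φ x) (S.ζ x) (S.ξL x · ·) _ _, _⟫) - _
    - ⟪comp3 n (S.φ x) (S.ζ x) (S.ξL x · ·) _ _, _⟫ - _ + _ - _)
  ring

theorem ricStarAlt_of_comm_of_symm (hn : 1 ≤ n) (hd : Module.finrank ℝ E = 2 * n + 1) {ε : ℝ}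
    (hεε : ε * ε = 1)
    (hL : ∀ (y : M) (u : TangentSpace I y),
      reebL (S.ζ y) (S.ξL y) (S.φ y u) = ε • S.φ y (reebL (S.ζ y) (S.ξL y) u))
    (hK : ∀ (y : M) (u v : TangentSpace I y),
      horTensor (S.ζ y) (S.ξL y) (S.φ y u) (S.φ y v) = horTensor (S.ζ y) (S.ξL y) u v)
    (x : M) (X Y : TangentSpace I x) :
    S.ricStarAlt x (hor (S.ζ x) X) (hor (S.ζ x) Y) =
      ((n : ℝ) - 1) / 2 * lambda20 (S.φ x) (extDeriv1 I (S.θ n) x) X Y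
      - (1 + ε) / 2 * (⟪alongL (S.ζ x) (S.ξL x) (reebL (S.ζ x) (S.ξL x) X
          - LinearMap.adjoint (reebL (S.ζ x) (S.ξL x)) X), Y⟫
        - ⟪alongL (S.ζ x) (S.ξL x) (reebL (S.ζ x) (S.ξL x) Y
          - LinearMap.adjoint (reebL (S.ζ x) (S.ξL x)) Y), X⟫) := by
  rw [ricStarAlt_eq, extDeriv1_θ]
  exact (S.isPointData x).starRicci_alt_of_comm_of_symm hεε (hL x) (S.hor_lee n x) (hK x)
    (S.covξL_comm hK) (S.covLee n x) (S.hor_covLee n) (S.horTrace_covξL hn hd x) X Y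

/-! ### The vector `Ric^*(ζ)` -/

theorem ricStarζ_of_comm (hn : 1 ≤ n) (hd : Module.finrank ℝ E = 2 * n + 1)
    (hL : ∀ (y : M) (u : TangentSpace I y),
      reebL (S.ζ y) (S.ξL y) (S.φ y u) = S.φ y (reebL (S.ζ y) (S.ξL y) u)) (x : M)
    {Q : TangentSpace I x}
    (hQ : basisSum (fun e ↦ horTensor (S.ζ x) (S.ξL x) e (reebL (S.ζ x) (S.ξL x) e)) =
      (1 / 4 : ℝ) • (reebTrace (S.ζ x) (S.ξL x) • S.lee n x
        - (2 : ℝ) • LinearMap.adjoint (reebL (S.ζ x) (S.ξL x)) (S.lee n x)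
        - reebTraceφ (S.φ x) (S.ζ x) (S.ξL x) • S.φ x (S.lee n x)) + Q) :
    S.ricStarζ x = (-1 : ℝ) • codiff (S.ξL x) (S.covξL x) (S.ζ x) +
      (- S.dξζη x + Q
        - (((n : ℝ) - 1) / (4 * n) * S.codiffη x) • S.lee n x
        - ((2 * (n : ℝ) - 1) / 2) • S.ξc n 8 x (S.lee n x) (S.ζ x)
        - (3 * ((n : ℝ) - 1) / (4 * n) * S.codiffF x (S.ζ x)) • S.φ x (S.lee n x)
        - ((2 * (n : ℝ) - 3) / 2) • S.ξc n 7 x (S.lee n x) (S.ζ x)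
        + (((n : ℝ) - 1) / n * S.codiffη x) • S.ξζζ x
        - (2 : ℝ) • S.ξc n 8 x (S.ξζζ x) (S.ζ x)
        + S.codiffF x (S.ζ x) • S.φ x (S.ξζζ x)
        - S.ξc n 11 x (S.ζ x) (S.ξc n 12 x (S.ζ x) (S.ζ x))) := by
  have hA : ∀ w u, reebL (S.ζ x) (S.covξL x w) (S.φ x u)
      = S.φ x (reebL (S.ζ x) (S.covξL x w) u) := fun w u ↦ by
    have := S.reebL_covξL 1 (fun y u ↦ by rw [hL, one_smul]) w u
    rwa [one_smul] at this
  have h := (S.isPointData x).starRicci_ζ_eq_of_comm hn (S.hor_lee n x) (S.horTrace_ξL hn hd x) (hL x) hA hQ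
  rw [ricStarζ_eq, h, codiffη_eq, codiffF_ζ, ξc11_ζ, ξc12_ζ, ξζζ_eq, S.ξc7_ζ (hL x),
    S.ξc8_ζ (hL x), S.ξc8_ζ (hL x), dξζη_eq, neg_one_smul]

theorem ricStarζ_of_anti (hn : 1 ≤ n) (hd : Module.finrank ℝ E = 2 * n + 1)
    (hL : ∀ (y : M) (u : TangentSpace I y),
      reebL (S.ζ y) (S.ξL y) (S.φ y u) = - S.φ y (reebL (S.ζ y) (S.ξL y) u)) (x : M)
    {Q : TangentSpace I x}
    (hQ : basisSum (fun e ↦ horTensor (S.ζ x) (S.ξL x) e (reebL (S.ζ x) (S.ξL x) e)) = Q) :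
    S.ricStarζ x = (1 : ℝ) • codiff (S.ξL x) (S.covξL x) (S.ζ x) +
      (S.dξζη x - Q
        + ((n : ℝ) - 1) • S.ξc n 9 x (S.lee n x) (S.ζ x)
        + ((n : ℝ) - 1) • S.ξc n 10 x (S.lee n x) (S.ζ x)
        + (2 : ℝ) • S.ξc n 9 x (S.ξζζ x) (S.ζ x)
        + S.ξc n 11 x (S.ζ x) (S.ξζζ x)) := by
  have hA : ∀ w u, reebL (S.ζ x) (S.covξL x w) (S.φ x u)
      = - S.φ x (reebL (S.ζ x) (S.covξL x w) u) := fun w u ↦ by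
    have := S.reebL_covξL (-1) (fun y u ↦ by rw [hL, neg_one_smul]) w u
    rwa [neg_one_smul] at this
  have h := (S.isPointData x).starRicci_ζ_eq_of_anti (S.horTrace_ξL hn hd x) (hL x) hA hQ
  rw [ricStarζ_eq, h, ξc11_ζ, ξζζ_eq, S.ξc9_ζ (hL x), S.ξc10_ζ (hL x),
    S.ξc9_ζ (hL x), dξζη_eq, one_smul]

/-! ### The four types -/

variable {S}

theorem IsOfType.anti_comm (h : S.IsOfType n {1, 2, 4, 5, 6, 7, 8, 11, 12}) :
    (∀ (y : M) (u v : TangentSpace I y), horTensor (S.ζ y) (S.ξL y) u v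
      + horTensor (S.ζ y) (S.ξL y) (S.φ y u) (S.φ y v)
      = (2 : ℝ) • leePart (S.φ y) (S.ζ y) (S.lee n y) u v) ∧
    ∀ (y : M) (u : TangentSpace I y),
      reebL (S.ζ y) (S.ξL y) (S.φ y u) = S.φ y (reebL (S.ζ y) (S.ξL y) u) := by
  have h1 := fun y ↦ anti_comm_of_type (S.isACM y) (T := S.ξL y) (h y)
  simp only [← lee_eq] at h1
  exact ⟨fun y ↦ (h1 y).1, fun y ↦ (h1 y).2⟩

theorem IsOfType.anti_anti (h : S.IsOfType n {1, 2, 4, 9, 10, 11, 12}) :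
    (∀ (y : M) (u v : TangentSpace I y), horTensor (S.ζ y) (S.ξL y) u v
      + horTensor (S.ζ y) (S.ξL y) (S.φ y u) (S.φ y v)
      = (2 : ℝ) • leePart (S.φ y) (S.ζ y) (S.lee n y) u v) ∧
    ∀ (y : M) (u : TangentSpace I y),
      reebL (S.ζ y) (S.ξL y) (S.φ y u) = - S.φ y (reebL (S.ζ y) (S.ξL y) u) := by
  have h1 := fun y ↦ anti_anti_of_type (S.isACM y) (T := S.ξL y) (h y)
  simp only [← lee_eq] at h1
  exact ⟨fun y ↦ (h1 y).1, fun y ↦ (h1 y).2⟩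

theorem IsOfType.comm_comm (h : S.IsOfType n {3, 4, 5, 6, 7, 8, 11, 12}) :
    (∀ (y : M) (u v : TangentSpace I y),
      horTensor (S.ζ y) (S.ξL y) (S.φ y u) (S.φ y v) = horTensor (S.ζ y) (S.ξL y) u v) ∧
    ∀ (y : M) (u : TangentSpace I y),
      reebL (S.ζ y) (S.ξL y) (S.φ y u) = S.φ y (reebL (S.ζ y) (S.ξL y) u) :=
  ⟨fun y ↦ (comm_comm_of_type (S.isACM y) (T := S.ξL y) (h y)).1,
    fun y ↦ (comm_comm_of_type (S.isACM y) (T := S.ξL y) (h y)).2⟩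

theorem IsOfType.comm_anti (h : S.IsOfType n {3, 4, 9, 10, 11, 12}) :
    (∀ (y : M) (u v : TangentSpace I y),
      horTensor (S.ζ y) (S.ξL y) (S.φ y u) (S.φ y v) = horTensor (S.ζ y) (S.ξL y) u v) ∧
    ∀ (y : M) (u : TangentSpace I y),
      reebL (S.ζ y) (S.ξL y) (S.φ y u) = - S.φ y (reebL (S.ζ y) (S.ξL y) u) :=
  ⟨fun y ↦ (comm_anti_of_type (S.isACM y) (T := S.ξL y) (h y)).1,
    fun y ↦ (comm_anti_of_type (S.isACM y) (T := S.ξL y) (h y)).2⟩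

variable (S) in
/-- The skew-symmetric part of `reebL` in terms of its components in `C_6` and `C_7`. -/
theorem inner_alongL_reebL_sub_adjoint (hn : 1 ≤ n) {x : M}
    (hL : ∀ u, reebL (S.ζ x) (S.ξL x) (S.φ x u) = S.φ x (reebL (S.ζ x) (S.ξL x) u))
    (X Y : TangentSpace I x) :
    ⟪alongL (S.ζ x) (S.ξL x) (reebL (S.ζ x) (S.ξL x) X
        - LinearMap.adjoint (reebL (S.ζ x) (S.ξL x)) X), Y⟫ =
      - 2 * S.ξcη n 7 x X (S.ξc n 11 x (S.ζ x) Y)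
      + S.codiffF x (S.ζ x) / n * ⟪S.ξc n 11 x (S.ζ x) (S.φ x X), Y⟫ := by
  have hn0 : (n : ℝ) ≠ 0 := by positivity
  have h1 : reebL (S.ζ x) (S.ξL x) X - LinearMap.adjoint (reebL (S.ζ x) (S.ξL x)) X =
      (2 : ℝ) • reeb7 n (S.φ x) (S.ζ x) (S.ξL x · ·) X
        + (S.codiffF x (S.ζ x) / n) • S.φ x X := by
    rw [reeb7_eq (S.isACM x) hL, codiffF_ζ]
    match_scalars <;> field_simp
    ring
  rw [h1, map_add, map_smul, map_smul, inner_add_left, real_inner_smul_left, real_inner_smul_left,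
    (S.isTorsion_ξL x).alongL_skew (S.isACM x), S.ξcη7_eq hL, ξc11_ζ, ξc11_ζ]
  ring

variable (S) in
theorem inner_ξc11_φ (x : M) (X Y : TangentSpace I x) :
    ⟪S.ξc n 11 x (S.ζ x) (S.φ x Y), X⟫ = - ⟪S.ξc n 11 x (S.ζ x) (S.φ x X), Y⟫ := by
  have h := S.isACM x
  have hT := S.isTorsion_ξL x
  rw [ξc11_ζ, ξc11_ζ, hT.alongL_φ h, inner_neg_left, h.inner_φ_left, hT.alongL_skew h,
    real_inner_comm _ Y, neg_neg]

variable (S) in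
theorem codiffη_eq_zero {x : M}
    (hL : ∀ u, reebL (S.ζ x) (S.ξL x) (S.φ x u) = - S.φ x (reebL (S.ζ x) (S.ξL x) u)) :
    S.codiffη x = 0 := by
  rw [codiffη_eq, reebTrace_eq_zero (S.isACM x) hL]

variable (S) in
theorem codiffF_ζ_eq_zero {x : M}
    (hL : ∀ u, reebL (S.ζ x) (S.ξL x) (S.φ x u) = - S.φ x (reebL (S.ζ x) (S.ξL x) u)) :
    S.codiffF x (S.ζ x) = 0 := by
  rw [codiffF_ζ, reebTraceφ_eq_zero (S.isACM x) hL]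

section Formulas

variable (S) (hn : 1 ≤ n) (hd : Module.finrank ℝ E = 2 * n + 1)

include hn hd

theorem ricStarζ_anti_comm (hL : ∀ (y : M) (u : TangentSpace I y),
      reebL (S.ζ y) (S.ξL y) (S.φ y u) = S.φ y (reebL (S.ζ y) (S.ξL y) u))
    (hK : ∀ (y : M) (u v : TangentSpace I y), horTensor (S.ζ y) (S.ξL y) u v
      + horTensor (S.ζ y) (S.ξL y) (S.φ y u) (S.φ y v)
      = (2 : ℝ) • leePart (S.φ y) (S.ζ y) (S.lee n y) u v) (x : M) :
    S.ricStarζ x = (-1 : ℝ) • codiff (S.ξL x) (S.covξL x) (S.ζ x) +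
      (- S.dξζη x
        - (((n : ℝ) - 1) / (4 * n) * S.codiffη x) • S.lee n x
        - ((2 * (n : ℝ) - 1) / 2) • S.ξc n 8 x (S.lee n x) (S.ζ x)
        - (3 * ((n : ℝ) - 1) / (4 * n) * S.codiffF x (S.ζ x)) • S.φ x (S.lee n x)
        - ((2 * (n : ℝ) - 3) / 2) • S.ξc n 7 x (S.lee n x) (S.ζ x)
        + (((n : ℝ) - 1) / n * S.codiffη x) • S.ξζζ x
        - (2 : ℝ) • S.ξc n 8 x (S.ξζζ x) (S.ζ x)
        + S.codiffF x (S.ζ x) • S.φ x (S.ξζζ x)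
        - S.ξc n 11 x (S.ζ x) (S.ξc n 12 x (S.ζ x) (S.ζ x))) := by
  have hQ := basisSum_horTensor_reebL_anti_comm (S.isACM x) (hL x) (hK x)
  rw [S.ricStarζ_of_comm hn hd hL x (hQ.trans (add_zero _).symm), add_zero]

theorem ricStarζ_anti_anti (hL : ∀ (y : M) (u : TangentSpace I y),
      reebL (S.ζ y) (S.ξL y) (S.φ y u) = - S.φ y (reebL (S.ζ y) (S.ξL y) u))
    (hK : ∀ (y : M) (u v : TangentSpace I y), horTensor (S.ζ y) (S.ξL y) u v
      + horTensor (S.ζ y) (S.ξL y) (S.φ y u) (S.φ y v)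
      = (2 : ℝ) • leePart (S.φ y) (S.ζ y) (S.lee n y) u v) (x : M) :
    S.ricStarζ x = (1 : ℝ) • codiff (S.ξL x) (S.covξL x) (S.ζ x) +
      (S.dξζη x
        - basisSum (fun e ↦ S.ξc n 1 x e (S.ξc n 10 x e (S.ζ x)))
        - basisSum (fun e ↦ S.ξc n 2 x e (S.ξc n 9 x e (S.ζ x) + S.ξc n 10 x e (S.ζ x)))
        + ((n : ℝ) - 1) • S.ξc n 9 x (S.lee n x) (S.ζ x)
        + ((n : ℝ) - 1) • S.ξc n 10 x (S.lee n x) (S.ζ x)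
        + (2 : ℝ) • S.ξc n 9 x (S.ξζζ x) (S.ζ x)
        + S.ξc n 11 x (S.ζ x) (S.ξc n 12 x (S.ζ x) (S.ζ x))) := by
  have hQ := basisSum_horTensor_reebL_anti_anti (S.isACM x) (S.isTorsion_ξL x) (hL x) (hK x)
  have h1 : ∀ e : TangentSpace I x, S.ξc n 1 x e (S.ξc n 10 x e (S.ζ x)) =
      comp1 (S.φ x) (S.ζ x) (S.ξL x · ·) e (reeb10 (S.φ x) (S.ζ x) (S.ξL x · ·) e) := fun e ↦ by
    rw [S.ξc10_ζ (hL x)]; rfl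
  have h2 : ∀ e : TangentSpace I x,
      S.ξc n 2 x e (S.ξc n 9 x e (S.ζ x) + S.ξc n 10 x e (S.ζ x)) =
      comp2 (S.φ x) (S.ζ x) (S.ξL x · ·) e (reeb9 (S.φ x) (S.ζ x) (S.ξL x · ·) e
        + reeb10 (S.φ x) (S.ζ x) (S.ξL x · ·) e) := fun e ↦ by
    rw [S.ξc10_ζ (hL x), S.ξc9_ζ (hL x)]; rfl
  rw [S.ricStarζ_of_anti hn hd hL x hQ, basisSum_congr h1, basisSum_congr h2, ξc12_ζ, ← ξζζ_eq,
    sub_sub]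

theorem ricStarζ_comm_comm (hL : ∀ (y : M) (u : TangentSpace I y),
      reebL (S.ζ y) (S.ξL y) (S.φ y u) = S.φ y (reebL (S.ζ y) (S.ξL y) u))
    (hK : ∀ (y : M) (u v : TangentSpace I y),
      horTensor (S.ζ y) (S.ξL y) (S.φ y u) (S.φ y v) = horTensor (S.ζ y) (S.ξL y) u v) (x : M) :
    S.ricStarζ x = (-1 : ℝ) • codiff (S.ξL x) (S.covξL x) (S.ζ x) +
      (- S.dξζη x - S.pairξ3 n 8 x - S.pairξ3 n 7 x
        - (((n : ℝ) - 1) / (4 * n) * S.codiffη x) • S.lee n x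
        - ((2 * (n : ℝ) - 1) / 2) • S.ξc n 8 x (S.lee n x) (S.ζ x)
        - (3 * ((n : ℝ) - 1) / (4 * n) * S.codiffF x (S.ζ x)) • S.φ x (S.lee n x)
        - ((2 * (n : ℝ) - 3) / 2) • S.ξc n 7 x (S.lee n x) (S.ζ x)
        + (((n : ℝ) - 1) / n * S.codiffη x) • S.ξζζ x
        - (2 : ℝ) • S.ξc n 8 x (S.ξζζ x) (S.ζ x)
        + S.codiffF x (S.ζ x) • S.φ x (S.ξζζ x)
        - S.ξc n 11 x (S.ζ x) (S.ξc n 12 x (S.ζ x) (S.ζ x))) := by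
  have hT := S.isTorsion_ξL x
  have hQ := basisSum_horTensor_reebL_comm_comm (S.isACM x) hT hd (S.hor_lee n x)
    (S.horTrace_ξL hn hd x) (hL x) (hK x) (S.lee_eq n x)
  have hP : ∀ (i : ℕ) (L : TangentSpace I x → TangentSpace I x),
      (∀ u, S.ξc n i x u (S.ζ x) = L u) → S.pairξ3 n i x =
        - basisSum fun e ↦ comp3 n (S.φ x) (S.ζ x) (S.ξL x · ·) e (L e) := fun i L hi ↦ by
    rw [pairξ3, ← sharp_formInner_comp3 (S.isACM x) hT (hK x) (S.lee_eq n x)]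
    simp only [hi]
    rfl
  rw [add_assoc] at hQ
  rw [S.ricStarζ_of_comm hn hd hL x hQ, hP 8 _ (S.ξc8_ζ (hL x)), hP 7 _ (S.ξc7_ζ (hL x)),
    sub_neg_eq_add, sub_neg_eq_add, ← add_assoc]

theorem inner_nablaξ11_comm_comm (hS : S.IsHarmonic) (hL : ∀ (y : M) (u : TangentSpace I y),
      reebL (S.ζ y) (S.ξL y) (S.φ y u) = S.φ y (reebL (S.ζ y) (S.ξL y) u))
    (hK : ∀ (y : M) (u v : TangentSpace I y),
      horTensor (S.ζ y) (S.ξL y) (S.φ y u) (S.φ y v) = horTensor (S.ζ y) (S.ξL y) u v)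
    (x : M) (X Y : TangentSpace I x) :
    ⟪S.nablaξ11 n x X, Y⟫ =
      - (((n : ℝ) - 1) / 2 * lambda20 (S.φ x) (extDeriv1 I (S.θ n) x) X Y)
      - ((n : ℝ) - 1) * ⟪S.ξc n 3 x (S.lee n x) X, Y⟫
      - ⟪S.ξc n 3 x (S.ξζζ x) X, Y⟫
      - S.wedgeTerm n x X Y
      + S.codiffη x * ⟪S.ξc n 11 x (S.ζ x) X, Y⟫
      - ((n : ℝ) - 2) / n * S.codiffF x (S.ζ x) * ⟪S.ξc n 11 x (S.ζ x) (S.φ x X), Y⟫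
      - 2 * S.ξcη n 7 x X (S.ξc n 11 x (S.ζ x) Y)
      + 2 * S.ξcη n 7 x Y (S.ξc n 11 x (S.ζ x) X) := by
  have hL' : ∀ (y : M) (u : TangentSpace I y), reebL (S.ζ y) (S.ξL y) (S.φ y u)
      = (1 : ℝ) • S.φ y (reebL (S.ζ y) (S.ξL y) u) := fun y u ↦ by rw [hL, one_smul]
  have h1 := S.ricStarAlt_of_comm hn hd (one_mul 1) hL' hK x X Y
  rw [S.isHarmonic_iff.1 hS, hor_zero, inner_zero_left,
    S.ricStarAlt_of_comm_of_symm hn hd (one_mul 1) hL' hK x X Y,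
    S.inner_alongL_reebL_sub_adjoint hn (hL x), S.inner_alongL_reebL_sub_adjoint hn (hL x),
    S.inner_ξc11_φ x X Y] at h1
  have hn0 : (n : ℝ) ≠ 0 := by positivity
  have h2 : ((n : ℝ) - 2) / n = 1 - 2 / n := by field_simp
  rw [h2]
  linear_combination h1

theorem inner_nablaξ11_comm_anti (hS : S.IsHarmonic) (hL : ∀ (y : M) (u : TangentSpace I y),
      reebL (S.ζ y) (S.ξL y) (S.φ y u) = - S.φ y (reebL (S.ζ y) (S.ξL y) u))
    (hK : ∀ (y : M) (u v : TangentSpace I y),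
      horTensor (S.ζ y) (S.ξL y) (S.φ y u) (S.φ y v) = horTensor (S.ζ y) (S.ξL y) u v)
    (x : M) (X Y : TangentSpace I x) :
    ⟪S.nablaξ11 n x X, Y⟫ =
      - (((n : ℝ) - 1) / 2 * lambda20 (S.φ x) (extDeriv1 I (S.θ n) x) X Y)
      - ((n : ℝ) - 1) * ⟪S.ξc n 3 x (S.lee n x) X, Y⟫
      - ⟪S.ξc n 3 x (S.ξζζ x) X, Y⟫
      - S.wedgeTerm n x X Y := by
  have hL' : ∀ (y : M) (u : TangentSpace I y), reebL (S.ζ y) (S.ξL y) (S.φ y u)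
      = (-1 : ℝ) • S.φ y (reebL (S.ζ y) (S.ξL y) u) := fun y u ↦ by rw [hL, neg_one_smul]
  have h1 := S.ricStarAlt_of_comm hn hd (by norm_num) hL' hK x X Y
  rw [S.isHarmonic_iff.1 hS, hor_zero, inner_zero_left,
    S.ricStarAlt_of_comm_of_symm hn hd (by norm_num) hL' hK x X Y,
    S.codiffη_eq_zero (hL x), S.codiffF_ζ_eq_zero (hL x)] at h1
  linear_combination h1

end Formulas

end AlmostContactMetric

end Characterization

end

end ACM

theorem theorem5p2 (n : ℕ) (hn : 1 ≤ n) {M : Type*} [TopologicalSpace M]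
    [ChartedSpace (EuclideanSpace ℝ (Fin (2 * n + 1))) M] [IsManifold (𝓡 (2 * n + 1)) ∞ M]
    [RiemannianBundle (fun x : M ↦ TangentSpace (𝓡 (2 * n + 1)) x)]
    [IsContMDiffRiemannianBundle (𝓡 (2 * n + 1)) ∞ (EuclideanSpace ℝ (Fin (2 * n + 1)))
      (fun x : M ↦ TangentSpace (𝓡 (2 * n + 1)) x)]
    (S : ACM.AlmostContactMetric (𝓡 (2 * n + 1)) M) :
    -- type A ⊕ C4 ⊕ C ⊕ E
    (S.IsOfType n {1, 2, 4, 5, 6, 7, 8, 11, 12} →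
      (S.IsHarmonic ↔
        (∀ (x : M) (X Y : TangentSpace (𝓡 (2 * n + 1)) x),
          S.ricStarAlt x (ACM.hor (S.ζ x) X) (ACM.hor (S.ζ x) Y) =
            ACM.lambda20 (S.φ x) (ACM.extDeriv1 (𝓡 (2 * n + 1)) (S.θ n) x) X Y
            + ((n : ℝ) - 3) * inner ℝ (S.ξc n 1 x (S.lee n x) X) Y
            + (n : ℝ) * inner ℝ (S.ξc n 2 x (S.lee n x) X) Y
            - S.codiffη x * inner ℝ (S.ξc n 11 x (S.ζ x) X) Y
            - S.codiffF x (S.ζ x) * inner ℝ (S.ξc n 11 x (S.ζ x) (S.φ x X)) Y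
            + inner ℝ (S.nablaξ11 n x X) Y
            + inner ℝ (S.ξc n 1 x (S.ξc n 12 x (S.ζ x) (S.ζ x)) X) Y
            + inner ℝ (S.ξc n 2 x (S.ξc n 12 x (S.ζ x) (S.ζ x)) X) Y
            + S.wedgeTerm n x X Y) ∧
        (∀ x : M,
          S.ricStarζ x =
            - S.dξζη x
            - (((n : ℝ) - 1) / (4 * n) * S.codiffη x) • S.lee n x
            - ((2 * (n : ℝ) - 1) / 2) • S.ξc n 8 x (S.lee n x) (S.ζ x)
            - (3 * ((n : ℝ) - 1) / (4 * n) * S.codiffF x (S.ζ x)) • S.φ x (S.lee n x)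
            - ((2 * (n : ℝ) - 3) / 2) • S.ξc n 7 x (S.lee n x) (S.ζ x)
            + (((n : ℝ) - 1) / n * S.codiffη x) • S.ξζζ x
            - (2 : ℝ) • S.ξc n 8 x (S.ξζζ x) (S.ζ x)
            + S.codiffF x (S.ζ x) • S.φ x (S.ξζζ x)
            - S.ξc n 11 x (S.ζ x) (S.ξc n 12 x (S.ζ x) (S.ζ x))))) ∧
    -- type A ⊕ C4 ⊕ D ⊕ E
    (S.IsOfType n {1, 2, 4, 9, 10, 11, 12} →
      (S.IsHarmonic ↔
        (∀ (x : M) (X Y : TangentSpace (𝓡 (2 * n + 1)) x),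
          S.ricStarAlt x (ACM.hor (S.ζ x) X) (ACM.hor (S.ζ x) Y) =
            ACM.lambda20 (S.φ x) (ACM.extDeriv1 (𝓡 (2 * n + 1)) (S.θ n) x) X Y
            + ((n : ℝ) - 3) * inner ℝ (S.ξc n 1 x (S.lee n x) X) Y
            + (n : ℝ) * inner ℝ (S.ξc n 2 x (S.lee n x) X) Y
            + inner ℝ (S.nablaξ11 n x X) Y
            + inner ℝ (S.ξc n 1 x (S.ξc n 12 x (S.ζ x) (S.ζ x)) X) Y
            + inner ℝ (S.ξc n 2 x (S.ξc n 12 x (S.ζ x) (S.ζ x)) X) Y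
            + S.wedgeTerm n x X Y) ∧
        (∀ x : M,
          S.ricStarζ x =
            S.dξζη x
            - ACM.basisSum (fun e ↦ S.ξc n 1 x e (S.ξc n 10 x e (S.ζ x)))
            - ACM.basisSum (fun e ↦
                S.ξc n 2 x e (S.ξc n 9 x e (S.ζ x) + S.ξc n 10 x e (S.ζ x)))
            + ((n : ℝ) - 1) • S.ξc n 9 x (S.lee n x) (S.ζ x)
            + ((n : ℝ) - 1) • S.ξc n 10 x (S.lee n x) (S.ζ x)
            + (2 : ℝ) • S.ξc n 9 x (S.ξζζ x) (S.ζ x)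
            + S.ξc n 11 x (S.ζ x) (S.ξc n 12 x (S.ζ x) (S.ζ x))))) ∧
    -- type B ⊕ C ⊕ E
    (S.IsOfType n {3, 4, 5, 6, 7, 8, 11, 12} →
      ((S.IsHarmonic ↔
        (∀ (x : M) (X Y : TangentSpace (𝓡 (2 * n + 1)) x),
          S.ricStarAlt x (ACM.hor (S.ζ x) X) (ACM.hor (S.ζ x) Y) =
            - (((n : ℝ) - 1) * inner ℝ (S.ξc n 3 x (S.lee n x) X) Y)
            - inner ℝ (S.nablaξ11 n x X) Y
            - inner ℝ (S.ξc n 3 x (S.ξζζ x) X) Y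
            - S.wedgeTerm n x X Y
            + S.codiffη x * inner ℝ (S.ξc n 11 x (S.ζ x) X) Y
            - S.codiffF x (S.ζ x) * inner ℝ (S.ξc n 11 x (S.ζ x) (S.φ x X)) Y) ∧
        (∀ x : M,
          S.ricStarζ x =
            - S.dξζη x
            - S.pairξ3 n 8 x
            - S.pairξ3 n 7 x
            - (((n : ℝ) - 1) / (4 * n) * S.codiffη x) • S.lee n x
            - ((2 * (n : ℝ) - 1) / 2) • S.ξc n 8 x (S.lee n x) (S.ζ x)
            - (3 * ((n : ℝ) - 1) / (4 * n) * S.codiffF x (S.ζ x)) • S.φ x (S.lee n x)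
            - ((2 * (n : ℝ) - 3) / 2) • S.ξc n 7 x (S.lee n x) (S.ζ x)
            + (((n : ℝ) - 1) / n * S.codiffη x) • S.ξζζ x
            - (2 : ℝ) • S.ξc n 8 x (S.ξζζ x) (S.ζ x)
            + S.codiffF x (S.ζ x) • S.φ x (S.ξζζ x)
            - S.ξc n 11 x (S.ζ x) (S.ξc n 12 x (S.ζ x) (S.ζ x)))) ∧
      (S.IsHarmonic →
        ∀ (x : M) (X Y : TangentSpace (𝓡 (2 * n + 1)) x),
          inner ℝ (S.nablaξ11 n x X) Y =
            - (((n : ℝ) - 1) / 2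
                * ACM.lambda20 (S.φ x) (ACM.extDeriv1 (𝓡 (2 * n + 1)) (S.θ n) x) X Y)
            - ((n : ℝ) - 1) * inner ℝ (S.ξc n 3 x (S.lee n x) X) Y
            - inner ℝ (S.ξc n 3 x (S.ξζζ x) X) Y
            - S.wedgeTerm n x X Y
            + S.codiffη x * inner ℝ (S.ξc n 11 x (S.ζ x) X) Y
            - ((n : ℝ) - 2) / n * S.codiffF x (S.ζ x)
                * inner ℝ (S.ξc n 11 x (S.ζ x) (S.φ x X)) Y
            - 2 * S.ξcη n 7 x X (S.ξc n 11 x (S.ζ x) Y)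
            + 2 * S.ξcη n 7 x Y (S.ξc n 11 x (S.ζ x) X)))) ∧
    -- type B ⊕ D ⊕ E
    (S.IsOfType n {3, 4, 9, 10, 11, 12} →
      ((S.IsHarmonic ↔
        (∀ (x : M) (X Y : TangentSpace (𝓡 (2 * n + 1)) x),
          S.ricStarAlt x (ACM.hor (S.ζ x) X) (ACM.hor (S.ζ x) Y) =
            - (((n : ℝ) - 1) * inner ℝ (S.ξc n 3 x (S.lee n x) X) Y)
            - inner ℝ (S.nablaξ11 n x X) Y
            - inner ℝ (S.ξc n 3 x (S.ξζζ x) X) Y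
            - S.wedgeTerm n x X Y) ∧
        (∀ x : M,
          S.ricStarζ x =
            S.dξζη x
            + ((n : ℝ) - 1) • S.ξc n 9 x (S.lee n x) (S.ζ x)
            + ((n : ℝ) - 1) • S.ξc n 10 x (S.lee n x) (S.ζ x)
            + (2 : ℝ) • S.ξc n 9 x (S.ξζζ x) (S.ζ x)
            + S.ξc n 11 x (S.ζ x) (S.ξζζ x))) ∧
      (S.IsHarmonic →
        ∀ (x : M) (X Y : TangentSpace (𝓡 (2 * n + 1)) x),
          inner ℝ (S.nablaξ11 n x X) Y =
            - (((n : ℝ) - 1) / 2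
                * ACM.lambda20 (S.φ x) (ACM.extDeriv1 (𝓡 (2 * n + 1)) (S.θ n) x) X Y)
            - ((n : ℝ) - 1) * inner ℝ (S.ξc n 3 x (S.lee n x) X) Y
            - inner ℝ (S.ξc n 3 x (S.ξζζ x) X) Y
            - S.wedgeTerm n x X Y))) := by
  have hd : Module.finrank ℝ (EuclideanSpace ℝ (Fin (2 * n + 1))) = 2 * n + 1 := by simp
  have hε : (-1 : ℝ) * -1 = 1 := by norm_num
  have hneg : (-1 : ℝ) ≠ 0 := by norm_num
  refine ⟨fun h ↦ ?_, fun h ↦ ?_, fun h ↦ ?_, fun h ↦ ?_⟩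
  · obtain ⟨hK, hL⟩ := h.anti_comm
    exact S.isHarmonic_iff_of_eq one_ne_zero hneg
      (S.ricStarAlt_of_anti hn hd (one_mul 1) (by simpa only [one_smul] using hL) hK)
      (S.ricStarζ_anti_comm hn hd hL hK)
  · obtain ⟨hK, hL⟩ := h.anti_anti
    refine S.isHarmonic_iff_of_eq one_ne_zero one_ne_zero (fun x X Y ↦ ?_)
      (S.ricStarζ_anti_anti hn hd hL hK)
    rw [S.ricStarAlt_of_anti hn hd hε (by simpa only [neg_one_smul] using hL) hK,
      S.codiffη_eq_zero (hL x), S.codiffF_ζ_eq_zero (hL x)]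
    ring
  · obtain ⟨hK, hL⟩ := h.comm_comm
    exact ⟨S.isHarmonic_iff_of_eq hneg hneg
      (S.ricStarAlt_of_comm hn hd (one_mul 1) (by simpa only [one_smul] using hL) hK)
      (S.ricStarζ_comm_comm hn hd hL hK), fun hS ↦ S.inner_nablaξ11_comm_comm hn hd hS hL hK⟩
  · obtain ⟨hK, hL⟩ := h.comm_anti
    refine ⟨S.isHarmonic_iff_of_eq hneg one_ne_zero (fun x X Y ↦ ?_) fun x ↦ ?_,
      fun hS ↦ S.inner_nablaξ11_comm_anti hn hd hS hL hK⟩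
    · rw [S.ricStarAlt_of_comm hn hd hε (by simpa only [neg_one_smul] using hL) hK,
        S.codiffη_eq_zero (hL x), S.codiffF_ζ_eq_zero (hL x)]
      ring
    · rw [S.ricStarζ_of_anti hn hd hL x
        (ACM.basisSum_horTensor_reebL_comm_anti (S.isACM x) (hL x) (hK x)), sub_zero]
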